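/- **Setup.** Let $\mathcal D$ be a random training set of $n$ points in $\mathcal X\times\mathbb R$, where $\mathcal X$ is an arbitrary measurable space. Let $\xi_1,\xi_2,\dots$ be i.i.d. randomizing parameters, independent of $\mathcal D$. Let $\varphi$ be a deterministic (measurable) function, and let $T_i(x)=\varphi(x;\mathcal D,\xi_i)$ (assumption A1), $\bar T_t=\frac1t\sum_{i=1}^tT_i$ and $\vartheta(x)=\mathbb E[T_1(x)\mid\mathcal D]$, the expectation being over $\xi_1$ only. Let $\nu$ be a probability distribution on $\mathcal X\times\mathbb R$ (the law of a test point $(X,Y)$ independent of everything else), let $\langle g,h\rangle=\int gh\,d\nu$ and $\|g\|_{L_2}=\sqrt{\langle g,g\rangle}$, and put $$\psi(f)=\int (y-f(x))^2\,d\nu(x,y),\qquad \mathrm{mse}_t=\psi(\bar T_t),\qquad \mathrm{mse}_\infty=\psi(\vartheta).$$ Write $y$ for the function $(x,y)\mapsto y$, and define $\zeta=2\langle\vartheta-y,\,T_1-\vartheta\rangle$, $\sigma(\mathcal D)=\sqrt{\operatorname{var}(\zeta\mid\mathcal D)}$ and, for positive integers $k$, $$\beta_k(\mathcal D)=\max\Big\{\big(\mathbb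 E[\|T_1-y\|_{L_2}^{2k}\mid\mathcal D]\big)^{1/k},\ \big(\mathbb E[\|T_1-\vartheta\|_{L_2}^{2k}\mid\mathcal D]\big)^{1/k}\Big\}\in[0,\infty].$$ **Bootstrap.** Given $\mathcal D$ and $\xi_1,\xi_2,\dots$, draw for each $b=1,\dots,B$, independently, functions $T^*_{b,1},\dots,T^*_{b,t}$ uniformly with replacement from $(T_1,\dots,T_t)$. Let $z_b=\psi\big(\frac1t\sum_{i=1}^tT^*_{b,i}\big)-\psi(\bar T_t)$, and let $\hat q_{1-\alpha}(t)=\inf\{s\in\mathbb R:\ \frac1B\#\{b:z_b\le s\}\ge 1-\alpha\}$ be the empirical $(1-\alpha)$-quantile of $z_1,\dots,z_B$. **Theorem.** There is an absolute constant $c_0>0$ such that the following holds for all choices of the above objects, all integers $t\ge1$, $k\ge2$, $B\ge2$ and all $\alpha\in(0,1)$. Almost surely, whenever $\beta_{3k}(\mathcal D)<\infty$ (assumption A2), $\mathrm{mse}_m\to\mathrm{mse}_\infty$ as $m\to\infty$ and $$\mathbb P\big(\mathrm{mse}_t-\mathrm{mse}_\infty\le\hat q_{1-\alpha}(t)\,\big|\,\mathcal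 D\big)\ \ge\ 1-\alpha-c_0\,\delta_{t,k,B}(\mathcal D),$$ $$\delta_{t,k,B}(\mathcal D)=\frac{k^2}{\sqrt t}\Big(\frac{\beta_{3k}(\mathcal D)}{\sigma(\mathcal D)}\Big)^3+e^{-k/2}+\sqrt{\frac{\log B}{B}},$$ where the ratio $\beta_{3k}(\mathcal D)/\sigma(\mathcal D)$ is read as $\infty$ (so that the bound is trivial) when $\sigma(\mathcal D)=0$. -/

import Mathlib

open MeasureTheory ProbabilityTheory Filter Topology
open scoped ENNReal

noncomputable section

namespace RandomizedEnsemble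

/-- Training sets of size `n` in `𝒳 × ℝ`. -/
abbrev Dataset (𝒳 : Type*) (n : ℕ) : Type _ := Fin n → 𝒳 × ℝ

/-- The averaged regression function `x ↦ (1/t) ∑ᵢ fᵢ(x)`. -/
def average {𝒳 : Type*} {t : ℕ} (f : Fin t → 𝒳 → ℝ) (x : 𝒳) : ℝ :=
  (1 / (t : ℝ)) * ∑ i, f i x

/-- The mean-squared error functional `ψ(f) = ∫ (y - f(x))² dν(x, y)`. -/
def psi {𝒳 : Type*} [MeasurableSpace 𝒳] (ν : Measure (𝒳 × ℝ)) (f : 𝒳 → ℝ) : ℝ :=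
  ∫ z, (z.2 - f z.1) ^ 2 ∂ν

section FixedData

/- In this section the training set is held fixed: `T s : 𝒳 → ℝ` is the regression function obtained
from the randomizing parameter `s`, the law of the randomizing parameter is `Q`, and the law of the
test point is `ν`. -/

variable {𝒳 Ξ : Type*} [MeasurableSpace 𝒳] [MeasurableSpace Ξ]

/-- `ϑ(x)`, the expectation of `T(x)` over the randomizing parameter. -/
def vartheta (Q : Measure Ξ) (T : Ξ → 𝒳 → ℝ) (x : 𝒳) : ℝ :=
  ∫ s, T s x ∂Q

/-- `mse_∞ = ψ(ϑ)`. -/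
def mseInf (ν : Measure (𝒳 × ℝ)) (Q : Measure Ξ) (T : Ξ → 𝒳 → ℝ) : ℝ :=
  psi ν (vartheta Q T)

/-- The inner product `⟨g, h⟩ = ∫ g h dν`. -/
def innerL2 (ν : Measure (𝒳 × ℝ)) (g h : 𝒳 × ℝ → ℝ) : ℝ :=
  ∫ z, g z * h z ∂ν

/-- The random variable `ζ = 2 ⟨ϑ - y, T - ϑ⟩`, as a function of the randomizing parameter. -/
def zeta (ν : Measure (𝒳 × ℝ)) (Q : Measure Ξ) (T : Ξ → 𝒳 → ℝ) (s : Ξ) : ℝ :=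
  2 * innerL2 ν (fun z => vartheta Q T z.1 - z.2) (fun z => T s z.1 - vartheta Q T z.1)

/-- `σ`, the standard deviation of `ζ`. -/
def sigma (ν : Measure (𝒳 × ℝ)) (Q : Measure Ξ) (T : Ξ → 𝒳 → ℝ) : ℝ :=
  Real.sqrt (variance (zeta ν Q T) Q)

/-- The moment parameter
`β_k = max { (E ‖T - y‖_{L₂}^{2k})^{1/k}, (E ‖T - ϑ‖_{L₂}^{2k})^{1/k} }`, possibly infinite. -/
def beta (ν : Measure (𝒳 × ℝ)) (Q : Measure Ξ) (T : Ξ → 𝒳 → ℝ) (k : ℕ) : ℝ≥0∞ :=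
  max
    ((∫⁻ s, eLpNorm (fun z : 𝒳 × ℝ => T s z.1 - z.2) 2 ν ^ (2 * k) ∂Q) ^ (1 / (k : ℝ)))
    ((∫⁻ s, eLpNorm (fun z : 𝒳 × ℝ => T s z.1 - vartheta Q T z.1) 2 ν ^ (2 * k) ∂Q)
      ^ (1 / (k : ℝ)))

open scoped Classical in
/-- The error term `δ = (k²/√t) (β_{3k}/σ)³ + e^{-k/2} + √(log B / B)`, where the ratio is read as
`∞` if `σ = 0`. -/
def delta (ν : Measure (𝒳 × ℝ)) (Q : Measure Ξ) (T : Ξ → 𝒳 → ℝ) (t k B : ℕ) : ℝ≥0∞ :=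
  ENNReal.ofReal ((k : ℝ) ^ 2 / Real.sqrt t) *
      (if sigma ν Q T = 0 then ∞ else beta ν Q T (3 * k) / ENNReal.ofReal (sigma ν Q T)) ^ 3
    + ENNReal.ofReal (Real.exp (-(k : ℝ) / 2))
    + ENNReal.ofReal (Real.sqrt (Real.log B / B))

end FixedData

/-- The bootstrap sample `ψ(T̄*) - ψ(T̄)`, where `T*ᵢ = T_{J i}` for the resampled indices `J`. -/
def bootSample {𝒳 : Type*} [MeasurableSpace 𝒳] (ν : Measure (𝒳 × ℝ)) {t : ℕ}
    (T : Fin t → 𝒳 → ℝ) (J : Fin t → Fin t) : ℝ :=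
  psi ν (average fun i => T (J i)) - psi ν (average T)

/-- The empirical distribution function of `z₁, …, z_B`. -/
def empiricalCDF {B : ℕ} (z : Fin B → ℝ) (s : ℝ) : ℝ :=
  (1 / (B : ℝ)) * ∑ b, Set.indicator {r : ℝ | r ≤ s} (fun _ => (1 : ℝ)) (z b)

/-- The empirical `p`-quantile of `z₁, …, z_B`. -/
def empiricalQuantile {B : ℕ} (p : ℝ) (z : Fin B → ℝ) : ℝ :=
  sInf {s : ℝ | p ≤ empiricalCDF z s}

end RandomizedEnsemble

end

noncomputable section

namespace RandomizedEnsemble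

/-! ### Stein's equation for the standard normal distribution -/

/-! Fix the training set and work in `L²(ν)` with `g = ϑ - y` and `Xᵢ = Tᵢ - ϑ`. Then `mse_t = ‖g +
X̄‖²` and `mse_∞ = ‖g‖²`, so `mse_t - mse_∞` is the mean of the centred real variables `ζᵢ = 2⟨g,
Xᵢ⟩` plus the square `‖X̄‖²`. The mean is asymptotically normal at scale `σ/√t` with an explicit
rate (`berry_esseen`). The square has order `kβ/t` outside an event of probability `e^{-k}`, by a
moment inequality for sums of independent vectors (`moment_sum_le`) and Markov's inequality for
`k`-th powers.

Under-coverage occurs only if the bootstrap quantile is too small, so a one-sided estimate suffices: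
an upper bound for the bootstrap distribution function. A bootstrap deviation is `2⟨g + X̄, X̄* -
X̄⟩ + ‖X̄* - X̄‖²`, and dropping the last term only enlarges that probability. What remains is a
mean of `t` independent draws from a finite centred population, to which `berry_esseen` applies
again. On a good event for the sample (`GoodSample`) the variance of this population is `σ²(1 +
O(η))`, with `η = (k²/√t)(β/σ)³`, and its fourth moment is `O(β⁴)`; hence the normal limit is the
same up to `O(η)` (`GoodSample.bootstrap_cdf_le`).

The quantile falls below `m` exactly when at least `(1 - α)B` of the bootstrap values do. By
Hoeffding's inequality (`count_ge_le`) this has probability at most `ε = √(log B / B)` unless the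
bootstrap distribution function at `m` exceeds `1 - α - ε`. At `m = mse_t - mse_∞` the normal
approximation makes the latter an event of probability about `α` (`CenteredModel.coverage`).

Berry–Esseen itself is proved by Stein's method with induction on the number of summands: the
induction hypothesis supplies the concentration of leave-one-out sums that the smoothing argument
needs.

Finally, the data are independent of all the other randomness, so conditioning on them amounts to
freezing them (`condExp_indicator_of_indepFun`). Since `𝒳` is arbitrary, `L²(ν)` may be
nonseparable; measurability is therefore required only of inner products, never of the vectors
themselves. -/

/-- The standard normal density. -/
abbrev stdPDF : ℝ → ℝ := gaussianPDFReal 0 1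

lemma stdPDF_eq (x : ℝ) : stdPDF x = (√(2 * Real.pi))⁻¹ * Real.exp (-(x ^ 2 / 2)) := by
  simp [stdPDF, gaussianPDFReal_def, neg_div]

lemma stdPDF_pos (x : ℝ) : 0 < stdPDF x := gaussianPDFReal_pos 0 1 x (by norm_num)

lemma stdPDF_neg (x : ℝ) : stdPDF (-x) = stdPDF x := by simp [stdPDF_eq]

lemma hasDerivAt_stdPDF (x : ℝ) : HasDerivAt stdPDF (-(x * stdPDF x)) x := by
  have h : HasDerivAt (fun x : ℝ => (√(2 * Real.pi))⁻¹ * Real.exp (-(x ^ 2 / 2)))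
      ((√(2 * Real.pi))⁻¹ * (Real.exp (-(x ^ 2 / 2)) * -((2 : ℕ) * x ^ (2 - 1) * 1 / 2))) x :=
    ((((hasDerivAt_id x).pow 2).div_const 2).neg.exp).const_mul _
  have e : stdPDF = fun x : ℝ => (√(2 * Real.pi))⁻¹ * Real.exp (-(x ^ 2 / 2)) :=
    funext stdPDF_eq
  rw [e]
  convert h using 1
  norm_num
  ring

lemma continuous_stdPDF : Continuous stdPDF :=
  continuous_iff_continuousAt.2 fun x => (hasDerivAt_stdPDF x).continuousAt

lemma integrable_stdPDF : Integrable stdPDF := integrable_gaussianPDFReal 0 1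

lemma integral_stdPDF : ∫ x, stdPDF x = 1 := integral_gaussianPDFReal_eq_one 0 (by norm_num)

lemma stdPDF_le_half (x : ℝ) : stdPDF x ≤ 1 / 2 := by
  rw [stdPDF_eq]
  have h1 : Real.exp (-(x ^ 2 / 2)) ≤ 1 := Real.exp_le_one_iff.2 (by nlinarith [sq_nonneg x])
  have h2 : 2 ≤ √(2 * Real.pi) := Real.le_sqrt_of_sq_le (by nlinarith [Real.pi_gt_three])
  have h3 : (√(2 * Real.pi))⁻¹ ≤ 1 / 2 := by
    rw [one_div]; exact inv_anti₀ (by norm_num) h2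
  calc _ ≤ (1 / 2 : ℝ) * 1 := mul_le_mul h3 h1 (Real.exp_pos _).le (by norm_num)
    _ = _ := by norm_num

lemma tendsto_stdPDF_atTop : Tendsto stdPDF atTop (𝓝 0) := by
  have e : stdPDF = fun x : ℝ => (√(2 * Real.pi))⁻¹ * Real.exp (-(x ^ 2 / 2)) :=
    funext stdPDF_eq
  rw [e]
  rw [← mul_zero (√(2 * Real.pi))⁻¹]
  refine Tendsto.const_mul _ (Real.tendsto_exp_neg_atTop_nhds_zero.comp ?_)
  exact (tendsto_pow_atTop (by norm_num)).atTop_div_const (by norm_num)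

lemma integrable_mul_stdPDF : Integrable fun x => x * stdPDF x := by
  have h := (integrable_mul_exp_neg_mul_sq (b := 1 / 2) (by norm_num)).const_mul
    (√(2 * Real.pi))⁻¹
  refine h.congr (ae_of_all _ fun x => ?_)
  simp only [stdPDF_eq]
  ring_nf

lemma setIntegral_Ioi_mul_stdPDF (w : ℝ) : ∫ x in Set.Ioi w, x * stdPDF x = stdPDF w := by
  have h := integral_Ioi_of_hasDerivAt_of_tendsto (a := w) (f := fun x => -stdPDF x)
    (f' := fun x => x * stdPDF x) (m := 0) (continuous_stdPDF.neg.continuousWithinAt)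
    (fun x _ => by
      have h := (hasDerivAt_stdPDF x).neg
      rw [neg_neg] at h
      exact h) integrable_mul_stdPDF.integrableOn
    (by simpa using tendsto_stdPDF_atTop.neg)
  simpa using h

/-- On the half-line `w` is below the variable, and `x * stdPDF x` has primitive `-stdPDF`. This
Mills-type bound controls Stein solutions in the tails, and later the tails of `stdCDF`. -/
lemma mul_setIntegral_Ioi_stdPDF_le (w : ℝ) :
    w * ∫ x in Set.Ioi w, stdPDF x ≤ stdPDF w := by
  rw [← setIntegral_Ioi_mul_stdPDF w, ← integral_const_mul]
  refine setIntegral_mono_on (integrable_stdPDF.const_mul _).integrableOn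
    integrable_mul_stdPDF.integrableOn measurableSet_Ioi fun x hx => ?_
  exact mul_le_mul_of_nonneg_right (le_of_lt hx) (stdPDF_pos x).le

lemma setIntegral_Iic_stdPDF (w : ℝ) :
    ∫ x in Set.Iic w, stdPDF x = ∫ x in Set.Ioi (-w), stdPDF x := by
  rw [← integral_comp_neg_Iic]
  simp [stdPDF_neg]

lemma neg_mul_setIntegral_Iic_stdPDF_le (w : ℝ) :
    -w * ∫ x in Set.Iic w, stdPDF x ≤ stdPDF w := by
  rw [setIntegral_Iic_stdPDF, ← stdPDF_neg w]
  exact mul_setIntegral_Ioi_stdPDF_le (-w)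

lemma setIntegral_Iic_add_Ioi_stdPDF (w : ℝ) :
    (∫ x in Set.Iic w, stdPDF x) + ∫ x in Set.Ioi w, stdPDF x = 1 := by
  rw [intervalIntegral.integral_Iic_add_Ioi integrable_stdPDF.integrableOn
    integrable_stdPDF.integrableOn, integral_stdPDF]

/-- Existence of a solution of Stein's equation `f' = w f + q` with uniform bounds. -/
theorem exists_stein_solution {q : ℝ → ℝ} (hq : Continuous q) (hq1 : ∀ x, |q x| ≤ 1)
    (hq0 : ∫ x, q x * stdPDF x = 0) :
    ∃ f : ℝ → ℝ, (∀ w, HasDerivAt f (w * f w + q w) w) ∧ (∀ w, |f w| ≤ 3) ∧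
      ∀ w, |w * f w| ≤ 1 := by
  have hc : Continuous fun x => q x * stdPDF x := hq.mul continuous_stdPDF
  have hint : Integrable fun x => q x * stdPDF x :=
    integrable_stdPDF.bdd_mul (c := 1) hq.aestronglyMeasurable (ae_of_all _ hq1)
  -- The integrating factor of the equation gives the solution `F / stdPDF`. Because `q` has
  -- Gaussian mean zero, `F w` is bounded by either tail of the normal law, whichever is more
  -- useful.
  set F : ℝ → ℝ := fun w => ∫ x in Set.Iic w, q x * stdPDF x with hF
  have hbound : ∀ x, |q x * stdPDF x| ≤ stdPDF x := fun x => by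
    rw [abs_mul, abs_of_pos (stdPDF_pos x)]
    exact mul_le_of_le_one_left (stdPDF_pos x).le (hq1 x)
  have hF1 : ∀ w, |F w| ≤ ∫ x in Set.Iic w, stdPDF x := fun w =>
    (abs_integral_le_integral_abs).trans
      (integral_mono hint.abs.integrableOn integrable_stdPDF.integrableOn hbound)
  have hF2 : ∀ w, |F w| ≤ ∫ x in Set.Ioi w, stdPDF x := fun w => by
    have h := intervalIntegral.integral_Iic_add_Ioi (b := w) hint.integrableOn hint.integrableOn
    rw [hq0] at h
    have h' : F w = -∫ x in Set.Ioi w, q x * stdPDF x := by simp only [hF]; linarith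
    rw [h', abs_neg]
    exact (abs_integral_le_integral_abs).trans
      (integral_mono hint.abs.integrableOn integrable_stdPDF.integrableOn hbound)
  have hFd : ∀ w, HasDerivAt F (q w * stdPDF w) w := fun w => by
    have h1 : HasDerivAt (fun u => ∫ x in (0 : ℝ)..u, q x * stdPDF x) (q w * stdPDF w) w :=
      intervalIntegral.integral_hasDerivAt_right (hc.intervalIntegrable _ _)
        (hc.stronglyMeasurableAtFilter _ _) hc.continuousAt
    have h2 : F = fun u => F 0 + ∫ x in (0 : ℝ)..u, q x * stdPDF x := by
      funext u
      rw [← intervalIntegral.integral_Iic_sub_Iic hint.integrableOn hint.integrableOn]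
      simp [hF]
    rw [h2]
    exact h1.const_add _
  have hmul : ∀ w, |w| * |F w| ≤ stdPDF w := fun w => by
    rcases le_total 0 w with h | h
    · rw [abs_of_nonneg h]
      exact (mul_le_mul_of_nonneg_left (hF2 w) h).trans (mul_setIntegral_Ioi_stdPDF_le w)
    · rw [abs_of_nonpos h]
      exact (mul_le_mul_of_nonneg_left (hF1 w) (by linarith)).trans
        (neg_mul_setIntegral_Iic_stdPDF_le w)
  have hwf : ∀ w, |w * (F w / stdPDF w)| ≤ 1 := fun w => by
    rw [← mul_div_assoc, abs_div, abs_mul, abs_of_pos (stdPDF_pos w), div_le_one (stdPDF_pos w)]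
    exact hmul w
  refine ⟨fun w => F w / stdPDF w, fun w => ?_, fun w => ?_, hwf⟩
  · have h := (hFd w).div (hasDerivAt_stdPDF w) (stdPDF_pos w).ne'
    have h0 := (stdPDF_pos w).ne'
    have e : (q w * stdPDF w * stdPDF w - F w * -(w * stdPDF w)) / stdPDF w ^ 2 =
        w * (F w / stdPDF w) + q w := by
      rw [div_eq_iff (pow_ne_zero 2 h0), add_mul,
        show w * (F w / stdPDF w) * stdPDF w ^ 2 =
          w * F w * stdPDF w * (stdPDF w / stdPDF w) by ring, div_self h0]
      ring
    rw [e] at h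
    exact h
  -- For `|w| ≥ 1` the bound follows from `|w f w| ≤ 1`. For `|w| ≤ 1` the smaller of the two tails
  -- is at most `1/2`, while the density is at least `1/6`.
  · rcases le_total 1 |w| with h | h
    · have := hwf w
      rw [abs_mul] at this
      nlinarith [abs_nonneg (F w / stdPDF w)]
    · have h1 : |F w| ≤ 1 / 2 := by
        have := hF1 w; have := hF2 w; have := setIntegral_Iic_add_Ioi_stdPDF w; linarith
      have h2 : 1 / 6 ≤ stdPDF w := by
        rw [stdPDF_eq]
        have ha : Real.exp (-(1 / 2)) ≤ Real.exp (-(w ^ 2 / 2)) := by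
          apply Real.exp_le_exp.2
          have : w ^ 2 ≤ 1 := by rw [← sq_abs]; nlinarith [abs_nonneg w]
          linarith
        have hb : (1 / 2 : ℝ) ≤ Real.exp (-(1 / 2)) := by
          have := Real.add_one_le_exp (-(1 / 2) : ℝ); linarith
        have hcc : √(2 * Real.pi) ≤ 3 := by
          rw [Real.sqrt_le_left (by norm_num)]
          nlinarith [Real.pi_lt_d2]
        have hd : (1 / 3 : ℝ) ≤ (√(2 * Real.pi))⁻¹ := by
          rw [one_div]; exact inv_anti₀ (by positivity) hcc
        calc (1 / 6 : ℝ) = (1 / 3) * (1 / 2) := by norm_num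
          _ ≤ _ := mul_le_mul hd (hb.trans ha) (by norm_num) (by positivity)
      rw [abs_div, abs_of_pos (stdPDF_pos w), div_le_iff₀ (stdPDF_pos w)]
      linarith

/-- The standard normal distribution function. -/
def stdCDF (x : ℝ) : ℝ := ∫ u in Set.Iic x, stdPDF u

lemma stdCDF_sub (a b : ℝ) : stdCDF b - stdCDF a = ∫ u in a..b, stdPDF u :=
  intervalIntegral.integral_Iic_sub_Iic integrable_stdPDF.integrableOn
    integrable_stdPDF.integrableOn

lemma stdCDF_mono : Monotone stdCDF := fun a b hab => by
  have := stdCDF_sub a b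
  have h2 : 0 ≤ ∫ u in a..b, stdPDF u :=
    intervalIntegral.integral_nonneg hab fun u _ => (stdPDF_pos u).le
  linarith

lemma stdCDF_nonneg (x : ℝ) : 0 ≤ stdCDF x :=
  integral_nonneg fun u => (stdPDF_pos u).le

lemma stdCDF_le_one (x : ℝ) : stdCDF x ≤ 1 := by
  have h1 := setIntegral_Iic_add_Ioi_stdPDF x
  have h2 : 0 ≤ ∫ u in Set.Ioi x, stdPDF u := integral_nonneg fun u => (stdPDF_pos u).le
  unfold stdCDF
  linarith

lemma stdCDF_sub_le {a b : ℝ} (hab : a ≤ b) : stdCDF b - stdCDF a ≤ (b - a) / 2 := by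
  rw [stdCDF_sub]
  calc ∫ u in a..b, stdPDF u ≤ ∫ _ in a..b, (1 / 2 : ℝ) :=
        intervalIntegral.integral_mono_on hab (continuous_stdPDF.intervalIntegrable _ _)
          (continuous_const.intervalIntegrable _ _) fun x _ => stdPDF_le_half x
    _ = _ := by rw [intervalIntegral.integral_const, smul_eq_mul]; ring

lemma stdCDF_add_le {a c : ℝ} (hc : 0 ≤ c) : stdCDF (a + c) ≤ stdCDF a + c / 2 := by
  have := stdCDF_sub_le (show a ≤ a + c by linarith)
  linarith [add_sub_cancel_left a c]

/-! ### Piecewise linear approximations of indicators -/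

/-- The function which is `1` on `(-∞, z]`, `0` on `[z + ε, ∞)` and linear in between. -/
def ramp (z ε w : ℝ) : ℝ := max 0 (min 1 (1 + (z - w) / ε))

lemma ramp_nonneg (z ε w : ℝ) : 0 ≤ ramp z ε w := le_max_left _ _

lemma ramp_le_one (z ε w : ℝ) : ramp z ε w ≤ 1 := max_le zero_le_one (min_le_left _ _)

lemma continuous_ramp (z ε : ℝ) : Continuous (ramp z ε) := by unfold ramp; fun_prop

lemma ramp_of_le {z ε w : ℝ} (hε : 0 < ε) (h : w ≤ z) : ramp z ε w = 1 := by
  have : 0 ≤ (z - w) / ε := div_nonneg (by linarith) hε.le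
  rw [ramp, min_eq_left (by linarith), max_eq_right zero_le_one]

lemma ramp_of_ge {z ε w : ℝ} (hε : 0 < ε) (h : z + ε ≤ w) : ramp z ε w = 0 := by
  have : (z - w) / ε ≤ -1 := by rw [div_le_iff₀ hε]; linarith
  rw [ramp, max_eq_left]
  exact (min_le_right _ _).trans (by linarith)

lemma abs_ramp_sub_le {z ε : ℝ} (hε : 0 < ε) (w w' : ℝ) :
    |ramp z ε w' - ramp z ε w| ≤ |w' - w| / ε := by
  have h1 : |ramp z ε w' - ramp z ε w| ≤
      |min 1 (1 + (z - w') / ε) - min 1 (1 + (z - w) / ε)| := by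
    have := abs_max_sub_max_le_max 0 (min 1 (1 + (z - w') / ε)) 0 (min 1 (1 + (z - w) / ε))
    simpa [ramp] using this
  have h2 : |min 1 (1 + (z - w') / ε) - min 1 (1 + (z - w) / ε)| ≤
      |(1 + (z - w') / ε) - (1 + (z - w) / ε)| := by
    have := abs_min_sub_min_le_max 1 (1 + (z - w') / ε) 1 (1 + (z - w) / ε)
    simpa using this
  refine (h1.trans h2).trans (le_of_eq ?_)
  rw [show (1 + (z - w') / ε) - (1 + (z - w) / ε) = -((w' - w) / ε) by ring, abs_neg, abs_div,
    abs_of_pos hε]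

/-- A shift by at most `u` changes the ramp only if it starts within `u` of the sloped interval.
Keeping this indicator, rather than only the Lipschitz constant `1/ε`, is what lets concentration of
`w` enter. -/
lemma abs_ramp_add_sub_le {z ε : ℝ} (hε : 0 < ε) {u v : ℝ} (w : ℝ) (hv : |v| ≤ u) :
    |ramp z ε (w + v) - ramp z ε w| ≤
      u / ε * (Set.Ioc (z - u) (z + ε + u)).indicator (fun _ => (1 : ℝ)) w := by
  have hv' := abs_le.1 hv
  by_cases hw : w ∈ Set.Ioc (z - u) (z + ε + u)
  · rw [Set.indicator_of_mem hw, mul_one]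
    refine (abs_ramp_sub_le hε w (w + v)).trans ?_
    rw [add_sub_cancel_left]
    gcongr
  · rw [Set.indicator_of_notMem hw, mul_zero]
    rw [Set.mem_Ioc, not_and_or, not_lt, not_le] at hw
    rcases hw with hw | hw
    · rw [ramp_of_le hε (by linarith), ramp_of_le hε (by linarith [abs_nonneg v])]; simp
    · rw [ramp_of_ge hε (by linarith), ramp_of_ge hε (by linarith [abs_nonneg v])]; simp

lemma integrable_ramp_mul_stdPDF (z ε : ℝ) : Integrable fun x => ramp z ε x * stdPDF x :=
  integrable_stdPDF.bdd_mul (c := 1) (continuous_ramp z ε).aestronglyMeasurable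
    (ae_of_all _ fun x => by
      rw [Real.norm_eq_abs, abs_of_nonneg (ramp_nonneg _ _ _)]; exact ramp_le_one _ _ _)

lemma integral_ramp_le {z ε : ℝ} (hε : 0 < ε) :
    ∫ x, ramp z ε x * stdPDF x ≤ stdCDF (z + ε) := by
  rw [stdCDF, ← integral_indicator measurableSet_Iic]
  refine integral_mono (integrable_ramp_mul_stdPDF z ε)
    (integrable_stdPDF.indicator measurableSet_Iic) fun x => ?_
  by_cases hx : x ∈ Set.Iic (z + ε)
  · simp only [Set.indicator_of_mem hx]
    exact mul_le_of_le_one_left (stdPDF_pos x).le (ramp_le_one _ _ _)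
  · simp only [Set.indicator_of_notMem hx]
    rw [ramp_of_ge hε (le_of_lt (not_le.1 hx)), zero_mul]

lemma le_integral_ramp {z ε : ℝ} (hε : 0 < ε) :
    stdCDF z ≤ ∫ x, ramp z ε x * stdPDF x := by
  rw [stdCDF, ← integral_indicator measurableSet_Iic]
  refine integral_mono (integrable_stdPDF.indicator measurableSet_Iic)
    (integrable_ramp_mul_stdPDF z ε) fun x => ?_
  by_cases hx : x ∈ Set.Iic z
  · simp only [Set.indicator_of_mem hx]
    rw [ramp_of_le hε hx, one_mul]
  · simp only [Set.indicator_of_notMem hx]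
    exact mul_nonneg (ramp_nonneg _ _ _) (stdPDF_pos x).le

/-- The Stein solution for a ramp function, with its regularity bounds. -/
theorem exists_stein_ramp (z : ℝ) {ε : ℝ} (hε : 0 < ε) :
    ∃ f f' : ℝ → ℝ, (∀ w, HasDerivAt f (f' w) w) ∧ Continuous f' ∧
      (∀ w, f' w - w * f w = ramp z ε w - ∫ x, ramp z ε x * stdPDF x) ∧
      (∀ w, |f w| ≤ 3) ∧ (∀ w, |f' w| ≤ 2) ∧
      (∀ w u v, |v| ≤ u → |f' (w + v) - f' w| ≤ 3 * u * (1 + |w|) +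
        u / ε * (Set.Ioc (z - u) (z + ε + u)).indicator (fun _ => (1 : ℝ)) w) := by
  set N := ∫ x, ramp z ε x * stdPDF x with hN
  have hN0 : 0 ≤ N := (stdCDF_nonneg z).trans (le_integral_ramp hε)
  have hN1 : N ≤ 1 := (integral_ramp_le hε).trans (stdCDF_le_one _)
  have hq1 : ∀ x, |ramp z ε x - N| ≤ 1 := fun x => by
    have := ramp_nonneg z ε x
    have := ramp_le_one z ε x
    exact abs_le.2 ⟨by linarith, by linarith⟩
  obtain ⟨f, hf, hf3, hwf⟩ := exists_stein_solution (q := fun x => ramp z ε x - N)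
    ((continuous_ramp z ε).sub continuous_const) hq1 (by
      simp only [sub_mul]
      rw [integral_sub (integrable_ramp_mul_stdPDF z ε) (integrable_stdPDF.const_mul _),
        integral_const_mul, integral_stdPDF, ← hN]
      ring)
  have hfc : Continuous f := continuous_iff_continuousAt.2 fun x => (hf x).continuousAt
  have hf' : ∀ w, |w * f w + (ramp z ε w - N)| ≤ 2 := fun w => by
    have := abs_add_le (w * f w) (ramp z ε w - N)
    linarith [hwf w, hq1 w]
  have hlip : ∀ w v, |f (w + v) - f w| ≤ 2 * |v| := fun w v => by
    have := Convex.norm_image_sub_le_of_norm_hasDerivWithin_le (f := f)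
      (f' := fun w => w * f w + (ramp z ε w - N)) (C := 2) (s := Set.univ) (x := w) (y := w + v)
      (fun x _ => (hf x).hasDerivWithinAt) (fun x _ => hf' x) convex_univ trivial trivial
    simpa using this
  refine ⟨f, fun w => w * f w + (ramp z ε w - N), hf, ?_, fun w => by ring, hf3, hf', ?_⟩
  · exact (continuous_id.mul hfc).add ((continuous_ramp z ε).sub continuous_const)
  · intro w u v hv
    -- The three pieces use, in turn, `|f| ≤ 3`, the Lipschitz constant `2` of `f`, and the
    -- localized modulus of the ramp.
    have e : (w + v) * f (w + v) + (ramp z ε (w + v) - N) - (w * f w + (ramp z ε w - N)) =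
      v * f (w + v) + w * (f (w + v) - f w) + (ramp z ε (w + v) - ramp z ε w) := by ring
    rw [e]
    refine (abs_add_le _ _).trans (add_le_add ?_ (abs_ramp_add_sub_le hε w hv))
    refine (abs_add_le _ _).trans ?_
    rw [abs_mul, abs_mul]
    have h1 : |v| * |f (w + v)| ≤ u * 3 :=
      mul_le_mul hv (hf3 _) (abs_nonneg _) ((abs_nonneg v).trans hv)
    have h2 : |w| * |f (w + v) - f w| ≤ |w| * (2 * u) :=
      mul_le_mul_of_nonneg_left ((hlip w v).trans (by linarith)) (abs_nonneg w)
    nlinarith [abs_nonneg w, (abs_nonneg v).trans hv]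

/-! ### Integration against independent random variables -/

section Indep

variable {Ω α β : Type*} [MeasurableSpace Ω] [MeasurableSpace α] [MeasurableSpace β]
  {P : Measure Ω} [IsProbabilityMeasure P] {U : Ω → α} {V : Ω → β}

/-- Fubini's theorem for independent random variables. -/
lemma integral_of_indepFun (hU : Measurable U) (hV : Measurable V) (h : IndepFun U V P)
    {G : α × β → ℝ} (hG : Measurable G) (hi : Integrable (fun ω => G (U ω, V ω)) P) :
    ∫ ω, G (U ω, V ω) ∂P = ∫ ω, (∫ ω', G (U ω', V ω) ∂P) ∂P ∧
      Integrable (fun ω => ∫ ω', G (U ω', V ω) ∂P) P := by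
  have hmap := (indepFun_iff_map_prod_eq_prod_map_map hU.aemeasurable hV.aemeasurable).1 h
  have hUV : Measurable fun ω => (U ω, V ω) := hU.prodMk hV
  have : IsProbabilityMeasure (P.map U) := Measure.isProbabilityMeasure_map hU.aemeasurable
  have : IsProbabilityMeasure (P.map V) := Measure.isProbabilityMeasure_map hV.aemeasurable
  have hGi : Integrable G ((P.map U).prod (P.map V)) := by
    rw [← hmap, integrable_map_measure hG.aestronglyMeasurable hUV.aemeasurable]
    exact hi
  have hin : ∀ y, ∫ x, G (x, y) ∂(P.map U) = ∫ ω', G (U ω', y) ∂P := fun y =>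
    integral_map hU.aemeasurable (hG.comp measurable_prodMk_right).aestronglyMeasurable
  have h1 : ∫ ω, G (U ω, V ω) ∂P = ∫ z, G z ∂((P.map U).prod (P.map V)) := by
    rw [← hmap, integral_map hUV.aemeasurable hG.aestronglyMeasurable]
  have hi2 : Integrable (fun y => ∫ x, G (x, y) ∂(P.map U)) (P.map V) := hGi.integral_prod_right
  constructor
  · rw [h1, integral_prod_symm _ hGi, integral_map hV.aemeasurable hi2.aestronglyMeasurable]
    simp only [hin]
  · rw [integrable_map_measure hi2.aestronglyMeasurable hV.aemeasurable] at hi2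
    refine hi2.congr (ae_of_all _ fun ω => ?_)
    simp only [Function.comp, hin]

lemma integral_le_of_indepFun (hU : Measurable U) (hV : Measurable V) (h : IndepFun U V P)
    {G : α × β → ℝ} (hG : Measurable G) (hi : Integrable (fun ω => G (U ω, V ω)) P)
    {b : β → ℝ} (hb : Integrable (fun ω => b (V ω)) P) (hle : ∀ y, ∫ ω, G (U ω, y) ∂P ≤ b y) :
    ∫ ω, G (U ω, V ω) ∂P ≤ ∫ ω, b (V ω) ∂P := by
  obtain ⟨h1, h2⟩ := integral_of_indepFun hU hV h hG hi
  rw [h1]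
  exact integral_mono h2 hb fun ω => hle (V ω)

lemma integral_eq_zero_of_indepFun (hU : Measurable U) (hV : Measurable V) (h : IndepFun U V P)
    {G : α × β → ℝ} (hG : Measurable G) (hi : Integrable (fun ω => G (U ω, V ω)) P)
    (h0 : ∀ y, ∫ ω, G (U ω, y) ∂P = 0) : ∫ ω, G (U ω, V ω) ∂P = 0 := by
  rw [(integral_of_indepFun hU hV h hG hi).1]
  simp [h0]

end Indep

/-! ### A moment inequality in inner product spaces -/

/-- Passing from `j` to `j + 1` multiplies the two powers by `(A ± x)²`, which mixes their sum and
difference linearly. Bounding the difference by the sum, with factor `2jx/A`, closes the recursion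
for the sum. -/
lemma even_odd_part_bound (A x : ℝ) (hA : 0 ≤ A) (hx : 0 ≤ x) (k : ℕ) :
    0 ≤ (A + x) ^ (2 * k) - (A - x) ^ (2 * k) ∧
    A * ((A + x) ^ (2 * k) - (A - x) ^ (2 * k)) ≤
      2 * k * x * ((A + x) ^ (2 * k) + (A - x) ^ (2 * k)) ∧
    (A + x) ^ (2 * k) + (A - x) ^ (2 * k) ≤ 2 * (A ^ 2 + 4 * k * x ^ 2) ^ k := by
  have hmono : ∀ j : ℕ, j ≤ k → 0 ≤ (A + x) ^ (2 * j) - (A - x) ^ (2 * j) ∧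
    A * ((A + x) ^ (2 * j) - (A - x) ^ (2 * j)) ≤
      2 * j * x * ((A + x) ^ (2 * j) + (A - x) ^ (2 * j)) ∧
    (A + x) ^ (2 * j) + (A - x) ^ (2 * j) ≤ 2 * (A ^ 2 + 4 * k * x ^ 2) ^ j := by
    intro j
    induction j with
    | zero => intro _; simp; norm_num
    | succ j ih =>
      intro hj
      obtain ⟨h1, h2, h3⟩ := ih (by omega)
      have hjk : (j : ℝ) + 1 ≤ k := by exact_mod_cast hj
      have e1 : (A + x) ^ (2 * (j + 1)) = (A + x) ^ (2 * j) * (A + x) ^ 2 := by ring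
      have e2 : (A - x) ^ (2 * (j + 1)) = (A - x) ^ (2 * j) * (A - x) ^ 2 := by ring
      have p1 : 0 ≤ (A + x) ^ (2 * j) := by positivity
      have p2 : 0 ≤ (A - x) ^ (2 * j) := by rw [pow_mul]; positivity
      rw [e1, e2]
      set p := (A + x) ^ (2 * j)
      set m := (A - x) ^ (2 * j)
      have hsum : p * (A + x) ^ 2 + m * (A - x) ^ 2 =
        (A ^ 2 + x ^ 2) * (p + m) + 2 * x * (A * (p - m)) := by ring
      have hdiff : p * (A + x) ^ 2 - m * (A - x) ^ 2 =
        (A ^ 2 + x ^ 2) * (p - m) + 2 * A * x * (p + m) := by ring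
      refine ⟨?_, ?_, ?_⟩
      · rw [hdiff]; positivity
      · rw [hsum, hdiff]
        push_cast
        have g1 : (A ^ 2 + x ^ 2) * (A * (p - m)) ≤ (A ^ 2 + x ^ 2) * (2 * j * x * (p + m)) :=
          mul_le_mul_of_nonneg_left h2 (by positivity)
        have g2 : 0 ≤ x ^ 2 * x * (p + m) := by positivity
        have g3 : 0 ≤ ((j : ℝ) + 1) * x * (x * (A * (p - m))) := by positivity
        nlinarith
      · rw [hsum, pow_succ (A ^ 2 + 4 * k * x ^ 2) j]
        have g1 : 2 * x * (A * (p - m)) ≤ 2 * x * (2 * j * x * (p + m)) :=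
          mul_le_mul_of_nonneg_left h2 (by positivity)
        have g2 : (A ^ 2 + x ^ 2) * (p + m) + 2 * x * (2 * j * x * (p + m)) ≤
            (A ^ 2 + 4 * k * x ^ 2) * (p + m) := by
          have : 0 ≤ x ^ 2 * (p + m) := by positivity
          nlinarith
        have g3 : (A ^ 2 + 4 * k * x ^ 2) * (p + m) ≤
            (A ^ 2 + 4 * k * x ^ 2) * (2 * (A ^ 2 + 4 * k * x ^ 2) ^ j) :=
          mul_le_mul_of_nonneg_left h3 (by positivity)
        linarith
  exact hmono k le_rfl

lemma convex_pow_le {x y a b : ℝ} (hx : 0 ≤ x) (hy : 0 ≤ y) (ha : 0 ≤ a) (hb : 0 ≤ b)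
    (hab : a + b = 1) (k : ℕ) : (a * x + b * y) ^ k ≤ a * x ^ k + b * y ^ k :=
  (convexOn_pow (𝕜 := ℝ) k).2 (Set.mem_Ici.2 hx) (Set.mem_Ici.2 hy) ha hb hab

lemma two_mul_add_pow_le {a y : ℝ} (ha : 0 ≤ a) (hy : 0 ≤ y) (k : ℕ) :
    2 * (a + y) ^ k ≤ (a + 2 * y) ^ k + a ^ k := by
  have h := convex_pow_le (x := a + 2 * y) (y := a) (a := 1 / 2) (b := 1 / 2) (by positivity) ha
    (by norm_num) (by norm_num) (by norm_num) k
  rw [show 1 / 2 * (a + 2 * y) + 1 / 2 * a = a + y by ring] at h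
  linarith

/-- With the first-order term removed, only `x²` enters. Bernoulli's inequality at the opposite sign
leaves the sum of both powers minus `A^{2k}`; `even_odd_part_bound` and midpoint convexity then
absorb `A^{2k}`. -/
lemma scalar_pow_bound (A x : ℝ) (hA : 0 ≤ A) (hx : 0 ≤ x) (k : ℕ) (hk : 1 ≤ k) :
    (A + x) ^ (2 * k) - 2 * k * A ^ (2 * k - 1) * x ≤ (A ^ 2 + 8 * k * x ^ 2) ^ k ∧
    (A - x) ^ (2 * k) + 2 * k * A ^ (2 * k - 1) * x ≤ (A ^ 2 + 8 * k * x ^ 2) ^ k := by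
  have hbern : ∀ y : ℝ, A ^ (2 * k) + 2 * k * A ^ (2 * k - 1) * y ≤ (A + y) ^ (2 * k) := by
    intro y
    rcases hA.eq_or_lt with rfl | hA'
    · rw [zero_pow (by omega), zero_pow (by omega), pow_mul]
      simp only [mul_zero, zero_mul, add_zero]
      positivity
    · by_cases hy : -2 ≤ y / A
      · have := one_add_mul_le_pow hy (2 * k)
        have e : A + y = A * (1 + y / A) := by field_simp
        rw [e, mul_pow]
        have e2 : A ^ (2 * k) + 2 * k * A ^ (2 * k - 1) * y =
            A ^ (2 * k) * (1 + ((2 * k : ℕ) : ℝ) * (y / A)) := by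
          have : A ^ (2 * k) = A ^ (2 * k - 1) * A := by rw [← pow_succ]; congr 1; omega
          rw [this]; push_cast; field_simp
        rw [e2]
        exact mul_le_mul_of_nonneg_left this (by positivity)
      · have hy' : y < -2 * A := by rw [not_le, div_lt_iff₀ hA'] at hy; exact hy
        have : A ^ (2 * k) = A ^ (2 * k - 1) * A := by rw [← pow_succ]; congr 1; omega
        have h0 : 0 ≤ (A + y) ^ (2 * k) := by rw [pow_mul]; positivity
        have hk' : (1 : ℝ) ≤ k := by exact_mod_cast hk
        have h1 : A + 2 * k * y ≤ 0 := by nlinarith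
        have h2 : A ^ (2 * k - 1) * (A + 2 * k * y) ≤ 0 :=
          mul_nonpos_of_nonneg_of_nonpos (by positivity) h1
        nlinarith
  obtain ⟨-, -, h3⟩ := even_odd_part_bound A x hA hx k
  have h4 := two_mul_add_pow_le (a := A ^ 2) (y := 4 * k * x ^ 2) (by positivity) (by positivity) k
  rw [← pow_mul, show 2 * (4 * (k : ℝ) * x ^ 2) = 8 * k * x ^ 2 by ring] at h4
  have b1 := hbern x
  have b2 := hbern (-x)
  rw [← sub_eq_add_neg] at b2
  constructor <;> nlinarith

/-- The square `‖S + X‖²` is a convex combination of `(‖S‖ + ‖X‖)²` and `(‖S‖ - ‖X‖)²`, so convexity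
of the `k`-th power reduces the claim to the two collinear cases. The term linear in `X` is isolated
because it integrates to zero. -/
lemma norm_add_pow_le {H : Type*} [NormedAddCommGroup H] [InnerProductSpace ℝ H] (S X : H)
    (k : ℕ) (hk : 1 ≤ k) :
    ‖S + X‖ ^ (2 * k) ≤ 2 * k * (‖S‖ ^ (2 * k - 2) * inner ℝ S X) +
      (‖S‖ ^ 2 + 8 * k * ‖X‖ ^ 2) ^ k := by
  have hq : ‖S + X‖ ^ 2 = ‖S‖ ^ 2 + 2 * inner ℝ S X + ‖X‖ ^ 2 := norm_add_sq_real S X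
  have hb := abs_le.1 (abs_real_inner_le_norm S X)
  set A := ‖S‖ with hA
  set x := ‖X‖ with hx
  set b := inner ℝ S X with hbdef
  have hA0 : 0 ≤ A := norm_nonneg _
  have hx0 : 0 ≤ x := norm_nonneg _
  rw [pow_mul, hq]
  obtain ⟨s1, s2⟩ := scalar_pow_bound A x hA0 hx0 k hk
  rcases (mul_nonneg hA0 hx0).eq_or_lt with h0 | h0
  · have hb0 : b = 0 := by
      rw [← h0] at hb; linarith [hb.1, hb.2]
    rw [hb0]
    simp only [mul_zero, add_zero, zero_add]
    have hk' : (1 : ℝ) ≤ k := by exact_mod_cast hk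
    exact pow_le_pow_left₀ (by positivity) (by nlinarith [sq_nonneg x]) k
  · set θ := (A * x + b) / (2 * (A * x)) with hθ
    have hθ0 : 0 ≤ θ := div_nonneg (by linarith [hb.1]) (by linarith)
    have hθ1 : 0 ≤ 1 - θ := by
      rw [sub_nonneg, hθ, div_le_one (by linarith)]; linarith [hb.2]
    have hbθ : b = (2 * θ - 1) * (A * x) := by
      have hA1 : A ≠ 0 := fun h => by simp [h] at h0
      have hx1 : x ≠ 0 := fun h => by simp [h] at h0
      rw [hθ]; field_simp; ring
    have hconv := convex_pow_le (sq_nonneg (A + x)) (sq_nonneg (A - x)) hθ0 hθ1 (by ring) k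
    simp only [← pow_mul] at hconv
    rw [show θ * (A + x) ^ 2 + (1 - θ) * (A - x) ^ 2 = A ^ 2 + 2 * b + x ^ 2 by
      rw [hbθ]; ring] at hconv
    refine hconv.trans ?_
    have e : A ^ (2 * k - 2) * b = (2 * θ - 1) * (A ^ (2 * k - 1) * x) := by
      have : A ^ (2 * k - 1) = A ^ (2 * k - 2) * A := by rw [← pow_succ]; congr 1; omega
      rw [hbθ, this]; ring
    rw [e]
    have t1 := mul_le_mul_of_nonneg_left s1 hθ0
    have t2 := mul_le_mul_of_nonneg_left s2 hθ1
    nlinarith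

/-- Convexity with weights `n/(n+1)` and `1/(n+1)`, the choice for which the moment recursion from
`n` to `n + 1` summands reproduces the form `(8kn)^k` exactly. -/
lemma weighted_pow_bound {a b : ℝ} (ha : 0 ≤ a) (hb : 0 ≤ b) (n k : ℕ) (hn : 1 ≤ n) :
    (a + b) ^ k ≤ (n / (n + 1) : ℝ) * (((n + 1) / n : ℝ) * a) ^ k +
      (1 / (n + 1) : ℝ) * ((n + 1) * b) ^ k := by
  have hn' : (0 : ℝ) < n := by exact_mod_cast hn
  have h := convex_pow_le (x := ((n + 1) / n : ℝ) * a) (y := ((n : ℝ) + 1) * b)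
    (a := (n / (n + 1) : ℝ)) (b := (1 / (n + 1) : ℝ)) (by positivity) (by positivity)
    (by positivity) (by positivity) (by field_simp) k
  convert h using 2
  field_simp

/-- A Marcinkiewicz–Zygmund type inequality in an inner product space: the even moments of a sum
of `n` independent centred vectors with the same law. Only the Gram kernel has to be measurable. -/
theorem moment_sum_le {Ω Ξ H : Type*} [MeasurableSpace Ω] [MeasurableSpace Ξ]
    [NormedAddCommGroup H] [InnerProductSpace ℝ H] {P : Measure Ω} [IsProbabilityMeasure P]
    {Q : Measure Ξ} {X : Ξ → H} (hK : Measurable fun p : Ξ × Ξ => inner ℝ (X p.1) (X p.2))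
    (h0 : ∀ s, ∫ s', inner ℝ (X s) (X s') ∂Q = 0) {k : ℕ} (hk : 1 ≤ k)
    (hint : Integrable (fun s => ‖X s‖ ^ (2 * k)) Q)
    {ξ : ℕ → Ω → Ξ} (hξ : ∀ i, Measurable (ξ i)) (hind : iIndepFun ξ P)
    (hQ : ∀ i, P.map (ξ i) = Q) (n : ℕ) :
    Integrable (fun ω => ‖∑ i ∈ Finset.range n, X (ξ i ω)‖ ^ (2 * k)) P ∧
    ∫ ω, ‖∑ i ∈ Finset.range n, X (ξ i ω)‖ ^ (2 * k) ∂P ≤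
      (8 * k * n) ^ k * ∫ s, ‖X s‖ ^ (2 * k) ∂Q := by
  have hnorm : Measurable fun s => ‖X s‖ := by
    have : (fun s => ‖X s‖) = fun s => √(inner ℝ (X s) (X s)) := by
      funext s; rw [real_inner_self_eq_norm_sq, Real.sqrt_sq (norm_nonneg _)]
    rw [this]
    exact (hK.comp (measurable_id.prodMk measurable_id)).sqrt
  -- Norms of sums are recovered from the Gram kernel, since `X` itself is not assumed measurable.
  have hpast : ∀ n, Measurable fun y : (Finset.range n → Ξ) => ‖∑ i, X (y i)‖ := fun n => by
    have : (fun y : (Finset.range n → Ξ) => ‖∑ i, X (y i)‖) =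
        fun y => √(∑ i, ∑ j, inner ℝ (X (y i)) (X (y j))) := by
      funext y
      rw [← Real.sqrt_sq (norm_nonneg (∑ i, X (y i))), ← real_inner_self_eq_norm_sq, sum_inner]
      simp_rw [inner_sum]
    rw [this]
    refine Measurable.sqrt (Finset.measurable_sum _ fun i _ => Finset.measurable_sum _ fun j _ => ?_)
    have hij : Measurable fun y : (Finset.range n → Ξ) => (y i, y j) :=
      (measurable_pi_apply i).prodMk (measurable_pi_apply j)
    exact hK.comp hij
  have hX1 : ∀ i, Integrable (fun ω => ‖X (ξ i ω)‖ ^ (2 * k)) P := fun i => by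
    rw [← hQ i] at hint
    exact (integrable_map_measure (hnorm.pow_const _).aestronglyMeasurable
      (hξ i).aemeasurable).1 hint
  have hX2 : ∀ i, ∫ ω, ‖X (ξ i ω)‖ ^ (2 * k) ∂P = ∫ s, ‖X s‖ ^ (2 * k) ∂Q := fun i => by
    rw [← hQ i, integral_map (hξ i).aemeasurable (hnorm.pow_const _).aestronglyMeasurable]
  have hsum : ∀ n ω, ∑ i ∈ Finset.range n, X (ξ i ω) =
      ∑ i : Finset.range n, X (ξ i ω) := fun n ω => by
    rw [Finset.sum_coe_sort (Finset.range n) fun i => X (ξ i ω)]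
  have hpm : ∀ n, Measurable fun ω => fun i : Finset.range n => ξ i ω := fun n =>
    measurable_pi_lambda _ fun i => hξ i
  have hSm : ∀ n, Measurable fun ω => ‖∑ i ∈ Finset.range n, X (ξ i ω)‖ := fun n => by
    simp_rw [hsum n]
    exact (hpast n).comp (hpm n)
  induction n with
  | zero => 
    simp only [Finset.range_zero, Finset.sum_empty, norm_zero]
    rw [zero_pow (by omega)]
    refine ⟨integrable_const _, ?_⟩
    simp [zero_pow (show k ≠ 0 by omega)]
  | succ n ih =>
    obtain ⟨ihi, ihle⟩ := ih
    set S : Ω → H := fun ω => ∑ i ∈ Finset.range n, X (ξ i ω) with hS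
    have hstep : ∀ ω, ∑ i ∈ Finset.range (n + 1), X (ξ i ω) = S ω + X (ξ n ω) := fun ω => by
      rw [Finset.sum_range_succ]
    have hi' : Integrable (fun ω => ‖∑ i ∈ Finset.range (n + 1), X (ξ i ω)‖ ^ (2 * k)) P := by
      refine Integrable.mono' ((ihi.add (hX1 n)).const_mul (2 ^ (2 * k - 1)))
        ((hSm (n + 1)).pow_const _).aestronglyMeasurable (ae_of_all _ fun ω => ?_)
      rw [Real.norm_of_nonneg (by positivity), hstep]
      exact (pow_le_pow_left₀ (norm_nonneg _) (norm_add_le _ _) _).trans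
        (add_pow_le (norm_nonneg _) (norm_nonneg _) _)
    refine ⟨hi', ?_⟩
    rcases Nat.eq_zero_or_pos n with rfl | hn
    · simp only [zero_add, Finset.range_one, Finset.sum_singleton]
      rw [hX2 0]
      have hk' : (1 : ℝ) ≤ k := by exact_mod_cast hk
      refine le_mul_of_one_le_left (integral_nonneg fun s => by positivity) ?_
      exact one_le_pow₀ (by push_cast; linarith)
    · have hSX : Measurable fun z : (Finset.range n → Ξ) × Ξ =>
          inner ℝ (∑ i, X (z.1 i)) (X z.2) := by
        simp_rw [sum_inner]
        refine Finset.measurable_sum _ fun i _ => ?_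
        have hi : Measurable fun z : (Finset.range n → Ξ) × Ξ => (z.1 i, z.2) :=
          ((measurable_pi_apply i).comp measurable_fst).prodMk measurable_snd
        exact hK.comp hi
      have hindep : IndepFun (fun ω => ξ n ω) (fun ω => fun i : Finset.range n => ξ i ω) P := by
        have h1 := hind.indepFun_finset (Finset.range n) {n} (by simp) hξ
        exact (h1.comp measurable_id (measurable_pi_apply
          (⟨n, by simp⟩ : ({n} : Finset ℕ)))).symm
      set G : Ξ × (Finset.range n → Ξ) → ℝ := fun z =>
        ‖∑ i, X (z.2 i)‖ ^ (2 * k - 2) * inner ℝ (∑ i, X (z.2 i)) (X z.1) with hG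
      have hGm : Measurable G :=
        (((hpast n).comp measurable_snd).pow_const _).mul (hSX.comp measurable_swap)
      have hGe : ∀ ω, G (ξ n ω, fun i : Finset.range n => ξ i ω) =
          ‖S ω‖ ^ (2 * k - 2) * inner ℝ (S ω) (X (ξ n ω)) := fun ω => by
        simp only [hG, hS, hsum]
      have hGi : Integrable (fun ω => G (ξ n ω, fun i : Finset.range n => ξ i ω)) P := by
        refine Integrable.mono' (ihi.add (hX1 n))
          (hGm.comp ((hξ n).prodMk (hpm n))).aestronglyMeasurable (ae_of_all _ fun ω => ?_)
        rw [hGe, Real.norm_eq_abs, abs_mul, abs_of_nonneg (pow_nonneg (norm_nonneg _) _)]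
        have hb := abs_real_inner_le_norm (S ω) (X (ξ n ω))
        have ha : 0 ≤ ‖S ω‖ := norm_nonneg _
        have hx : 0 ≤ ‖X (ξ n ω)‖ := norm_nonneg _
        have e : ‖S ω‖ ^ (2 * k) = ‖S ω‖ ^ (2 * k - 2) * ‖S ω‖ ^ 2 := by
          rw [← pow_add]; congr 1; omega
        have e' : ‖X (ξ n ω)‖ ^ (2 * k) = ‖X (ξ n ω)‖ ^ (2 * k - 2) * ‖X (ξ n ω)‖ ^ 2 := by
          rw [← pow_add]; congr 1; omega
        refine (mul_le_mul_of_nonneg_left hb (by positivity)).trans ?_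
        simp only [Pi.add_apply]
        rcases le_total ‖S ω‖ ‖X (ξ n ω)‖ with h | h
        · have : ‖S ω‖ ^ (2 * k - 2) * (‖S ω‖ * ‖X (ξ n ω)‖) ≤ ‖X (ξ n ω)‖ ^ (2 * k) := by
            rw [e', sq]; gcongr
          have : 0 ≤ ‖S ω‖ ^ (2 * k) := by positivity
          linarith
        · have : ‖S ω‖ ^ (2 * k - 2) * (‖S ω‖ * ‖X (ξ n ω)‖) ≤ ‖S ω‖ ^ (2 * k) := by
            rw [e, sq]; gcongr
          have : 0 ≤ ‖X (ξ n ω)‖ ^ (2 * k) := by positivity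
          linarith
      -- The new summand is independent of the past and weakly centred, so the linear term vanishes.
      have hG0 : ∫ ω, G (ξ n ω, fun i : Finset.range n => ξ i ω) ∂P = 0 := by
        refine integral_eq_zero_of_indepFun (hξ n) (hpm n) hindep hGm hGi fun y => ?_
        simp only [hG]
        rw [integral_const_mul]
        have hm : Measurable fun s => inner ℝ (∑ i, X (y i)) (X s) :=
          hSX.comp measurable_prodMk_left
        have e1 : ∫ ω, inner ℝ (∑ i, X (y i)) (X (ξ n ω)) ∂P =
            ∫ s, inner ℝ (∑ i, X (y i)) (X s) ∂Q := by
          rw [← hQ n, integral_map (hξ n).aemeasurable hm.aestronglyMeasurable]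
        have hXi : Integrable (fun s => ‖X s‖) Q := by
          have : IsProbabilityMeasure Q := by
            rw [← hQ 0]; exact Measure.isProbabilityMeasure_map (hξ 0).aemeasurable
          refine Integrable.mono' ((integrable_const (1 : ℝ)).add hint)
            hnorm.aestronglyMeasurable (ae_of_all _ fun s => ?_)
          simp only [Real.norm_eq_abs, abs_norm, Pi.add_apply]
          rcases le_total ‖X s‖ 1 with h | h
          · have : 0 ≤ ‖X s‖ ^ (2 * k) := by positivity
            linarith
          · have := le_self_pow₀ h (show 2 * k ≠ 0 by omega)
            linarith
        rw [e1]
        simp_rw [sum_inner]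
        rw [integral_finsetSum]
        · simp [h0]
        · intro i _
          refine Integrable.mono' (hXi.const_mul ‖X (y i)‖)
            (hK.comp measurable_prodMk_left).aestronglyMeasurable (ae_of_all _ fun s => ?_)
          exact norm_inner_le_norm _ _
      have hpt : ∀ ω, ‖∑ i ∈ Finset.range (n + 1), X (ξ i ω)‖ ^ (2 * k) ≤
          2 * k * G (ξ n ω, fun i : Finset.range n => ξ i ω) +
          ((n / (n + 1) : ℝ) * ((n + 1) / n : ℝ) ^ k * ‖S ω‖ ^ (2 * k) +
            (1 / (n + 1) : ℝ) * ((n + 1) * (8 * k)) ^ k * ‖X (ξ n ω)‖ ^ (2 * k)) := fun ω => by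
        rw [hstep, hGe]
        refine (norm_add_pow_le _ _ k hk).trans (add_le_add le_rfl ?_)
        refine (weighted_pow_bound (by positivity) (by positivity) n k hn).trans (le_of_eq ?_)
        rw [mul_pow, mul_pow _ (8 * (k : ℝ) * _), mul_pow (8 * (k : ℝ)), mul_pow _ (8 * (k : ℝ))]
        simp only [← pow_mul]
        ring
      have hi1 := hGi.const_mul (2 * k : ℝ)
      have hi2 := ihi.const_mul ((n / (n + 1) : ℝ) * ((n + 1) / n : ℝ) ^ k)
      have hi3 := (hX1 n).const_mul ((1 / (n + 1) : ℝ) * ((n + 1) * (8 * k)) ^ k)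
      have hmain := integral_mono hi' (hi1.add (hi2.add hi3)) hpt
      refine hmain.trans ?_
      rw [integral_add' hi1 (hi2.add hi3), integral_add' hi2 hi3, integral_const_mul,
        integral_const_mul, integral_const_mul, hG0, hX2 n, mul_zero, zero_add]
      have hn' : (0 : ℝ) < n := by exact_mod_cast hn
      set m := ∫ s, ‖X s‖ ^ (2 * k) ∂Q
      have hc : 0 ≤ (n / (n + 1) : ℝ) * ((n + 1) / n : ℝ) ^ k := by positivity
      have h1 := mul_le_mul_of_nonneg_left ihle hc
      refine (add_le_add h1 le_rfl).trans (le_of_eq ?_)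
      have e1 : ((n + 1) / n : ℝ) ^ k * (8 * k * n) ^ k = (8 * k * (n + 1)) ^ k := by
        rw [← mul_pow]; congr 1; field_simp
      calc _ = (n / (n + 1) : ℝ) * (((n + 1) / n : ℝ) ^ k * (8 * k * n) ^ k) * m +
            (1 / (n + 1) : ℝ) * ((n + 1) * (8 * k)) ^ k * m := by ring
        _ = _ := by
            rw [e1, show ((n : ℝ) + 1) * (8 * k) = 8 * k * (n + 1) by ring]
            push_cast
            field_simp

/-! ### The Berry–Esseen theorem -/

section BerryEsseen

variable {Ω : Type*} [MeasurableSpace Ω] {P : Measure Ω} [IsProbabilityMeasure P]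

lemma integrable_abs_pow {Y : Ω → ℝ} (hY : Measurable Y)
    (h4 : Integrable (fun ω => Y ω ^ 4) P) {j : ℕ} (hj : j ≤ 4) :
    Integrable (fun ω => |Y ω| ^ j) P := by
  refine Integrable.mono' ((integrable_const (1 : ℝ)).add h4)
    (hY.abs.pow_const _).aestronglyMeasurable (ae_of_all _ fun ω => ?_)
  rw [Real.norm_of_nonneg (by positivity)]
  simp only [Pi.add_apply]
  have e : Y ω ^ 4 = |Y ω| ^ 4 := by rw [← abs_pow, abs_of_nonneg (by positivity)]
  rw [e]
  rcases le_total |Y ω| 1 with h | h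
  · have := pow_le_one₀ (n := j) (abs_nonneg (Y ω)) h
    have : 0 ≤ |Y ω| ^ 4 := by positivity
    linarith
  · have := pow_le_pow_right₀ h hj
    linarith

/-- The contribution of the modulus of continuity of a Stein solution, integrated against an
independent pair. -/
lemma integral_modulus_le {V Y : Ω → ℝ} (hV : Measurable V) (hY : Measurable Y)
    (hVY : IndepFun V Y P) (hVi : Integrable V P) (hV1 : ∫ ω, |V ω| ∂P ≤ 1)
    (h4 : Integrable (fun ω => Y ω ^ 4) P) {δ : ℝ} 
    (hconc : ∀ a b, a ≤ b → P.real {ω | V ω ∈ Set.Ioc a b} ≤ (b - a) + δ)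
    (z : ℝ) {ε : ℝ} (hε : 0 < ε) {j : ℕ} (hj : j ≤ 2) :
    Integrable (fun ω => |Y ω| ^ j * (3 * |Y ω| * (1 + |V ω|) + |Y ω| / ε *
      (Set.Ioc (z - |Y ω|) (z + ε + |Y ω|)).indicator (fun _ => (1 : ℝ)) (V ω))) P ∧
    ∫ ω, |Y ω| ^ j * (3 * |Y ω| * (1 + |V ω|) + |Y ω| / ε *
      (Set.Ioc (z - |Y ω|) (z + ε + |Y ω|)).indicator (fun _ => (1 : ℝ)) (V ω)) ∂P ≤
      (7 + δ / ε) * ∫ ω, |Y ω| ^ (j + 1) ∂P + 2 / ε * ∫ ω, |Y ω| ^ (j + 2) ∂P := by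
  set ind : ℝ × ℝ → ℝ := fun p =>
    (Set.Ioc (z - |p.2|) (z + ε + |p.2|)).indicator (fun _ => (1 : ℝ)) p.1 with hind
  have hindm : Measurable ind := by
    have : ind = Set.indicator {p : ℝ × ℝ | z - |p.2| < p.1 ∧ p.1 ≤ z + ε + |p.2|}
        (fun _ => (1 : ℝ)) := by
      funext p
      simp only [hind, Set.indicator, Set.mem_Ioc, Set.mem_ofPred_eq]
    rw [this]
    have h1 : MeasurableSet {p : ℝ × ℝ | z - |p.2| < p.1} :=
      measurableSet_lt (by fun_prop) (by fun_prop)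
    have h2 : MeasurableSet {p : ℝ × ℝ | p.1 ≤ z + ε + |p.2|} :=
      measurableSet_le (by fun_prop) (by fun_prop)
    exact measurable_const.indicator (h1.inter h2)
  have hind0 : ∀ p, 0 ≤ ind p := fun p => Set.indicator_nonneg (fun _ _ => zero_le_one) _
  have hind1 : ∀ p, ind p ≤ 1 := fun p => Set.indicator_le_self' (fun _ _ => zero_le_one) _
  have hGm : Measurable fun p : ℝ × ℝ =>
      |p.2| ^ j * (3 * |p.2| * (1 + |p.1|) + |p.2| / ε * ind p) := by fun_prop
  have hi1 := integrable_abs_pow hY h4 (show j + 1 ≤ 4 by omega)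
  have hi2 := integrable_abs_pow hY h4 (show j + 2 ≤ 4 by omega)
  have hprod : Integrable (fun ω => |V ω| * |Y ω| ^ (j + 1)) P := by
    have h := (hVY.comp (φ := fun x => |x|) (ψ := fun x => |x| ^ (j + 1)) (by fun_prop)
      (by fun_prop)).integrable_mul hVi.abs hi1
    exact h
  have hGi : Integrable (fun ω => |Y ω| ^ j * (3 * |Y ω| * (1 + |V ω|) + |Y ω| / ε *
      ind (V ω, Y ω))) P := by
    refine Integrable.mono' (((hi1.const_mul 3).add (hprod.const_mul 3)).add
      (hi1.const_mul (1 / ε)))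
      (hGm.comp (hV.prodMk hY)).aestronglyMeasurable (ae_of_all _ fun ω => ?_)
    have h0 := hind0 (V ω, Y ω)
    rw [Real.norm_of_nonneg (by positivity)]
    simp only [Pi.add_apply]
    have h2 : |Y ω| ^ j * (|Y ω| / ε * ind (V ω, Y ω)) ≤ 1 / ε * |Y ω| ^ (j + 1) := by
      calc _ ≤ |Y ω| ^ j * (|Y ω| / ε * 1) := by gcongr; exact hind1 _
        _ = _ := by ring
    calc _ = 3 * |Y ω| ^ (j + 1) + 3 * (|V ω| * |Y ω| ^ (j + 1)) +
          |Y ω| ^ j * (|Y ω| / ε * ind (V ω, Y ω)) := by ring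
      _ ≤ _ := by linarith
  refine ⟨hGi, ?_⟩
  have hb : Integrable (fun ω => (fun y : ℝ => (7 + δ / ε) * |y| ^ (j + 1) +
      2 / ε * |y| ^ (j + 2)) (Y ω)) P :=
    (hi1.const_mul _).add (hi2.const_mul _)
  refine (integral_le_of_indepFun (b := fun y => (7 + δ / ε) * |y| ^ (j + 1) +
      2 / ε * |y| ^ (j + 2)) hV hY hVY hGm hGi hb ?_).trans (le_of_eq ?_)
  · intro y
    simp only
    have hiv : Integrable (fun ω => 3 * |y| * (1 + |V ω|)) P :=
      ((integrable_const 1).add hVi.abs).const_mul _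
    have hii : Integrable (fun ω => ind (V ω, y)) P := by
      refine Integrable.mono' (integrable_const (1 : ℝ))
        (hindm.comp (hV.prodMk measurable_const)).aestronglyMeasurable (ae_of_all _ fun ω => ?_)
      rw [Real.norm_of_nonneg (hind0 _)]
      exact hind1 _
    have e2 : ∫ ω, ind (V ω, y) ∂P = P.real {ω | V ω ∈ Set.Ioc (z - |y|) (z + ε + |y|)} :=
      integral_indicator_one (hV (measurableSet_Ioc (a := z - |y|) (b := z + ε + |y|)))
    rw [integral_const_mul, integral_add hiv (hii.const_mul _), integral_const_mul,
      integral_const_mul, integral_add (integrable_const 1) hVi.abs, e2]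
    have hc := hconc (z - |y|) (z + ε + |y|) (by linarith [abs_nonneg y])
    simp only [integral_const, probReal_univ, one_smul]
    have hy := abs_nonneg y
    have h1 : 3 * |y| * (1 + ∫ ω, |V ω| ∂P) ≤ 3 * |y| * 2 := by gcongr; linarith
    have h2 : |y| / ε * P.real {ω | V ω ∈ Set.Ioc (z - |y|) (z + ε + |y|)} ≤
      |y| / ε * (ε + 2 * |y| + δ) := by gcongr; linarith
    -- The interval has length `ε + 2|y|`. Its `ε` cancels against `1/ε` and raises the constant
    -- from `6` to `7`, while `2|y|` yields the term of higher order.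
    calc _ ≤ |y| ^ j * (3 * |y| * 2 + |y| / ε * (ε + 2 * |y| + δ)) := by gcongr
      _ = |y| ^ (j + 1) * (6 + ε / ε + δ / ε) + 2 / ε * |y| ^ (j + 2) := by ring
      _ = _ := by rw [div_self hε.ne']; ring
  · rw [integral_add (hi1.const_mul _) (hi2.const_mul _), integral_const_mul, integral_const_mul]

/-- One step of Stein's method: replacing one summand. -/
lemma stein_step {V Y : Ω → ℝ} (hV : Measurable V) (hY : Measurable Y)
    (hVY : IndepFun V Y P) (hVi : Integrable V P) (hV1 : ∫ ω, |V ω| ∂P ≤ 1)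
    (h4 : Integrable (fun ω => Y ω ^ 4) P) (hY0 : ∫ ω, Y ω ∂P = 0) {δ : ℝ}
    (hconc : ∀ a b, a ≤ b → P.real {ω | V ω ∈ Set.Ioc a b} ≤ (b - a) + δ)
    {z ε : ℝ} (hε : 0 < ε) {f f' : ℝ → ℝ} (hf : ∀ w, HasDerivAt f (f' w) w)
    (hf'c : Continuous f') (hf3 : ∀ w, |f w| ≤ 3) (hf2 : ∀ w, |f' w| ≤ 2)
    (hmod : ∀ w u v, |v| ≤ u → |f' (w + v) - f' w| ≤ 3 * u * (1 + |w|) +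
        u / ε * (Set.Ioc (z - u) (z + ε + u)).indicator (fun _ => (1 : ℝ)) w) :
    |(∫ ω, Y ω ^ 2 ∂P) * ∫ ω, f' (V ω + Y ω) ∂P - ∫ ω, Y ω * f (V ω + Y ω) ∂P| ≤
      (∫ ω, Y ω ^ 2 ∂P) * ((7 + δ / ε) * ∫ ω, |Y ω| ∂P + 2 / ε * ∫ ω, Y ω ^ 2 ∂P) +
        ((7 + δ / ε) * ∫ ω, |Y ω| ^ 3 ∂P + 2 / ε * ∫ ω, Y ω ^ 4 ∂P) := by
  have hfc : Continuous f := continuous_iff_continuousAt.2 fun x => (hf x).continuousAt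
  obtain ⟨i0, m0⟩ := integral_modulus_le hV hY hVY hVi hV1 h4 hconc z hε (j := 0) (by omega)
  obtain ⟨i2, m2⟩ := integral_modulus_le hV hY hVY hVi hV1 h4 hconc z hε (j := 2) (by omega)
  simp only [pow_zero, one_mul, zero_add, pow_one, sq_abs] at i0 m0 i2 m2
  have e4 : ∀ ω, |Y ω| ^ (2 + 2) = Y ω ^ 4 := fun ω => by
    calc |Y ω| ^ (2 + 2) = (|Y ω| ^ 2) ^ 2 := by ring
      _ = Y ω ^ 4 := by rw [sq_abs]; ring
  simp only [e4] at m2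
  set R : Ω → ℝ := fun ω => 3 * |Y ω| * (1 + |V ω|) + |Y ω| / ε *
    (Set.Ioc (z - |Y ω|) (z + ε + |Y ω|)).indicator (fun _ => (1 : ℝ)) (V ω) with hR
  have hb2 := integrable_abs_pow hY h4 (show 2 ≤ 4 by omega)
  have hb1 := integrable_abs_pow hY h4 (show 1 ≤ 4 by omega)
  simp only [pow_one, sq_abs] at hb1 hb2
  have hYi : Integrable Y P := (integrable_norm_iff hY.aestronglyMeasurable).1 hb1
  have j1 : Integrable (fun ω => f' (V ω + Y ω)) P :=
    Integrable.mono' (integrable_const (2 : ℝ))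
      (hf'c.measurable.comp (hV.add hY)).aestronglyMeasurable (ae_of_all _ fun ω => hf2 _)
  have j2 : Integrable (fun ω => f' (V ω)) P :=
    Integrable.mono' (integrable_const (2 : ℝ))
      (hf'c.measurable.comp hV).aestronglyMeasurable (ae_of_all _ fun ω => hf2 _)
  have j3 : Integrable (fun ω => Y ω * f (V ω + Y ω)) P :=
    hYi.mul_bdd (c := 3) (hfc.measurable.comp (hV.add hY)).aestronglyMeasurable
      (ae_of_all _ fun ω => hf3 _)
  have j4 : Integrable (fun ω => Y ω * f (V ω)) P :=
    hYi.mul_bdd (c := 3) (hfc.measurable.comp hV).aestronglyMeasurable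
      (ae_of_all _ fun ω => hf3 _)
  have j5 : Integrable (fun ω => Y ω ^ 2 * f' (V ω)) P :=
    hb2.mul_bdd (c := 2) (hf'c.measurable.comp hV).aestronglyMeasurable
      (ae_of_all _ fun ω => hf2 _)
  -- By independence, the zeroth-order term of the expansion of `Y f(V + Y)` around `V` vanishes and
  -- the first-order one factors. Only moduli of continuity of `f'` remain.
  have z4 : ∫ ω, Y ω * f (V ω) ∂P = 0 := by
    have h := (hVY.symm.comp (φ := id) (ψ := f) measurable_id
      hfc.measurable).integral_fun_mul_eq_mul_integral hY.aestronglyMeasurable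
      (hfc.measurable.comp hV).aestronglyMeasurable
    simp only [Function.comp, id] at h
    rw [h, hY0, zero_mul]
  have z5 : ∫ ω, Y ω ^ 2 * f' (V ω) ∂P = (∫ ω, Y ω ^ 2 ∂P) * ∫ ω, f' (V ω) ∂P := by
    have h := (hVY.symm.comp (φ := fun y => y ^ 2) (ψ := f') (by fun_prop)
      hf'c.measurable).integral_fun_mul_eq_mul_integral (hY.pow_const 2).aestronglyMeasurable
      (hf'c.measurable.comp hV).aestronglyMeasurable
    simpa only [Function.comp] using h
  have a1 : |∫ ω, f' (V ω + Y ω) ∂P - ∫ ω, f' (V ω) ∂P| ≤ ∫ ω, R ω ∂P := by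
    rw [← integral_sub j1 j2, ← Real.norm_eq_abs]
    refine norm_integral_le_of_norm_le i0 (ae_of_all _ fun ω => ?_)
    exact hmod _ _ _ le_rfl
  have a2 : |∫ ω, Y ω * f (V ω + Y ω) ∂P - ∫ ω, Y ω * f (V ω) ∂P -
      ∫ ω, Y ω ^ 2 * f' (V ω) ∂P| ≤ ∫ ω, Y ω ^ 2 * R ω ∂P := by
    have j34 : Integrable (fun ω => Y ω * f (V ω + Y ω) - Y ω * f (V ω)) P := j3.sub j4
    rw [← integral_sub j3 j4, ← integral_sub j34 j5, ← Real.norm_eq_abs]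
    refine norm_integral_le_of_norm_le i2 (ae_of_all _ fun ω => ?_)
    simp only [Real.norm_eq_abs]
    have htaylor : |f (V ω + Y ω) - f (V ω) - Y ω * f' (V ω)| ≤ R ω * |Y ω| := by
      have h := Convex.norm_image_sub_le_of_norm_hasDerivWithin_le
        (f := fun v => f (V ω + v) - v * f' (V ω))
        (f' := fun v => f' (V ω + v) - f' (V ω)) (C := R ω)
        (s := Set.Icc (-|Y ω|) |Y ω|) (x := 0) (y := Y ω)
        (fun v _ => by
          have h1 : HasDerivAt (fun v => f (V ω + v)) (f' (V ω + v)) v := by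
            simpa using (hf (V ω + v)).comp_const_add (V ω) v
          have h2 : HasDerivAt (fun v => v * f' (V ω)) (f' (V ω)) v := by
            simpa using (hasDerivAt_id v).mul_const (f' (V ω))
          exact (h1.sub h2).hasDerivWithinAt)
        (fun v hv => hmod _ _ _ (abs_le.2 hv)) (convex_Icc _ _)
        (by simp) ⟨neg_abs_le _, le_abs_self _⟩
      simp only [add_zero, zero_mul, sub_zero, Real.norm_eq_abs] at h
      rwa [show f (V ω + Y ω) - Y ω * f' (V ω) - f (V ω) =
        f (V ω + Y ω) - f (V ω) - Y ω * f' (V ω) by ring] at h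
    rw [show Y ω * f (V ω + Y ω) - Y ω * f (V ω) - Y ω ^ 2 * f' (V ω) =
      Y ω * (f (V ω + Y ω) - f (V ω) - Y ω * f' (V ω)) by ring, abs_mul]
    calc _ ≤ |Y ω| * (R ω * |Y ω|) := by gcongr
      _ = |Y ω| ^ 2 * R ω := by ring
      _ = _ := by rw [sq_abs]
  rw [z4, z5] at a2
  have hs : 0 ≤ ∫ ω, Y ω ^ 2 ∂P := integral_nonneg fun ω => sq_nonneg _
  set s2 := ∫ ω, Y ω ^ 2 ∂P
  have hsplit : s2 * ∫ ω, f' (V ω + Y ω) ∂P - ∫ ω, Y ω * f (V ω + Y ω) ∂P =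
      s2 * (∫ ω, f' (V ω + Y ω) ∂P - ∫ ω, f' (V ω) ∂P) -
        (∫ ω, Y ω * f (V ω + Y ω) ∂P - 0 - s2 * ∫ ω, f' (V ω) ∂P) := by ring
  rw [hsplit]
  refine (abs_sub _ _).trans (add_le_add ?_ (a2.trans m2))
  rw [abs_mul, abs_of_nonneg hs]
  exact mul_le_mul_of_nonneg_left (a1.trans m0) hs

/-- **Berry–Esseen theorem** for independent standardized random variables with bounded fourth
moments. -/
theorem berry_esseen {ι : Type*} [DecidableEq ι] {X : ι → Ω → ℝ} (hX : ∀ i, Measurable (X i))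
    (hind : iIndepFun X P) (h4 : ∀ i, Integrable (fun ω => X i ω ^ 4) P)
    (hX0 : ∀ i, ∫ ω, X i ω ∂P = 0) (hX2 : ∀ i, ∫ ω, X i ω ^ 2 ∂P = 1) {M : ℝ} (hM : 1 ≤ M)
    (hX4 : ∀ i, ∫ ω, X i ω ^ 4 ∂P ≤ M ^ 4) (s : Finset ι) (hs : s.Nonempty) (z : ℝ) :
    |P.real {ω | ∑ i ∈ s, X i ω ≤ z * √s.card} - stdCDF z| ≤ 41 * M ^ 3 / √s.card := by
  -- The induction runs over all index sets and all thresholds, since the hypothesis is needed for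
  -- every leave-one-out set and at both ends of an interval.
  induction hn : s.card generalizing s z with
  | zero => exact absurd (Finset.card_eq_zero.1 hn) hs.ne_empty
  | succ n ih =>
    have hM3 : 1 ≤ M ^ 3 := one_le_pow₀ hM
    rcases Nat.eq_zero_or_pos n with rfl | hnpos
    · simp only [zero_add, Nat.cast_one, Real.sqrt_one, div_one]
      have h1 := stdCDF_nonneg z
      have h2 := stdCDF_le_one z
      have h3 : 0 ≤ P.real {ω | ∑ i ∈ s, X i ω ≤ z * 1} := measureReal_nonneg
      have h4 : P.real {ω | ∑ i ∈ s, X i ω ≤ z * 1} ≤ 1 := measureReal_le_one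
      exact abs_le.2 ⟨by linarith, by linarith⟩
    have hnR : (0 : ℝ) < n := by exact_mod_cast hnpos
    have hN0 : (0 : ℝ) < ((n + 1 : ℕ) : ℝ) := by positivity
    set r : ℝ := 1 / √((n + 1 : ℕ) : ℝ) with hr
    have hr0 : 0 < r := by positivity
    have hr2 : ((n + 1 : ℕ) : ℝ) * r ^ 2 = 1 := by
      rw [hr, div_pow, Real.sq_sqrt hN0.le]; field_simp
    have hr1 : r ≤ 1 := by
      rw [hr, div_le_one (by positivity), Real.one_le_sqrt]; push_cast; linarith
    set η : ℝ := M ^ 3 * r with hη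
    have hη0 : 0 < η := by positivity
    have hrη : r ≤ η := le_mul_of_one_le_left hr0.le hM3
    have habs := fun i (j : ℕ) (hj : j ≤ 4) => integrable_abs_pow (hX i) (h4 i) hj
    have m1 : ∀ i, ∫ ω, |X i ω| ∂P ≤ 1 := fun i => by
      have h1 := habs i 1 (by omega)
      have h2 := habs i 2 (by omega)
      simp only [pow_one, sq_abs] at h1 h2
      have := integral_mono h1 (((integrable_const (1 : ℝ)).add h2).const_mul (1 / 2)) fun ω => by
        simp only [Pi.add_apply]; nlinarith [sq_nonneg (|X i ω| - 1), sq_abs (X i ω)]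
      refine this.trans ?_
      rw [integral_const_mul, integral_add' (integrable_const _) h2, hX2]
      simp
      norm_num
    have m3 : ∀ i, ∫ ω, |X i ω| ^ 3 ∂P ≤ M ^ 3 := fun i => by
      have h2 := habs i 2 (by omega)
      have h3 := habs i 3 (by omega)
      simp only [sq_abs] at h2
      have := integral_mono h3 (((h4 i).const_mul (1 / (2 * M))).add (h2.const_mul (M / 2)))
        fun ω => by
          simp only [Pi.add_apply]
          have e4 : X i ω ^ 4 = |X i ω| ^ 4 := by rw [← abs_pow, abs_of_nonneg (by positivity)]
          rw [e4, ← sq_abs (X i ω)]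
          have hM0 : 0 < M := by linarith
          have : 0 ≤ 1 / (2 * M) * (|X i ω| ^ 2 * (|X i ω| - M) ^ 2) := by positivity
          have e : 1 / (2 * M) * (|X i ω| ^ 2 * (|X i ω| - M) ^ 2) =
            1 / (2 * M) * |X i ω| ^ 4 + M / 2 * |X i ω| ^ 2 - |X i ω| ^ 3 := by
            field_simp; ring
          linarith
      refine this.trans ?_
      rw [integral_add' ((h4 i).const_mul _) (h2.const_mul _), integral_const_mul,
        integral_const_mul, hX2, mul_one]
      have hM0 : 0 < M := by linarith
      have h5 : 1 / (2 * M) * ∫ ω, X i ω ^ 4 ∂P ≤ 1 / (2 * M) * M ^ 4 := by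
        gcongr; exact hX4 i
      have e : 1 / (2 * M) * M ^ 4 = M ^ 3 / 2 := by field_simp
      have : M ≤ M ^ 3 := le_self_pow₀ hM (by norm_num)
      linarith
    -- the leave-one-out sums
    set V : ι → Ω → ℝ := fun i ω => r * ∑ j ∈ s.erase i, X j ω with hVdef
    set W : Ω → ℝ := fun ω => r * ∑ j ∈ s, X j ω with hWdef
    have hVm : ∀ i, Measurable (V i) := fun i =>
      (Finset.measurable_sum _ fun j _ => hX j).const_mul r
    have hWm : Measurable W := (Finset.measurable_sum _ fun j _ => hX j).const_mul r
    have hWV : ∀ i ∈ s, ∀ ω, W ω = V i ω + r * X i ω := fun i hi ω => by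
      simp only [hWdef, hVdef]
      rw [← Finset.sum_erase_add s _ hi]; ring
    have hcard : ∀ i ∈ s, (s.erase i).card = n := fun i hi => by
      rw [Finset.card_erase_of_mem hi, hn]; rfl
    have hML : ∀ i, MemLp (X i) 2 P := fun i => by
      rw [memLp_two_iff_integrable_sq (hX i).aestronglyMeasurable]
      simpa using habs i 2 (by omega)
    have hVML : ∀ i, MemLp (V i) 2 P := fun i =>
      (memLp_finsetSum (s.erase i) fun j _ => hML j).const_mul r
    have hVi : ∀ i, Integrable (V i) P := fun i => (hVML i).integrable (by norm_num)
    have hV1 : ∀ i ∈ s, ∫ ω, |V i ω| ∂P ≤ 1 := fun i hi => by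
      have hvar := IndepFun.variance_sum (s := s.erase i) (X := X) (μ := P) (fun j _ => hML j)
        (fun a _ b _ hab => hind.indepFun hab)
      have hXi : ∀ j, Integrable (X j) P := fun j => (hML j).integrable (by norm_num)
      have hmean : ∫ ω, (∑ j ∈ s.erase i, X j) ω ∂P = 0 := by
        simp only [Finset.sum_apply]
        rw [integral_finsetSum _ fun j _ => hXi j]
        simp [hX0]
      rw [variance_of_integral_eq_zero
        (Finset.aemeasurable_sum _ fun j _ => (hX j).aemeasurable) hmean,
        Finset.sum_congr rfl fun j _ => (variance_of_integral_eq_zero (hX j).aemeasurable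
          (hX0 j)).trans (hX2 j)] at hvar
      simp only [Finset.sum_apply, Finset.sum_const, nsmul_eq_mul, mul_one, hcard i hi] at hvar
      have hsq : ∫ ω, V i ω ^ 2 ∂P ≤ 1 := by
        simp only [hVdef, mul_pow]
        rw [integral_const_mul, hvar]
        push_cast at hr2
        nlinarith [sq_nonneg r]
      have hi2 : Integrable (fun ω => V i ω ^ 2) P :=
        (memLp_two_iff_integrable_sq (hVm i).aestronglyMeasurable).1 (hVML i)
      have := integral_mono (hVi i).abs (((integrable_const (1 : ℝ)).add hi2).const_mul (1 / 2))
        fun ω => by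
          simp only [Pi.add_apply]; nlinarith [sq_nonneg (|V i ω| - 1), sq_abs (V i ω)]
      refine this.trans ?_
      rw [integral_const_mul, integral_add' (integrable_const _) hi2]
      simp only [integral_const, probReal_univ, one_smul]
      linarith
    have hVX : ∀ i, IndepFun (V i) (fun ω => r * X i ω) P := fun i => by
      have h := hind.indepFun_finsetSum_of_notMem hX (Finset.notMem_erase i s)
      have h2 := h.comp (φ := fun x => r * x) (ψ := fun x => r * x) (by fun_prop) (by fun_prop)
      have e : (fun x => r * x) ∘ (∑ j ∈ s.erase i, X j) = V i := by
        funext ω; simp [hVdef]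
      rw [e] at h2
      exact h2
    -- concentration of the leave-one-out sums
    set ratio : ℝ := √((n + 1 : ℕ) : ℝ) / √(n : ℝ) with hratio
    have hratio2 : ratio ≤ 3 / 2 := by
      rw [hratio, div_le_iff₀ (by positivity)]
      refine Real.sqrt_le_left (by positivity) |>.2 ?_
      rw [mul_pow, Real.sq_sqrt hnR.le]
      have : (1 : ℝ) ≤ n := by exact_mod_cast hnpos
      push_cast
      linarith
    have hratio0 : 0 < ratio := by positivity
    -- Two uses of the induction hypothesis, with `n` instead of `n + 1` summands, cost at most `2 ·
    -- 41 · (3/2) = 123` multiples of `η`.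
    have hconc : ∀ i ∈ s, ∀ a b, a ≤ b →
        P.real {ω | V i ω ∈ Set.Ioc a b} ≤ (b - a) + 123 * η := fun i hi a b hab => by
      have hne : (s.erase i).Nonempty := by
        rw [← Finset.card_pos, hcard i hi]; exact hnpos
      have key : ∀ c, {ω | V i ω ≤ c} = {ω | ∑ j ∈ s.erase i, X j ω ≤ c * ratio * √(n : ℝ)} :=
        fun c => by
          ext ω
          simp only [Set.mem_ofPred_eq, hVdef, hr, hratio]
          rw [mul_assoc, div_mul_cancel₀ _ (by positivity), one_div_mul_eq_div,
            div_le_iff₀ (by positivity)]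
      have hd : {ω | V i ω ∈ Set.Ioc a b} = {ω | V i ω ≤ b} \ {ω | V i ω ≤ a} := by
        ext ω
        simp only [Set.mem_Ioc, Set.mem_ofPred_eq, Set.mem_sdiff, not_le]
        exact and_comm
      have hsub : {ω | V i ω ≤ a} ⊆ {ω | V i ω ≤ b} := fun ω h => le_trans h hab
      rw [hd, measureReal_sdiff hsub (hVm i measurableSet_Iic), key, key]
      have g1 := abs_le.1 (ih (s.erase i) hne (b * ratio) (hcard i hi))
      have g2 := abs_le.1 (ih (s.erase i) hne (a * ratio) (hcard i hi))
      have g3 := stdCDF_sub_le (mul_le_mul_of_nonneg_right hab hratio0.le)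
      have g4 : 41 * M ^ 3 / √(n : ℝ) ≤ 123 / 2 * η := by
        have : 41 * M ^ 3 / √(n : ℝ) = 41 * M ^ 3 * (ratio * r) := by
          rw [hratio, hr]; field_simp
        rw [this, hη]
        have : M ^ 3 * (ratio * r) ≤ M ^ 3 * (3 / 2 * r) := by gcongr
        linarith
      have g5 : (b * ratio - a * ratio) / 2 ≤ b - a := by
        nlinarith
      linarith [g1.2, g2.1]
    -- Stein's method
    set ε : ℝ := 20 * η with hε
    have hε0 : 0 < ε := by positivity
    have hδε : 123 * η / ε ≤ 7 := by
      rw [hε, div_le_iff₀ (by positivity)]; linarith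
    have hstein : ∀ z', |∫ ω, ramp z' ε (W ω) ∂P - ∫ x, ramp z' ε x * stdPDF x| ≤ 29 * η := by
      intro z'
      obtain ⟨f, f', hf, hf'c, heq, hf3, hf2, hmod⟩ := exists_stein_ramp z' hε0
      have hfc : Continuous f := continuous_iff_continuousAt.2 fun x => (hf x).continuousAt
      have hrX4 : ∀ i, Integrable (fun ω => (r * X i ω) ^ 4) P := fun i => by
        simp only [mul_pow]; exact (h4 i).const_mul _
      have hterm : ∀ i ∈ s, |r ^ 2 * ∫ ω, f' (W ω) ∂P - ∫ ω, r * X i ω * f (W ω) ∂P| ≤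
          r ^ 2 * (29 * η) := fun i hi => by
        have h := stein_step (P := P) (hVm i) ((hX i).const_mul r) (hVX i) (hVi i) (hV1 i hi)
          (hrX4 i) (by rw [integral_const_mul, hX0, mul_zero]) (hconc i hi) hε0 hf hf'c hf3 hf2
          hmod
        simp only [← hWV i hi, mul_pow, abs_mul, abs_of_pos hr0] at h
        simp only [integral_const_mul, hX2, mul_one] at h
        have c1 : 7 + 123 * η / ε ≤ 14 := by linarith
        have c0 : 0 ≤ 7 + 123 * η / ε := by positivity
        have b1 : (7 + 123 * η / ε) * (r * ∫ ω, |X i ω| ∂P) ≤ 14 * (r * 1) := by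
          have := m1 i
          have h0 : 0 ≤ ∫ ω, |X i ω| ∂P := integral_nonneg fun ω => abs_nonneg _
          gcongr
        have b3 : (7 + 123 * η / ε) * (r ^ 3 * ∫ ω, |X i ω| ^ 3 ∂P) ≤ 14 * (r ^ 3 * M ^ 3) := by
          have := m3 i
          have h0 : 0 ≤ ∫ ω, |X i ω| ^ 3 ∂P := integral_nonneg fun ω => by positivity
          gcongr
        have b2 : 2 / ε * r ^ 2 ≤ 1 / 10 * η := by
          rw [hε, div_mul_eq_mul_div, div_le_iff₀ (by positivity)]
          nlinarith
        have b4 : 2 / ε * (r ^ 4 * ∫ ω, X i ω ^ 4 ∂P) ≤ r ^ 2 * (1 / 10 * η) := by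
          have hx := hX4 i
          have h46 : M ^ 4 ≤ M ^ 6 := pow_le_pow_right₀ hM (by norm_num)
          calc 2 / ε * (r ^ 4 * ∫ ω, X i ω ^ 4 ∂P) ≤ 2 / ε * (r ^ 4 * M ^ 6) := by
                gcongr; linarith
            _ = r ^ 2 * (2 / ε * η ^ 2) := by rw [hη]; ring
            _ = r ^ 2 * (1 / 10 * η) := by rw [hε]; field_simp; norm_num
        refine h.trans ?_
        have e3 : r ^ 3 * M ^ 3 = r ^ 2 * η := by rw [hη]; ring
        have b12 : r ^ 2 * ((7 + 123 * η / ε) * (r * ∫ ω, |X i ω| ∂P) + 2 / ε * r ^ 2) ≤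
            r ^ 2 * (14 * η + 1 / 10 * η) := by
          refine mul_le_mul_of_nonneg_left ?_ (by positivity)
          linarith
        have hr2η : 0 ≤ r ^ 2 * η := by positivity
        rw [e3] at b3
        linarith
      have hsumr : ∑ _i ∈ s, r ^ 2 = 1 := by
        rw [Finset.sum_const, hn, nsmul_eq_mul, hr2]
      have hXf : ∀ i ∈ s, Integrable (fun ω => r * X i ω * f (W ω)) P := fun i _ =>
        (((hML i).integrable (by norm_num)).const_mul r).mul_bdd (c := 3)
          (hfc.measurable.comp hWm).aestronglyMeasurable (ae_of_all _ fun ω => hf3 _)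
      have hWf : ∫ ω, W ω * f (W ω) ∂P = ∑ i ∈ s, ∫ ω, r * X i ω * f (W ω) ∂P := by
        rw [← integral_finsetSum _ hXf]
        refine integral_congr_ae (ae_of_all _ fun ω => ?_)
        simp only [hWdef]
        rw [← Finset.sum_mul, ← Finset.mul_sum]
      have hWfi : Integrable (fun ω => W ω * f (W ω)) P := by
        have := integrable_finsetSum s hXf
        refine this.congr (ae_of_all _ fun ω => ?_)
        simp only [hWdef]
        rw [← Finset.sum_mul, ← Finset.mul_sum]
      have hf'i : Integrable (fun ω => f' (W ω)) P :=
        Integrable.mono' (integrable_const (2 : ℝ))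
          (hf'c.measurable.comp hWm).aestronglyMeasurable (ae_of_all _ fun ω => hf2 _)
      have hri : Integrable (fun ω => ramp z' ε (W ω)) P := by
        refine Integrable.mono' (integrable_const (1 : ℝ))
          ((continuous_ramp z' ε).measurable.comp hWm).aestronglyMeasurable
          (ae_of_all _ fun ω => ?_)
        rw [Real.norm_of_nonneg (ramp_nonneg _ _ _)]
        exact ramp_le_one _ _ _
      have e1 : ∫ ω, ramp z' ε (W ω) ∂P - ∫ x, ramp z' ε x * stdPDF x =
          ∑ i ∈ s, (r ^ 2 * ∫ ω, f' (W ω) ∂P - ∫ ω, r * X i ω * f (W ω) ∂P) := by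
        rw [Finset.sum_sub_distrib, ← Finset.sum_mul, hsumr, one_mul, ← hWf,
          ← integral_sub hf'i hWfi]
        simp only [heq]
        rw [integral_sub hri (integrable_const _)]
        simp
      rw [e1]
      refine (Finset.abs_sum_le_sum_abs _ _).trans ((Finset.sum_le_sum hterm).trans ?_)
      rw [← Finset.sum_mul, hsumr, one_mul]
    have hset : {ω | ∑ i ∈ s, X i ω ≤ z * √((n + 1 : ℕ) : ℝ)} = {ω | W ω ≤ z} := by
      ext ω
      simp only [Set.mem_ofPred_eq, hWdef, hr]
      rw [one_div_mul_eq_div, div_le_iff₀ (by positivity)]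
    have hmeas : MeasurableSet {ω | W ω ≤ z} := hWm measurableSet_Iic
    have hri : ∀ z', Integrable (fun ω => ramp z' ε (W ω)) P := fun z' => by
      refine Integrable.mono' (integrable_const (1 : ℝ))
        ((continuous_ramp z' ε).measurable.comp hWm).aestronglyMeasurable
        (ae_of_all _ fun ω => ?_)
      rw [Real.norm_of_nonneg (ramp_nonneg _ _ _)]
      exact ramp_le_one _ _ _
    have hindi : Integrable ({ω | W ω ≤ z}.indicator (1 : Ω → ℝ)) P :=
      (integrable_const (1 : ℝ)).indicator hmeas
    have hup : P.real {ω | W ω ≤ z} ≤ ∫ ω, ramp z ε (W ω) ∂P := by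
      rw [← integral_indicator_one hmeas]
      refine integral_mono hindi (hri z) fun ω => ?_
      by_cases h : ω ∈ {ω | W ω ≤ z}
      · rw [Set.indicator_of_mem h, ramp_of_le hε0 h]; rfl
      · rw [Set.indicator_of_notMem h]; exact ramp_nonneg _ _ _
    have hlow : ∫ ω, ramp (z - ε) ε (W ω) ∂P ≤ P.real {ω | W ω ≤ z} := by
      rw [← integral_indicator_one hmeas]
      refine integral_mono (hri _) hindi fun ω => ?_
      by_cases h : ω ∈ {ω | W ω ≤ z}
      · rw [Set.indicator_of_mem h]; exact ramp_le_one _ _ _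
      · rw [Set.indicator_of_notMem h, ramp_of_ge hε0]
        simp only [Set.mem_ofPred_eq, not_le] at h
        linarith
    have t1 := abs_le.1 (hstein z)
    have t2 := abs_le.1 (hstein (z - ε))
    have t3 := integral_ramp_le (z := z) hε0
    have t4 := le_integral_ramp (z := z - ε) hε0
    have t5 := stdCDF_sub_le (show z ≤ z + ε by linarith)
    have t6 := stdCDF_sub_le (show z - ε ≤ z by linarith)
    have hfin : 41 * M ^ 3 / √((n + 1 : ℕ) : ℝ) = 41 * η := by rw [hη, hr]; ring
    rw [hset, hfin]
    refine abs_le.2 ⟨?_, ?_⟩ <;> linarith [t1.1, t1.2, t2.1, t2.2]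

end BerryEsseen

/-! ### Comparison of normal distribution functions -/

lemma stdPDF_le_of_abs_le {x y : ℝ} (h : |x| ≤ |y|) : stdPDF y ≤ stdPDF x := by
  rw [stdPDF_eq, stdPDF_eq]
  have := sq_le_sq.2 h
  gcongr

/-- The quantity `x * stdPDF x` is the derivative of `stdCDF (c * x)` in the scale `c` at `c = 1`;
bounding it makes the cost of a wrong variance uniform in `x`. -/
lemma mul_stdPDF_le_one (x : ℝ) : x * stdPDF x ≤ 1 := by
  have h0 := stdPDF_pos x
  rcases le_total x 0 with h | h
  · nlinarith
  · rw [stdPDF_eq]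
    have h1 : Real.exp (-(x ^ 2 / 2)) ≤ 1 / (1 + x ^ 2 / 2) := by
      rw [Real.exp_neg, ← one_div]
      apply one_div_le_one_div_of_le (by positivity)
      linarith [Real.add_one_le_exp (x ^ 2 / 2)]
    have h2 : (√(2 * Real.pi))⁻¹ ≤ 1 := by
      apply inv_le_one_of_one_le₀
      rw [Real.one_le_sqrt]
      linarith [Real.pi_gt_three]
    calc x * ((√(2 * Real.pi))⁻¹ * Real.exp (-(x ^ 2 / 2)))
        ≤ x * (1 * (1 / (1 + x ^ 2 / 2))) := by gcongr
      _ = x / (1 + x ^ 2 / 2) := by ring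
      _ ≤ 1 := by rw [div_le_one (by positivity)]; nlinarith [sq_nonneg (x - 1)]

lemma stdCDF_sub_le_of_pdf_le {a b C : ℝ} (hab : a ≤ b) (h : ∀ x ∈ Set.Icc a b, stdPDF x ≤ C) :
    stdCDF b - stdCDF a ≤ (b - a) * C := by
  rw [stdCDF_sub]
  calc ∫ u in a..b, stdPDF u ≤ ∫ _ in a..b, C :=
        intervalIntegral.integral_mono_on hab (continuous_stdPDF.intervalIntegrable _ _)
          (continuous_const.intervalIntegrable _ _) h
    _ = _ := by rw [intervalIntegral.integral_const, smul_eq_mul]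

/-- Rescaling the argument of the normal distribution function. -/
lemma stdCDF_div_le {r : ℝ} (hr : 1 / 2 ≤ r) (x : ℝ) :
    stdCDF (x / r) ≤ stdCDF x + 2 * |r - 1| := by
  have hr0 : 0 < r := by linarith
  have habs := abs_nonneg (r - 1)
  -- Only two of the four sign patterns can increase the argument. In those, the density on the
  -- interval is at most its value at the endpoint nearest zero.
  rcases le_total 0 x with hx | hx <;> rcases le_total 1 r with h1 | h1
  · have := stdCDF_mono (div_le_self hx h1); linarith
  · have hle : x ≤ x / r := by rw [le_div_iff₀ hr0]; nlinarith
    have h := stdCDF_sub_le_of_pdf_le hle (C := stdPDF x) fun y hy =>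
      stdPDF_le_of_abs_le (by rw [abs_of_nonneg hx, abs_of_nonneg (hx.trans hy.1)]; exact hy.1)
    have e : (x / r - x) * stdPDF x = (1 - r) / r * (x * stdPDF x) := by field_simp
    have h2 : (1 - r) / r * (x * stdPDF x) ≤ (1 - r) / r * 1 :=
      mul_le_mul_of_nonneg_left (mul_stdPDF_le_one x) (div_nonneg (by linarith) hr0.le)
    have h3 : (1 - r) / r ≤ 2 * (1 - r) := by rw [div_le_iff₀ hr0]; nlinarith
    rw [abs_of_nonpos (by linarith)]
    linarith
  · have hle : x ≤ x / r := by rw [le_div_iff₀ hr0]; nlinarith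
    have hy0 : x / r ≤ 0 := div_nonpos_of_nonpos_of_nonneg hx hr0.le
    have h := stdCDF_sub_le_of_pdf_le hle (C := stdPDF (-(x / r))) fun y hy =>
      stdPDF_le_of_abs_le (by
        rw [abs_neg, abs_of_nonpos hy0, abs_of_nonpos (hy.2.trans hy0)]; linarith [hy.2])
    have e : (x / r - x) * stdPDF (-(x / r)) = (r - 1) * (-(x / r) * stdPDF (-(x / r))) := by
      field_simp; ring
    have h2 : (r - 1) * (-(x / r) * stdPDF (-(x / r))) ≤ (r - 1) * 1 :=
      mul_le_mul_of_nonneg_left (mul_stdPDF_le_one _) (by linarith)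
    rw [abs_of_nonneg (by linarith)]
    linarith
  · have hle : x / r ≤ x := by rw [div_le_iff₀ hr0]; nlinarith
    have := stdCDF_mono hle; linarith

/-! ### Resampled means -/

section Resampling

variable {Ω : Type*} [MeasurableSpace Ω] {P : Measure Ω} [IsProbabilityMeasure P]

lemma integral_comp_uniform {t : ℕ} {J : Ω → Fin t} (hJ : Measurable J)
    (hu : ∀ j, P {ω | J ω = j} = (t : ℝ≥0∞)⁻¹) (f : Fin t → ℝ) :
    ∫ ω, f (J ω) ∂P = (1 / (t : ℝ)) * ∑ j, f j := by
  have : IsProbabilityMeasure (P.map J) := Measure.isProbabilityMeasure_map hJ.aemeasurable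
  rw [← integral_map hJ.aemeasurable (measurable_of_finite f).aestronglyMeasurable,
    integral_fintype (Integrable.of_finite), Finset.mul_sum]
  refine Finset.sum_congr rfl fun j _ => ?_
  have h : (P.map J).real {j} = 1 / (t : ℝ) := by
    rw [measureReal_def, Measure.map_apply hJ (measurableSet_singleton j)]
    have : J ⁻¹' {j} = {ω | J ω = j} := rfl
    rw [this, hu]
    simp
  rw [h, smul_eq_mul]

/-- Normal approximation for the sum of `t` values drawn with replacement from a centred
population `a 1, …, a t`. -/
lemma resampled_sum_cdf_le {t : ℕ} (ht : 1 ≤ t) {J : Fin t → Ω → Fin t}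
    (hJ : ∀ i, Measurable (J i)) (hind : iIndepFun J P)
    (hu : ∀ i j, P {ω | J i ω = j} = (t : ℝ≥0∞)⁻¹) {a : Fin t → ℝ} {τ M : ℝ} (hτ : 0 < τ)
    (hM : 1 ≤ M) (h1 : ∑ j, a j = 0) (h2 : ∑ j, a j ^ 2 = t * τ ^ 2)
    (h4 : ∑ j, a j ^ 4 ≤ t * (M * τ) ^ 4) (c : ℝ) :
    P.real {ω | ∑ i, a (J i ω) ≤ c * √t * τ} ≤ stdCDF c + 41 * M ^ 3 / √t := by
  have htR : (0 : ℝ) < t := by exact_mod_cast ht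
  have hm : ∀ f : Fin t → ℝ, Measurable f := fun f => measurable_of_finite f
  have hne : Nonempty (Fin t) := ⟨⟨0, ht⟩⟩
  have h := berry_esseen (P := P) (X := fun i ω => a (J i ω) / τ)
    (fun i => (hm fun j => a j / τ).comp (hJ i))
    (hind.comp (fun _ j => a j / τ) fun _ => hm _)
    (fun i => ?_) (fun i => ?_) (fun i => ?_) hM (fun i => ?_) Finset.univ
    Finset.univ_nonempty c
  · have h' := (abs_le.1 h).2
    rw [Finset.card_univ, Fintype.card_fin] at h'
    have e : {ω | ∑ i, a (J i ω) ≤ c * √t * τ} = {ω | ∑ i, a (J i ω) / τ ≤ c * √t} := by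
      ext ω
      simp only [Set.mem_ofPred_eq]
      rw [← Finset.sum_div, div_le_iff₀ hτ]
    rw [e]
    linarith
  · have hb : Integrable (fun j : Fin t => (a j / τ) ^ 4) (P.map (J i)) := by
      have : IsProbabilityMeasure (P.map (J i)) :=
        Measure.isProbabilityMeasure_map (hJ i).aemeasurable
      exact Integrable.of_finite
    exact (integrable_map_measure (hm _).aestronglyMeasurable (hJ i).aemeasurable).1 hb
  · rw [integral_comp_uniform (hJ i) (hu i) fun j => a j / τ, ← Finset.sum_div, h1]; simp
  · rw [integral_comp_uniform (hJ i) (hu i) fun j => (a j / τ) ^ 2]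
    simp only [div_pow]
    rw [← Finset.sum_div, h2]
    field_simp
  · rw [integral_comp_uniform (hJ i) (hu i) fun j => (a j / τ) ^ 4]
    simp only [div_pow]
    rw [← Finset.sum_div]
    calc _ ≤ 1 / (t : ℝ) * (t * (M * τ) ^ 4 / τ ^ 4) := by gcongr
      _ = M ^ 4 := by field_simp

end Resampling

/-! ### Empirical moments on the good event -/

section Empirical

variable {H : Type*} [NormedAddCommGroup H] [InnerProductSpace ℝ H]

/-- The deterministic conditions on the sample `u 1, …, u t` under which the bootstrap is close
to its normal approximation. -/
structure GoodSample (g : H) (β σ : ℝ) (k : ℕ) {t : ℕ} (u : Fin t → H) : Prop where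
  norm_sum : ‖∑ i, u i‖ ^ 2 ≤ 24 * k * β * t
  sum_norm_four : ∑ i, ‖u i‖ ^ 4 ≤ 3 * β ^ 2 * t
  sum_sq : (∑ i, ((2 * inner ℝ g (u i)) ^ 2 - σ ^ 2)) ^ 2 ≤ 1600 * k * β ^ 4 * t

/-- The linear part of the bootstrap deviation caused by the `j`-th sample point. -/
def linearPart (g : H) {t : ℕ} (u : Fin t → H) (j : Fin t) : ℝ :=
  2 * inner ℝ (g + (1 / (t : ℝ)) • ∑ i, u i) (u j - (1 / (t : ℝ)) • ∑ i, u i)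

lemma sum_linearPart (g : H) {t : ℕ} (ht : 1 ≤ t) (u : Fin t → H) :
    ∑ j, linearPart g u j = 0 := by
  have htR : (t : ℝ) ≠ 0 := by positivity
  simp only [linearPart]
  rw [← Finset.mul_sum, ← inner_sum, Finset.sum_sub_distrib, Finset.sum_const, Finset.card_univ,
    Fintype.card_fin, ← Nat.cast_smul_eq_nsmul ℝ, smul_smul, mul_one_div_cancel htR, one_smul,
    sub_self, inner_zero_right, mul_zero]

/-- The rate parameter. -/
lemma rate_bounds {K ρ x η : ℝ} (hK : 2 ≤ K) (hρ : 1 / 2 ≤ ρ) (hx : 0 < x)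
    (hη : η = K ^ 2 * x * ρ ^ 3) :
    K * ρ ^ 2 * x ^ 2 ≤ 2 * η ^ 2 ∧ K * ρ ^ 2 * x ≤ η ∧ K * x ^ 2 ≤ 8 * η ^ 2 ∧
      K * ρ * x ≤ 2 * η ∧ ρ ^ 3 * x ≤ η / 4 := by
  -- Since `K ≥ 2` and `ρ ≥ 1/2`, surplus powers of `K` and `ρ` may be inserted at a constant cost,
  -- so all error terms are measured by the single rate `η`.
  have h1 : 1 ≤ K * ρ := by nlinarith
  have hρ0 : 0 < ρ := by linarith
  have hK0 : 0 < K := by linarith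
  have h2 : 1 / 2 ≤ K ^ 3 * ρ ^ 4 := by
    have hK3 : (2 : ℝ) ^ 3 ≤ K ^ 3 := pow_le_pow_left₀ (by norm_num) hK 3
    have hr4 : (1 / 2 : ℝ) ^ 4 ≤ ρ ^ 4 := pow_le_pow_left₀ (by norm_num) hρ 4
    calc (1 / 2 : ℝ) = 2 ^ 3 * (1 / 2) ^ 4 := by norm_num
      _ ≤ _ := by gcongr
  have a1 : K * ρ ^ 2 * x ^ 2 ≤ 2 * η ^ 2 := by
    calc K * ρ ^ 2 * x ^ 2 = 2 * (1 / 2) * (K * ρ ^ 2 * x ^ 2) := by ring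
      _ ≤ 2 * (K ^ 3 * ρ ^ 4) * (K * ρ ^ 2 * x ^ 2) := by gcongr
      _ = 2 * η ^ 2 := by rw [hη]; ring
  have a2 : K * ρ ^ 2 * x ≤ η := by
    calc K * ρ ^ 2 * x = 1 * (K * ρ ^ 2 * x) := by ring
      _ ≤ (K * ρ) * (K * ρ ^ 2 * x) := by gcongr
      _ = η := by rw [hη]; ring
  refine ⟨a1, a2, ?_, ?_, ?_⟩
  · have : K * x ^ 2 * (1 / 2) ^ 2 ≤ K * x ^ 2 * ρ ^ 2 := by gcongr
    nlinarith
  · have : K * ρ * x * (1 / 2) ≤ K * ρ * x * ρ := by gcongr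
    nlinarith
  · have h4 : (2 : ℝ) ^ 2 ≤ K ^ 2 := pow_le_pow_left₀ (by norm_num) hK 2
    have : 2 ^ 2 * (ρ ^ 3 * x) ≤ K ^ 2 * (ρ ^ 3 * x) := by gcongr
    rw [hη]; nlinarith

/-- Young's inequality with weight `η`: when the `e j` have squares of relative size `η²`, the cross
term costs only a relative `O(η)`. -/
lemma abs_sum_two_mul_le {ι : Type*} [Fintype ι] (b e : ι → ℝ) {η : ℝ} (hη : 0 < η) :
    |∑ j, 2 * (b j * e j)| ≤ η * ∑ j, b j ^ 2 + 1 / η * ∑ j, e j ^ 2 := by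
  rw [Finset.mul_sum, Finset.mul_sum, ← Finset.sum_add_distrib]
  refine (Finset.abs_sum_le_sum_abs _ _).trans (Finset.sum_le_sum fun j _ => ?_)
  have p1 : 0 ≤ (1 / η) * (η * b j - e j) ^ 2 := by positivity
  have p2 : 0 ≤ (1 / η) * (η * b j + e j) ^ 2 := by positivity
  have q1 : (1 / η) * (η * b j - e j) ^ 2 =
    η * b j ^ 2 + 1 / η * e j ^ 2 - 2 * (b j * e j) := by field_simp; ring
  have q2 : (1 / η) * (η * b j + e j) ^ 2 =
    η * b j ^ 2 + 1 / η * e j ^ 2 + 2 * (b j * e j) := by field_simp; ring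
  exact abs_le.2 ⟨by linarith, by linarith⟩

set_option maxHeartbeats 1000000 in
/-- Empirical second and fourth moments of the linear part, on the good event. -/
lemma GoodSample.moments {g : H} {β σ : ℝ} {k t : ℕ} {u : Fin t → H}
    (hu : GoodSample g β σ k u) (ht : 1 ≤ t) (hk : 2 ≤ k) (hβ : 0 < β) (hσ : 0 < σ)
    (hg : ‖g‖ ^ 2 ≤ β) (hρ : 1 / 2 ≤ β / σ) {η : ℝ}
    (hη : η = (k : ℝ) ^ 2 / √t * (β / σ) ^ 3) (hη1 : η ≤ 1 / 2000) :
    |∑ j, linearPart g u j ^ 2 - t * σ ^ 2| ≤ t * σ ^ 2 * (500 * η) ∧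
      ∑ j, linearPart g u j ^ 4 ≤ t * (10 * β) ^ 4 := by
  have htR : (0 : ℝ) < t := by exact_mod_cast ht
  have hK : (2 : ℝ) ≤ k := by exact_mod_cast hk
  set K : ℝ := (k : ℝ) with hKdef
  set ρ : ℝ := β / σ with hρdef
  have hβρ : β = ρ * σ := by rw [hρdef]; field_simp
  set x : ℝ := 1 / √t with hx
  have hx0 : 0 < x := by positivity
  have hx2 : t * x ^ 2 = 1 := by rw [hx, div_pow, Real.sq_sqrt htR.le]; field_simp
  have hη' : η = K ^ 2 * x * ρ ^ 3 := by rw [hη, hx]; ring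
  have hρ0 : 0 < ρ := by linarith
  have hη0 : 0 < η := by rw [hη']; positivity
  have hη2 : η ^ 2 ≤ η / 2000 := by
    linarith [sq η, mul_le_mul_of_nonneg_left hη1 hη0.le]
  obtain ⟨r1, r2, r3, -, -⟩ := rate_bounds hK hρ hx0 hη'
  set ub : H := (1 / (t : ℝ)) • ∑ i, u i with hub
  have hsum : ∑ i, u i = (t : ℝ) • ub := by
    rw [hub, smul_smul, mul_one_div_cancel htR.ne', one_smul]
  clear_value ub
  have hubn : ‖ub‖ ^ 2 ≤ 24 * K * β * x ^ 2 := by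
    have h := hu.norm_sum
    rw [hsum, norm_smul, mul_pow, Real.norm_of_nonneg htR.le] at h
    have e : 24 * K * β * x ^ 2 * (t : ℝ) ^ 2 = 24 * K * β * t := by
      calc _ = 24 * K * β * t * (t * x ^ 2) := by ring
        _ = _ := by rw [hx2, mul_one]
    refine le_of_mul_le_mul_right ?_ (show 0 < (t : ℝ) ^ 2 by positivity)
    rw [e]; linarith
  have hubβ : ‖ub‖ ^ 2 ≤ β := by
    refine hubn.trans ?_
    have : 24 * K * β * x ^ 2 = 24 * β * (K * x ^ 2) := by ring
    rw [this]
    have h8 : 24 * β * (K * x ^ 2) ≤ 24 * β * (8 * η ^ 2) := by gcongr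
    have : η ^ 2 ≤ (1 / 2000) ^ 2 := by gcongr
    have hb2 : β * η ^ 2 ≤ β * (1 / 2000) ^ 2 := by gcongr
    linarith
  have hS2 : ∑ i, ‖u i‖ ^ 2 ≤ 2 * β * t := by
    have : ∀ i, ‖u i‖ ^ 2 ≤ (1 / (2 * β)) * ‖u i‖ ^ 4 + β / 2 := fun i => by
      have : 0 ≤ (1 / (2 * β)) * (‖u i‖ ^ 2 - β) ^ 2 := by positivity
      have e : (1 / (2 * β)) * (‖u i‖ ^ 2 - β) ^ 2 =
        (1 / (2 * β)) * ‖u i‖ ^ 4 + β / 2 - ‖u i‖ ^ 2 := by field_simp; ring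
      linarith
    refine (Finset.sum_le_sum fun i _ => this i).trans ?_
    rw [Finset.sum_add_distrib, ← Finset.mul_sum, Finset.sum_const, Finset.card_univ,
      Fintype.card_fin, nsmul_eq_mul]
    have h := hu.sum_norm_four
    have : 1 / (2 * β) * ∑ i, ‖u i‖ ^ 4 ≤ 1 / (2 * β) * (3 * β ^ 2 * t) := by gcongr
    have e : 1 / (2 * β) * (3 * β ^ 2 * t) = 3 / 2 * β * t := by field_simp
    linarith
  have hdev : ∑ j, ‖u j - ub‖ ^ 2 ≤ 2 * β * t := by
    refine le_trans (le_of_eq ?_) ((sub_le_self (∑ i, ‖u i‖ ^ 2)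
      (show 0 ≤ (t : ℝ) * ‖ub‖ ^ 2 by positivity)).trans hS2)
    simp only [norm_sub_sq_real]
    rw [Finset.sum_add_distrib, Finset.sum_sub_distrib, ← Finset.mul_sum, ← sum_inner, hsum,
      real_inner_smul_left, real_inner_self_eq_norm_sq, Finset.sum_const, Finset.card_univ,
      Fintype.card_fin, nsmul_eq_mul]
    ring
  set b : Fin t → ℝ := fun j => 2 * inner ℝ g (u j - ub) with hb
  set e : Fin t → ℝ := fun j => 2 * inner ℝ ub (u j - ub) with he
  -- The main part `b` pairs the centred sample with the true bias `g`; `e` comes from using `g +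
  -- ub` in its place and is of relative order `η`.
  have ha : ∀ j, linearPart g u j = b j + e j := fun j => by
    simp only [linearPart, ← hub, hb, he, inner_add_left]; ring
  have hE : ∑ j, e j ^ 2 ≤ t * σ ^ 2 * (384 * η ^ 2) := by
    have : ∀ j, e j ^ 2 ≤ 4 * ‖ub‖ ^ 2 * ‖u j - ub‖ ^ 2 := fun j => by
      simp only [he, mul_pow]
      have h := real_inner_mul_inner_self_le ub (u j - ub)
      rw [real_inner_self_eq_norm_sq, real_inner_self_eq_norm_sq] at h
      linarith
    refine (Finset.sum_le_sum fun j _ => this j).trans ?_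
    rw [← Finset.mul_sum]
    calc 4 * ‖ub‖ ^ 2 * ∑ j, ‖u j - ub‖ ^ 2 ≤ 4 * (24 * K * β * x ^ 2) * (2 * β * t) := by gcongr
      _ = t * σ ^ 2 * (192 * (K * ρ ^ 2 * x ^ 2)) := by rw [hβρ]; ring
      _ ≤ t * σ ^ 2 * (192 * (2 * η ^ 2)) := by gcongr
      _ = _ := by ring
  have hB : |∑ j, b j ^ 2 - t * σ ^ 2| ≤ t * σ ^ 2 * (41 * η) := by
    -- Centring at the sample mean lowers the second moment by the squared mean, which is of smaller
    -- order.
    have e1 : ∑ j, b j ^ 2 = ∑ j, (2 * inner ℝ g (u j)) ^ 2 - t * (2 * inner ℝ g ub) ^ 2 := by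
      have : ∀ j, b j ^ 2 = (2 * inner ℝ g (u j)) ^ 2 - 8 * inner ℝ g ub * inner ℝ g (u j) +
        (2 * inner ℝ g ub) ^ 2 := fun j => by simp only [hb, inner_sub_right]; ring
      simp only [this]
      rw [Finset.sum_add_distrib, Finset.sum_sub_distrib, ← Finset.mul_sum, ← inner_sum, hsum,
        real_inner_smul_right, Finset.sum_const, Finset.card_univ, Fintype.card_fin, nsmul_eq_mul]
      ring
    have e2 : |∑ j, ((2 * inner ℝ g (u j)) ^ 2 - σ ^ 2)| ≤ t * σ ^ 2 * (40 * η) := by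
      refine abs_le_of_sq_le_sq (hu.sum_sq.trans ?_) (by positivity)
      have hh : (K * ρ ^ 2 * x) ^ 2 ≤ η ^ 2 := by gcongr
      have hKK : K ≤ K ^ 2 := le_self_pow₀ (by linarith) (by norm_num)
      calc 1600 * K * β ^ 4 * t = 1600 * K * β ^ 4 * t * (t * x ^ 2) := by rw [hx2, mul_one]
        _ ≤ 1600 * K ^ 2 * β ^ 4 * t * (t * x ^ 2) := by gcongr
        _ = 1600 * t ^ 2 * σ ^ 4 * (K * ρ ^ 2 * x) ^ 2 := by rw [hβρ]; ring
        _ ≤ 1600 * t ^ 2 * σ ^ 4 * η ^ 2 := by gcongr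
        _ = _ := by ring
    have e3 : t * (2 * inner ℝ g ub) ^ 2 ≤ t * σ ^ 2 * η := by
      have h := real_inner_mul_inner_self_le g ub
      rw [real_inner_self_eq_norm_sq, real_inner_self_eq_norm_sq] at h
      have h2 : ‖g‖ ^ 2 * ‖ub‖ ^ 2 ≤ β * (24 * K * β * x ^ 2) := by gcongr
      have h3 : (2 * inner ℝ g ub) ^ 2 ≤ σ ^ 2 * (96 * (K * ρ ^ 2 * x ^ 2)) := by
        have : β * (24 * K * β * x ^ 2) * 4 = σ ^ 2 * (96 * (K * ρ ^ 2 * x ^ 2)) := by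
          rw [hβρ]; ring
        linarith
      have h4 : σ ^ 2 * (96 * (K * ρ ^ 2 * x ^ 2)) ≤ σ ^ 2 * (96 * (2 * η ^ 2)) := by gcongr
      have h5 : 96 * (2 * η ^ 2) ≤ η := by linarith [hη2]
      have h6 : σ ^ 2 * (96 * (2 * η ^ 2)) ≤ σ ^ 2 * η := by gcongr
      rw [mul_assoc]
      gcongr
      linarith
    rw [e1]
    rw [Finset.sum_sub_distrib, Finset.sum_const, Finset.card_univ, Fintype.card_fin,
      nsmul_eq_mul] at e2
    have e2' := abs_le.1 e2
    have e30 : 0 ≤ t * (2 * inner ℝ g ub) ^ 2 := by positivity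
    exact abs_le.2 ⟨by linarith, by
      have : 0 ≤ t * σ ^ 2 * η := by positivity
      linarith⟩
  constructor
  · have hcross := abs_sum_two_mul_le b e hη0
    have hsplit : ∑ j, linearPart g u j ^ 2 =
        ∑ j, b j ^ 2 + ∑ j, 2 * (b j * e j) + ∑ j, e j ^ 2 := by
      rw [← Finset.sum_add_distrib, ← Finset.sum_add_distrib]
      refine Finset.sum_congr rfl fun j _ => ?_
      rw [ha]; ring
    have hts : 0 < t * σ ^ 2 := by positivity
    set T := t * σ ^ 2 with hT
    have hB' := abs_le.1 hB
    have c1 : η * ∑ j, b j ^ 2 ≤ T * (2 * η) := by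
      have : ∑ j, b j ^ 2 ≤ T * 2 := by linarith [hB'.2, mul_le_mul_of_nonneg_left hη1 hts.le]
      linarith [mul_le_mul_of_nonneg_left this hη0.le]
    have c2 : 1 / η * ∑ j, e j ^ 2 ≤ T * (384 * η) := by
      calc 1 / η * ∑ j, e j ^ 2 ≤ 1 / η * (T * (384 * η ^ 2)) := by gcongr
        _ = _ := by field_simp
    have c3 : T * (384 * η ^ 2) ≤ T * η := by
      gcongr; linarith [hη2]
    have c4 : 0 ≤ ∑ j, e j ^ 2 := Finset.sum_nonneg fun j _ => sq_nonneg _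
    have hcr := abs_le.1 hcross
    have hTη : 0 < T * η := by positivity
    rw [hsplit]
    -- The errors are `41η` from `b`, `2η + 384η` from the cross term and at most `η` from `e`,
    -- within `500η`.
    exact abs_le.2 ⟨by linarith [hB'.1, hcr.1], by linarith [hB'.2, hcr.2]⟩
  · have hg4 : ‖g + ub‖ ^ 2 ≤ 4 * β := by
      have := norm_add_sq_real g ub
      have h2 := norm_sub_sq_real g ub
      linarith [sq_nonneg ‖g - ub‖]
    have hj : ∀ j, linearPart g u j ^ 4 ≤ 2048 * β ^ 2 * (‖u j‖ ^ 4 + β ^ 2) := fun j => by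
      have h := real_inner_mul_inner_self_le (g + ub) (u j - ub)
      rw [real_inner_self_eq_norm_sq, real_inner_self_eq_norm_sq] at h
      have h2 : linearPart g u j ^ 2 ≤ 16 * β * ‖u j - ub‖ ^ 2 := by
        simp only [linearPart, ← hub, mul_pow]
        linarith [mul_le_mul_of_nonneg_right hg4 (sq_nonneg ‖u j - ub‖)]
      have h3 : ‖u j - ub‖ ^ 2 ≤ 2 * ‖u j‖ ^ 2 + 2 * β := by
        have a1 := norm_add_sq_real (u j) ub
        have a2 := norm_sub_sq_real (u j) ub
        linarith [sq_nonneg ‖u j + ub‖]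
      have h4 : linearPart g u j ^ 2 ≤ 32 * β * (‖u j‖ ^ 2 + β) := by
        linarith [mul_le_mul_of_nonneg_left h3 (show 0 ≤ 16 * β by positivity)]
      have h5 : (linearPart g u j ^ 2) ^ 2 ≤ (32 * β * (‖u j‖ ^ 2 + β)) ^ 2 := by gcongr
      have h6 : (‖u j‖ ^ 2 + β) ^ 2 ≤ 2 * (‖u j‖ ^ 4 + β ^ 2) := by
        linarith [sq_nonneg (‖u j‖ ^ 2 - β)]
      calc linearPart g u j ^ 4 = (linearPart g u j ^ 2) ^ 2 := by ring
        _ ≤ _ := h5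
        _ = 1024 * β ^ 2 * (‖u j‖ ^ 2 + β) ^ 2 := by ring
        _ ≤ 1024 * β ^ 2 * (2 * (‖u j‖ ^ 4 + β ^ 2)) := by gcongr
        _ = _ := by ring
    refine (Finset.sum_le_sum fun j _ => hj j).trans ?_
    rw [← Finset.mul_sum, Finset.sum_add_distrib, Finset.sum_const, Finset.card_univ,
      Fintype.card_fin, nsmul_eq_mul]
    have h := hu.sum_norm_four
    calc 2048 * β ^ 2 * (∑ i, ‖u i‖ ^ 4 + t * β ^ 2)
        ≤ 2048 * β ^ 2 * (3 * β ^ 2 * t + t * β ^ 2) := by gcongr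
      _ = 8192 * (t * β ^ 4) := by ring
      _ ≤ 10000 * (t * β ^ 4) := by gcongr; norm_num
      _ = _ := by ring

/-- On the good event, the bootstrap distribution function is bounded by the normal one. -/
lemma GoodSample.bootstrap_cdf_le {Ω : Type*} [MeasurableSpace Ω] {P : Measure Ω}
    [IsProbabilityMeasure P] {g : H} {β σ : ℝ} {k t : ℕ} {u : Fin t → H}
    (hu : GoodSample g β σ k u) (ht : 1 ≤ t) (hk : 2 ≤ k) (hβ : 0 < β) (hσ : 0 < σ)
    (hg : ‖g‖ ^ 2 ≤ β) (hρ : 1 / 2 ≤ β / σ) {η : ℝ}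
    (hη : η = (k : ℝ) ^ 2 / √t * (β / σ) ^ 3) (hη1 : η ≤ 1 / 2000)
    {J : Fin t → Ω → Fin t} (hJ : ∀ i, Measurable (J i)) (hind : iIndepFun J P)
    (hun : ∀ i j, P {ω | J i ω = j} = (t : ℝ≥0∞)⁻¹) (c : ℝ) :
    P.real {ω | ‖g + (1 / (t : ℝ)) • ∑ i, u (J i ω)‖ ^ 2 -
        ‖g + (1 / (t : ℝ)) • ∑ i, u i‖ ^ 2 < c} ≤
      stdCDF (c * √t / σ) + 90000 * η := by
  have htR : (0 : ℝ) < t := by exact_mod_cast ht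
  have hK : (2 : ℝ) ≤ k := by exact_mod_cast hk
  set ρ : ℝ := β / σ with hρdef
  have hβρ : β = ρ * σ := by rw [hρdef]; field_simp
  have hρ0 : 0 < ρ := by linarith
  set x : ℝ := 1 / √t with hx
  have hx0 : 0 < x := by positivity
  have hη' : η = (k : ℝ) ^ 2 * x * ρ ^ 3 := by rw [hη, hx]; ring
  have hη0 : 0 < η := by rw [hη']; positivity
  obtain ⟨-, -, -, -, r5⟩ := rate_bounds hK hρ hx0 hη'
  obtain ⟨m2, m4⟩ := hu.moments ht hk hβ hσ hg hρ hη hη1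
  set S2 := ∑ j, linearPart g u j ^ 2 with hS2
  set τ : ℝ := √(S2 / t) with hτ
  have hS2n : 0 ≤ S2 := Finset.sum_nonneg fun j _ => sq_nonneg _
  have hτ2 : τ ^ 2 = S2 / t := Real.sq_sqrt (by positivity)
  have htτ : S2 = t * τ ^ 2 := by rw [hτ2]; field_simp
  have hrel : |(τ / σ) ^ 2 - 1| ≤ 500 * η := by
    rw [htτ, ← mul_sub, abs_mul, abs_of_pos htR, mul_assoc, mul_le_mul_iff_right₀ htR] at m2
    have e : τ ^ 2 - σ ^ 2 = σ ^ 2 * ((τ / σ) ^ 2 - 1) := by field_simp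
    rw [e, abs_mul, abs_of_pos (by positivity), mul_le_mul_iff_right₀ (by positivity)] at m2
    exact m2
  set r : ℝ := τ / σ with hr
  have hr0 : 0 ≤ r := by positivity
  have hrel' := abs_le.1 hrel
  have hr12 : 1 / 2 ≤ r := 
    (pow_le_pow_iff_left₀ (by norm_num) hr0 two_ne_zero).1 (by linarith [hrel'.1])
  have hr1 : |r - 1| ≤ 500 * η := by
    rw [show r ^ 2 - 1 = (r - 1) * (r + 1) by ring, abs_mul, abs_of_pos (by linarith : 0 < r + 1)]
      at hrel
    linarith [le_mul_of_one_le_right (abs_nonneg (r - 1)) (show 1 ≤ r + 1 by linarith)]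
  have hτr : τ = r * σ := by rw [hr]; field_simp
  have hτ0 : 0 < τ := by rw [hτr]; positivity
  -- Since `τ ≥ σ/2`, the fourth-moment bound `10β = 10ρσ` is at most `20ρ · τ`, so `20ρ` serves as
  -- normalized moment bound.
  have hM : 1 ≤ 20 * ρ := by linarith
  have h := resampled_sum_cdf_le ht hJ hind hun (a := linearPart g u) hτ0 hM
    (sum_linearPart g ht u) htτ (m4.trans (mul_le_mul_of_nonneg_left
      (pow_le_pow_left₀ (by positivity) (by
        rw [hτr, hβρ]
        linarith [mul_le_mul_of_nonneg_left hr12 (mul_pos hρ0 hσ).le]) 4) htR.le)) (c * √t / τ)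
  -- Discarding the nonnegative term `‖us - ub‖²` enlarges the event. This is where the one-sided
  -- nature of the claim is used.
  have hset : {ω | ‖g + (1 / (t : ℝ)) • ∑ i, u (J i ω)‖ ^ 2 -
        ‖g + (1 / (t : ℝ)) • ∑ i, u i‖ ^ 2 < c} ⊆
      {ω | ∑ i, linearPart g u (J i ω) ≤ c * √t / τ * √t * τ} := by
    intro ω hω
    simp only [Set.mem_ofPred_eq] at hω ⊢
    rw [show c * √t / τ * √t * τ = c * (√t * √t) * (τ / τ) by ring, Real.mul_self_sqrt htR.le,
      div_self hτ0.ne', mul_one]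
    set ub := (1 / (t : ℝ)) • ∑ i, u i with hub
    set us := (1 / (t : ℝ)) • ∑ i, u (J i ω) with hus
    have e1 : ∑ i, linearPart g u (J i ω) = t * (2 * inner ℝ (g + ub) (us - ub)) := by
      simp only [linearPart, ← hub]
      rw [← Finset.mul_sum, ← inner_sum, Finset.sum_sub_distrib, Finset.sum_const,
        Finset.card_univ, Fintype.card_fin, ← Nat.cast_smul_eq_nsmul ℝ]
      have : ∑ i, u (J i ω) = (t : ℝ) • us := by
        rw [hus, smul_smul, mul_one_div_cancel htR.ne', one_smul]
      rw [this, ← smul_sub, real_inner_smul_right]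
      ring
    have e2 : ‖g + us‖ ^ 2 = ‖g + ub‖ ^ 2 + 2 * inner ℝ (g + ub) (us - ub) + ‖us - ub‖ ^ 2 := by
      rw [← norm_add_sq_real]; congr 2; abel
    have hle : 2 * inner ℝ (g + ub) (us - ub) ≤ c := by linarith [sq_nonneg ‖us - ub‖]
    rw [e1, mul_comm c]
    exact mul_le_mul_of_nonneg_left hle htR.le
  refine (measureReal_mono hset).trans (h.trans ?_)
  have hs : stdCDF (c * √t / τ) ≤ stdCDF (c * √t / σ) + 2 * |r - 1| := by
    have e : c * √t / τ = c * √t / σ / r := by rw [hτr, div_div, mul_comm r σ]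
    rw [e]
    exact stdCDF_div_le hr12 _
  have hbe : 41 * (20 * ρ) ^ 3 / √t ≤ 82000 * η := by
    have : 41 * (20 * ρ) ^ 3 / √t = 328000 * (ρ ^ 3 * x) := by rw [hx]; ring
    linarith
  linarith

end Empirical

/-! ### Empirical quantiles -/

/-- The empirical quantile lies below `m` iff many sample values lie below `m`. -/
lemma empiricalQuantile_lt_iff {B : ℕ} (hB : 1 ≤ B) {p : ℝ} (hp0 : 0 < p) (hp1 : p < 1)
    (z : Fin B → ℝ) (m : ℝ) :
    empiricalQuantile p z < m ↔
      p * B ≤ ∑ b, Set.indicator {r : ℝ | r < m} (fun _ => (1 : ℝ)) (z b) := by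
  have hBR : (0 : ℝ) < B := by exact_mod_cast hB
  have hcdf : ∀ s, p ≤ empiricalCDF z s ↔
      p * B ≤ ∑ b, Set.indicator {r : ℝ | r ≤ s} (fun _ => (1 : ℝ)) (z b) := fun s => by
    rw [empiricalCDF, one_div_mul_eq_div, le_div_iff₀ hBR]
  -- The real `sInf` has a default value on empty or unbounded sets. Positivity of `p` rules out
  -- unboundedness below, and `p < 1` makes the set nonempty.
  have hbdd : BddBelow {s : ℝ | p ≤ empiricalCDF z s} := by
    obtain ⟨l, hl⟩ := (Set.finite_range z).bddBelow
    refine ⟨l, fun s hs => ?_⟩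
    by_contra hlt
    rw [not_le] at hlt
    have h0 : ∑ b, Set.indicator {r : ℝ | r ≤ s} (fun _ => (1 : ℝ)) (z b) = 0 :=
      Finset.sum_eq_zero fun b _ => Set.indicator_of_notMem
        (show z b ∉ {r : ℝ | r ≤ s} from fun hb =>
          absurd (hl ⟨b, rfl⟩) (not_le.2 (lt_of_le_of_lt hb hlt))) _
    rw [Set.mem_ofPred_eq, hcdf, h0] at hs
    exact absurd hs (not_le.2 (by positivity))
  have hne : {s : ℝ | p ≤ empiricalCDF z s}.Nonempty := by
    obtain ⟨u, hu⟩ := (Set.finite_range z).bddAbove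
    refine ⟨u, ?_⟩
    rw [Set.mem_ofPred_eq, hcdf]
    have h1 : ∑ b, Set.indicator {r : ℝ | r ≤ u} (fun _ => (1 : ℝ)) (z b) = B := by
      rw [Finset.sum_congr rfl fun b _ => Set.indicator_of_mem
        (show z b ∈ {r : ℝ | r ≤ u} from hu ⟨b, rfl⟩) _]
      simp
    rw [h1]
    nlinarith
  constructor
  · intro h
    obtain ⟨s, hs, hsm⟩ := exists_lt_of_csInf_lt hne h
    rw [Set.mem_ofPred_eq, hcdf] at hs
    refine hs.trans (Finset.sum_le_sum fun b _ => ?_)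
    exact Set.indicator_le_indicator_of_subset (fun r hr => lt_of_le_of_lt hr hsm)
      (fun _ => zero_le_one) _
  · intro h
    set S := Finset.univ.filter fun b => z b < m with hS
    have hSne : S.Nonempty := by
      by_contra hempty
      rw [Finset.not_nonempty_iff_eq_empty] at hempty
      have h0 : ∑ b, Set.indicator {r : ℝ | r < m} (fun _ => (1 : ℝ)) (z b) = 0 :=
        Finset.sum_eq_zero fun b _ => Set.indicator_of_notMem (fun hb => by
          have : b ∈ S := by rw [hS, Finset.mem_filter]; exact ⟨Finset.mem_univ _, hb⟩
          rw [hempty] at this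
          exact absurd this (Finset.notMem_empty _)) _
      rw [h0] at h
      exact absurd h (not_le.2 (by positivity))
    -- The largest sample value below `m` already has all values below `m` to its left, so the
    -- quantile is at most this value and hence strictly below `m`.
    obtain ⟨b₀, hb₀, hmax⟩ := S.exists_max_image z hSne
    have hb₀m : z b₀ < m := (Finset.mem_filter.1 hb₀).2
    refine lt_of_le_of_lt (csInf_le hbdd ?_) hb₀m
    rw [Set.mem_ofPred_eq, hcdf]
    refine h.trans (Finset.sum_le_sum fun b _ => ?_)
    by_cases hb : z b < m
    · rw [Set.indicator_of_mem (show z b ∈ {r | r < m} from hb),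
        Set.indicator_of_mem (show z b ∈ {r | r ≤ z b₀} from
          hmax b (Finset.mem_filter.2 ⟨Finset.mem_univ _, hb⟩))]
    · rw [Set.indicator_of_notMem (show z b ∉ {r | r < m} from hb)]
      exact Set.indicator_nonneg (fun _ _ => zero_le_one) _

/-! ### Independent bootstrap samples -/

section Hoeffding

variable {Ω : Type*} [MeasurableSpace Ω] {P : Measure Ω} [IsProbabilityMeasure P]

/-- Grouping a doubly indexed independent family into independent blocks. -/
lemma iIndepFun_blocks {ι κ 𝒴 : Type*} [MeasurableSpace 𝒴] {J : ι → κ → Ω → 𝒴}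
    (hJ : ∀ b i, Measurable (J b i)) (hind : iIndepFun (fun p : ι × κ => J p.1 p.2) P) :
    iIndepFun (fun b ω => fun i => J b i ω) P := by
  have hpm : ∀ b i, IsProbabilityMeasure (P.map (J b i)) := fun b i =>
    Measure.isProbabilityMeasure_map (hJ b i).aemeasurable
  have hsig : iIndepFun (fun (p : (_ : ι) × κ) ω => J p.1 p.2 ω) P :=
    hind.precomp (Equiv.sigmaEquivProd ι κ).injective
  have hrow : ∀ b, iIndepFun (J b) P := fun b =>
    hind.precomp (g := fun i => (b, i)) fun i j h => (Prod.mk.inj h).2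
  have hcurry : (MeasurableEquiv.piCurry fun (_ : ι) (_ : κ) => 𝒴) ∘
      (fun ω (p : (_ : ι) × κ) => J p.1 p.2 ω) = fun ω b i => J b i ω := by
    ext; simp [Sigma.curry]
  -- Independence is the statement that the joint law is a product; currying turns the product over
  -- pairs into the product of the row laws.
  rw [iIndepFun_iff_map_fun_eq_infinitePi_map (by fun_prop)]
  have hr : ∀ b, P.map (fun ω i => J b i ω) = Measure.infinitePi fun i => P.map (J b i) :=
    fun b => (iIndepFun_iff_map_fun_eq_infinitePi_map (hJ b)).1 (hrow b)
  simp_rw [hr]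
  rw [← Measure.infinitePi_map_piCurry fun b i => P.map (J b i),
    ← (iIndepFun_iff_map_fun_eq_infinitePi_map (X := fun (p : (_ : ι) × κ) ω => J p.1 p.2 ω)
      (fun p => hJ p.1 p.2)).1 hsig,
    Measure.map_map (by fun_prop) (by fun_prop), hcurry]

/-- Hoeffding's inequality for the number of successes among `B` independent trials. -/
lemma count_ge_le {𝒴 : Type*} [MeasurableSpace 𝒴] {B : ℕ} (hB : 1 ≤ B) {Y : Fin B → Ω → 𝒴}
    (hY : ∀ b, Measurable (Y b)) (hind : iIndepFun Y P) {A : Set 𝒴} (hA : MeasurableSet A)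
    {q ε : ℝ} (hq : ∀ b, P.real {ω | Y b ω ∈ A} ≤ q) (hε : 0 ≤ ε) :
    P.real {ω | (q + ε) * B ≤ ∑ b, A.indicator (fun _ => (1 : ℝ)) (Y b ω)} ≤
      Real.exp (-(2 * B * ε ^ 2)) := by
  have hBR : (0 : ℝ) < B := by exact_mod_cast hB
  set F : 𝒴 → ℝ := A.indicator (fun _ => (1 : ℝ)) with hF
  have hFm : Measurable F := measurable_const.indicator hA
  have hmean : ∀ b, ∫ ω, F (Y b ω) ∂P ≤ q := fun b => by
    refine le_trans (le_of_eq ?_) (hq b)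
    exact integral_indicator_one (hY b hA)
  have hsub : ∀ b ∈ Finset.univ, HasSubgaussianMGF
      (fun ω => F (Y b ω) - ∫ ω, F (Y b ω) ∂P) ((‖(1 : ℝ) - 0‖₊ / 2) ^ 2) P := fun b _ =>
    hasSubgaussianMGF_of_mem_Icc (hFm.comp (hY b)).aemeasurable (ae_of_all _ fun ω =>
      ⟨Set.indicator_nonneg (fun _ _ => zero_le_one) _,
        Set.indicator_le_self' (fun _ _ => zero_le_one) _⟩)
  have hind' : iIndepFun (fun b ω => F (Y b ω) - ∫ ω, F (Y b ω) ∂P) P :=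
    hind.comp (fun b y => F y - ∫ ω, F (Y b ω) ∂P) fun b => hFm.sub_const _
  have h := HasSubgaussianMGF.measure_sum_ge_le_of_iIndepFun hind' hsub
    (show 0 ≤ B * ε by positivity)
  refine (measureReal_mono fun ω hω => ?_).trans (h.trans (le_of_eq ?_))
  · simp only [Set.mem_ofPred_eq, Finset.sum_sub_distrib] at hω ⊢
    have : ∑ b, ∫ ω, F (Y b ω) ∂P ≤ B * q := by
      refine (Finset.sum_le_sum fun b _ => hmean b).trans ?_
      simp
    linarith
  -- A variable in `[0, 1]` has variance proxy `1/4`, so the exponent is `-(Bε)² / (2 · B/4) =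
  -- -2Bε²`.
  · congr 1
    simp only [sub_zero, nnnorm_one, Finset.sum_const, Finset.card_univ, Fintype.card_fin]
    push_cast
    simp only [nsmul_eq_mul]
    field_simp

end Hoeffding

/-! ### Moments of a centred random vector -/

lemma pow_integral_le {Ξ : Type*} [MeasurableSpace Ξ] {Q : Measure Ξ} [IsProbabilityMeasure Q]
    {f : Ξ → ℝ} (hf0 : ∀ s, 0 ≤ f s) (hf : Integrable f Q) {k : ℕ}
    (hfk : Integrable (fun s => f s ^ k) Q) : (∫ s, f s ∂Q) ^ k ≤ ∫ s, f s ^ k ∂Q :=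
  (convexOn_pow (𝕜 := ℝ) k).map_integral_le (continuous_pow k).continuousOn isClosed_Ici
    (ae_of_all _ hf0) hf hfk

/-- Markov's inequality for the `k`-th power: a threshold `e` times the moment scale `c` gives
probability `e^{-k}`. -/
lemma markov_exp {Ω : Type*} [MeasurableSpace Ω] {P : Measure Ω} [IsProbabilityMeasure P]
    {f : Ω → ℝ} (hf0 : ∀ ω, 0 ≤ f ω) {k : ℕ} (hfk : Integrable (fun ω => f ω ^ k) P)
    {c A : ℝ} (hc : 0 < c) (hA : Real.exp 1 * c ≤ A) (h : ∫ ω, f ω ^ k ∂P ≤ c ^ k) :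
    P.real {ω | A < f ω} ≤ Real.exp (-k) := by
  have hA0 : 0 < A := lt_of_lt_of_le (by positivity) hA
  have h1 := mul_meas_ge_le_integral_of_nonneg (μ := P)
    (ae_of_all _ fun ω => pow_nonneg (hf0 ω) k) hfk (A ^ k)
  have h2 : P.real {ω | A < f ω} ≤ P.real {ω | A ^ k ≤ f ω ^ k} :=
    measureReal_mono fun ω hω => pow_le_pow_left₀ hA0.le (le_of_lt hω) k
  have h3 : (Real.exp 1 * c) ^ k ≤ A ^ k := pow_le_pow_left₀ (by positivity) hA k
  have h4 : (Real.exp 1 * c) ^ k * P.real {ω | A < f ω} ≤ c ^ k :=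
    (mul_le_mul h3 h2 measureReal_nonneg (by positivity)).trans (h1.trans h)
  rw [mul_pow, mul_assoc, mul_left_comm] at h4
  have h5 : Real.exp 1 ^ k * P.real {ω | A < f ω} ≤ 1 :=
    le_of_mul_le_mul_left (by linarith) (show 0 < c ^ k by positivity)
  rw [← Real.exp_nat_mul, mul_one] at h5
  rw [Real.exp_neg, ← one_div, le_div_iff₀ (Real.exp_pos _)]
  linarith

/-- Assumptions on a random vector `X` with law `Q` on the randomizing parameters, and on a fixed
vector `g`, which drive the bootstrap theorem. -/
structure CenteredModel {Ξ H : Type*} [MeasurableSpace Ξ] [NormedAddCommGroup H]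
    [InnerProductSpace ℝ H] (Q : Measure Ξ) (X : Ξ → H) (g : H) (β σ : ℝ) (k : ℕ) : Prop where
  measurable_kernel : Measurable fun p : Ξ × Ξ => (inner ℝ (X p.1) (X p.2) : ℝ)
  measurable_inner : Measurable fun s => (inner ℝ g (X s) : ℝ)
  integral_kernel : ∀ s, ∫ s', inner ℝ (X s) (X s') ∂Q = 0
  integral_inner : ∫ s, inner ℝ g (X s) ∂Q = 0
  beta_pos : 0 < β
  norm_sq_le : ‖g‖ ^ 2 ≤ β
  integrable_norm_pow : Integrable (fun s => ‖X s‖ ^ (4 * k)) Q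
  integral_norm_pow_le : ∫ s, ‖X s‖ ^ (4 * k) ∂Q ≤ β ^ (2 * k)
  sigma_pos : 0 < σ
  integral_sq : ∫ s, (2 * inner ℝ g (X s)) ^ 2 ∂Q = σ ^ 2

namespace CenteredModel

variable {Ξ H : Type*} [MeasurableSpace Ξ] [NormedAddCommGroup H] [InnerProductSpace ℝ H]
  {Q : Measure Ξ} {X : Ξ → H} {g : H} {β σ : ℝ} {k : ℕ}

lemma measurable_norm (h : CenteredModel Q X g β σ k) : Measurable fun s => ‖X s‖ := by
  have : (fun s => ‖X s‖) = fun s => √(inner ℝ (X s) (X s)) := by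
    funext s; rw [real_inner_self_eq_norm_sq, Real.sqrt_sq (norm_nonneg _)]
  rw [this]
  exact (h.measurable_kernel.comp (measurable_id.prodMk measurable_id)).sqrt

lemma zeta_sq_le (h : CenteredModel Q X g β σ k) (s : Ξ) :
    (2 * inner ℝ g (X s)) ^ 2 ≤ 4 * β * ‖X s‖ ^ 2 := by
  have h1 := real_inner_mul_inner_self_le g (X s)
  rw [real_inner_self_eq_norm_sq, real_inner_self_eq_norm_sq] at h1
  have h2 := mul_le_mul_of_nonneg_right h.norm_sq_le (sq_nonneg ‖X s‖)
  linarith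

lemma zeta_pow_le (h : CenteredModel Q X g β σ k) (s : Ξ) (j : ℕ) :
    (2 * inner ℝ g (X s)) ^ (2 * j) ≤ (4 * β) ^ j * ‖X s‖ ^ (2 * j) := by
  rw [pow_mul, pow_mul ‖X s‖, ← mul_pow]
  exact pow_le_pow_left₀ (sq_nonneg _) (h.zeta_sq_le s) j

lemma measurable_zeta (h : CenteredModel Q X g β σ k) :
    Measurable fun s => (2 * inner ℝ g (X s) : ℝ) :=
  h.measurable_inner.const_mul 2

lemma measurable_norm_sum (h : CenteredModel Q X g β σ k) (t : ℕ) :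
    Measurable fun s : Fin t → Ξ => ‖∑ i, X (s i)‖ ^ 2 := by
  have : (fun s : Fin t → Ξ => ‖∑ i, X (s i)‖ ^ 2) =
      fun s => ∑ i, ∑ j, inner ℝ (X (s i)) (X (s j)) := by
    funext s
    rw [← real_inner_self_eq_norm_sq, sum_inner]
    simp_rw [inner_sum]
  rw [this]
  refine Finset.measurable_sum _ fun i _ => Finset.measurable_sum _ fun j _ => ?_
  have hij : Measurable fun s : Fin t → Ξ => (s i, s j) :=
    (measurable_pi_apply i).prodMk (measurable_pi_apply j)
  exact h.measurable_kernel.comp hij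

lemma measurableSet_goodSample (h : CenteredModel Q X g β σ k) (t : ℕ) :
    MeasurableSet {s : Fin t → Ξ | GoodSample g β σ k fun i => X (s i)} := by
  have e : {s : Fin t → Ξ | GoodSample g β σ k fun i => X (s i)} =
      ({s | ‖∑ i, X (s i)‖ ^ 2 ≤ 24 * k * β * t} ∩
        {s | ∑ i, ‖X (s i)‖ ^ 4 ≤ 3 * β ^ 2 * t}) ∩
        {s | (∑ i, ((2 * inner ℝ g (X (s i))) ^ 2 - σ ^ 2)) ^ 2 ≤ 1600 * k * β ^ 4 * t} := by
    ext s
    exact ⟨fun hs => ⟨⟨hs.1, hs.2⟩, hs.3⟩, fun hs => ⟨hs.1.1, hs.1.2, hs.2⟩⟩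
  rw [e]
  refine ((measurableSet_le (h.measurable_norm_sum t) measurable_const).inter
    (measurableSet_le ?_ measurable_const)).inter (measurableSet_le ?_ measurable_const)
  · exact Finset.measurable_sum _ fun i _ =>
      (h.measurable_norm.comp (measurable_pi_apply i)).pow_const 4
  · exact (Finset.measurable_sum _ fun i _ =>
      (((h.measurable_zeta.comp (measurable_pi_apply i)).pow_const 2).sub_const _)).pow_const 2

variable [IsProbabilityMeasure Q]

lemma integrable_norm_pow_of_le (h : CenteredModel Q X g β σ k) {j : ℕ} (hj : j ≤ 4 * k) :
    Integrable (fun s => ‖X s‖ ^ j) Q := by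
  refine Integrable.mono' ((integrable_const (1 : ℝ)).add h.integrable_norm_pow)
    (h.measurable_norm.pow_const _).aestronglyMeasurable (ae_of_all _ fun s => ?_)
  rw [Real.norm_of_nonneg (by positivity)]
  simp only [Pi.add_apply]
  rcases le_total ‖X s‖ 1 with h1 | h1
  · have := pow_le_one₀ (n := j) (norm_nonneg (X s)) h1
    have : 0 ≤ ‖X s‖ ^ (4 * k) := by positivity
    linarith
  · have := pow_le_pow_right₀ h1 hj
    linarith

/-- Lyapunov's inequality for the moments of a centred model. -/
lemma integral_norm_pow_two_mul_le (h : CenteredModel Q X g β σ k) {j l : ℕ} (hl : l ≠ 0)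
    (hj : j * l = 2 * k) : ∫ s, ‖X s‖ ^ (2 * j) ∂Q ≤ β ^ j := by
  have hle : 2 * j ≤ 4 * k := by
    have : j ≤ j * l := Nat.le_mul_of_pos_right j (Nat.pos_of_ne_zero hl)
    omega
  have e : ∀ s, (‖X s‖ ^ (2 * j)) ^ l = ‖X s‖ ^ (4 * k) := fun s => by
    rw [← pow_mul]; congr 1; rw [mul_assoc, hj]; omega
  have h1 := pow_integral_le (Q := Q) (f := fun s => ‖X s‖ ^ (2 * j)) (k := l)
    (fun s => by positivity) (h.integrable_norm_pow_of_le hle)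
    (by simp only [e]; exact h.integrable_norm_pow)
  simp only [e] at h1
  have h2 := h1.trans h.integral_norm_pow_le
  rw [← hj, pow_mul] at h2
  exact (pow_le_pow_iff_left₀ (integral_nonneg fun s => by positivity)
    (pow_nonneg h.beta_pos.le _) hl).1 h2

lemma integrable_zeta_pow (h : CenteredModel Q X g β σ k) {j : ℕ} (hj : j ≤ 2 * k) :
    Integrable (fun s => (2 * inner ℝ g (X s) : ℝ) ^ (2 * j)) Q := by
  refine Integrable.mono' ((h.integrable_norm_pow_of_le (show 2 * j ≤ 4 * k by omega)).const_mul
    ((4 * β) ^ j)) (h.measurable_zeta.pow_const _).aestronglyMeasurable (ae_of_all _ fun s => ?_)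
  rw [Real.norm_of_nonneg (by rw [pow_mul]; positivity)]
  exact h.zeta_pow_le s j

/-- Cauchy–Schwarz bounds the square of `2⟨g, X⟩` by `4β‖X‖²`, after which Lyapunov's inequality
applies. -/
lemma integral_zeta_pow_le (h : CenteredModel Q X g β σ k) {j l : ℕ} (hl : l ≠ 0)
    (hj : j * l = 2 * k) : ∫ s, (2 * inner ℝ g (X s) : ℝ) ^ (2 * j) ∂Q ≤ (2 * β) ^ (2 * j) := by
  have hle : j ≤ 2 * k := hj ▸ Nat.le_mul_of_pos_right j (Nat.pos_of_ne_zero hl)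
  refine (integral_mono (h.integrable_zeta_pow hle) ((h.integrable_norm_pow_of_le
    (show 2 * j ≤ 4 * k by omega)).const_mul ((4 * β) ^ j)) fun s => h.zeta_pow_le s j).trans ?_
  rw [integral_const_mul]
  have hβ := h.beta_pos
  calc (4 * β) ^ j * ∫ s, ‖X s‖ ^ (2 * j) ∂Q ≤ (4 * β) ^ j * β ^ j := by
        gcongr; exact h.integral_norm_pow_two_mul_le hl hj
    _ = _ := by rw [← mul_pow, pow_mul]; congr 1; ring

/-- The second-moment case of `integral_zeta_pow_le` gives `σ ≤ 2β`. It provides the lower bound on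
`β/σ` needed by `rate_bounds`, and makes multiples such as `2β/σ` admissible as normalized moment
bounds, which must be at least one. -/
lemma half_le_ratio (h : CenteredModel Q X g β σ k) (hk : k ≠ 0) : 1 / 2 ≤ β / σ := by
  have h1 := h.integral_zeta_pow_le (j := 1) (l := 2 * k) (by omega) (by omega)
  rw [mul_one, h.integral_sq] at h1
  have h2 : σ ≤ 2 * β :=
    (pow_le_pow_iff_left₀ h.sigma_pos.le (by linarith [h.beta_pos]) two_ne_zero).1 h1
  rw [le_div_iff₀ h.sigma_pos]
  linarith

variable {Ω : Type*} [MeasurableSpace Ω] {P : Measure Ω} [IsProbabilityMeasure P]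

/-- The good event has probability at least `1 - 3 e^{-k}`. -/
lemma prob_not_goodSample_le (h : CenteredModel Q X g β σ k) (hk : 1 ≤ k) {t : ℕ} (ht : 1 ≤ t)
    {ξ : ℕ → Ω → Ξ} (hξ : ∀ i, Measurable (ξ i)) (hind : iIndepFun ξ P)
    (hQ : ∀ i, P.map (ξ i) = Q) :
    P.real {ω | ¬ GoodSample g β σ k fun i : Fin t => X (ξ i ω)} ≤ 3 * Real.exp (-k) := by
  have htR : (0 : ℝ) < t := by exact_mod_cast ht
  have hkR : (0 : ℝ) < k := by exact_mod_cast hk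
  have hβ := h.beta_pos
  have he := Real.exp_one_lt_d9
  have p1 : P.real {ω | 24 * k * β * t < ‖∑ i : Fin t, X (ξ i ω)‖ ^ 2} ≤ Real.exp (-k) := by
    obtain ⟨m1, m2⟩ := moment_sum_le h.measurable_kernel h.integral_kernel hk
      (h.integrable_norm_pow_of_le (show 2 * k ≤ 4 * k by omega)) hξ hind hQ t
    have e : ∀ ω, ‖∑ i ∈ Finset.range t, X (ξ i ω)‖ ^ (2 * k) =
        (‖∑ i : Fin t, X (ξ i ω)‖ ^ 2) ^ k := fun ω => by
      rw [← pow_mul, Finset.sum_range fun i => X (ξ i ω)]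
    simp only [e] at m1 m2
    -- The threshold constant `24` in `GoodSample` is chosen above `8e`.
    refine markov_exp (c := 8 * k * t * β) (fun ω => sq_nonneg _) m1 (by positivity) ?_ ?_
    · have : 0 < k * t * β := by positivity
      nlinarith
    · refine m2.trans ?_
      rw [mul_pow _ β]
      gcongr
      exact h.integral_norm_pow_two_mul_le two_ne_zero (by ring)
  have p2 : P.real {ω | 3 * β ^ 2 * t < ∑ i : Fin t, ‖X (ξ i ω)‖ ^ 4} ≤ Real.exp (-k) := by
    have hi : ∀ i, Integrable (fun ω => ‖X (ξ i ω)‖ ^ (4 * k)) P := fun i => by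
      have := h.integrable_norm_pow
      rw [← hQ i] at this
      exact (integrable_map_measure (h.measurable_norm.pow_const _).aestronglyMeasurable
        (hξ i).aemeasurable).1 this
    have hie : ∀ i, ∫ ω, ‖X (ξ i ω)‖ ^ (4 * k) ∂P = ∫ s, ‖X s‖ ^ (4 * k) ∂Q := fun i => by
      rw [← hQ i, integral_map (hξ i).aemeasurable
        (h.measurable_norm.pow_const _).aestronglyMeasurable]
    -- The power mean inequality suffices here, since no cancellation is needed for a sum of
    -- nonnegative terms.
    have hpt : ∀ ω, (∑ i : Fin t, ‖X (ξ i ω)‖ ^ 4) ^ k ≤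
        (t : ℝ) ^ (k - 1) * ∑ i : Fin t, ‖X (ξ i ω)‖ ^ (4 * k) := fun ω => by
      have hp := pow_sum_div_card_le_sum_pow (s := (Finset.univ : Finset (Fin t)))
        (f := fun i => ‖X (ξ i ω)‖ ^ 4) (fun i _ => by positivity) (k - 1)
      rw [Nat.sub_add_cancel hk, div_le_iff₀ (by simp; positivity)] at hp
      simp only [← pow_mul, Finset.card_univ, Fintype.card_fin] at hp
      linarith
    have hmeas : Measurable fun ω => ∑ i : Fin t, ‖X (ξ i ω)‖ ^ 4 :=
      Finset.measurable_sum _ fun i _ => (h.measurable_norm.comp (hξ i)).pow_const 4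
    have hsi : Integrable (fun ω => (t : ℝ) ^ (k - 1) * ∑ i : Fin t, ‖X (ξ i ω)‖ ^ (4 * k)) P :=
      (integrable_finsetSum (f := fun (i : Fin t) ω => ‖X (ξ i ω)‖ ^ (4 * k)) Finset.univ
        fun i _ => hi i).const_mul _
    have hint : Integrable (fun ω => (∑ i : Fin t, ‖X (ξ i ω)‖ ^ 4) ^ k) P :=
      Integrable.mono' hsi (hmeas.pow_const k).aestronglyMeasurable (ae_of_all _ fun ω => by
        rw [Real.norm_of_nonneg (by positivity)]; exact hpt ω)
    refine markov_exp (c := β ^ 2 * t) (fun ω => by positivity) hint (by positivity) ?_ ?_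
    · have : 0 < β ^ 2 * t := by positivity
      nlinarith
    · refine (integral_mono hint hsi hpt).trans ?_
      rw [integral_const_mul, integral_finsetSum _ fun (i : Fin t) _ => hi i]
      simp only [hie, Finset.sum_const, Finset.card_univ, Fintype.card_fin, nsmul_eq_mul]
      have h1 := h.integral_norm_pow_le
      have e : (β ^ 2 * t) ^ k = (t : ℝ) ^ (k - 1) * (t * β ^ (2 * k)) := by
        rw [mul_pow, ← pow_mul, ← mul_assoc, ← pow_succ, Nat.sub_add_cancel hk]; ring
      rw [e]
      gcongr
  have p3 : P.real {ω | 1600 * k * β ^ 4 * t <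
      (∑ i : Fin t, ((2 * inner ℝ g (X (ξ i ω))) ^ 2 - σ ^ 2)) ^ 2} ≤ Real.exp (-k) := by
    set Y : Ξ → ℝ := fun s => (2 * inner ℝ g (X s)) ^ 2 - σ ^ 2 with hY
    have hYm : Measurable Y := (h.measurable_zeta.pow_const 2).sub_const _
    have hz1 : Integrable (fun s => (2 * inner ℝ g (X s) : ℝ) ^ 2) Q := by
      simpa using h.integrable_zeta_pow (j := 1) (by omega)
    have hY0 : ∫ s, Y s ∂Q = 0 := by
      simp only [hY]
      rw [integral_sub hz1 (integrable_const _), h.integral_sq]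
      simp
    have hz2 := h.integrable_zeta_pow (j := 2 * k) le_rfl
    have hσβ : σ ^ 2 ≤ (2 * β) ^ 2 := by
      have := h.integral_zeta_pow_le (j := 1) (l := 2 * k) (by omega) (by omega)
      rwa [mul_one, h.integral_sq] at this
    -- Both terms of the difference are nonnegative, so its modulus is at most the larger; and `σ² ≤
    -- (2β)²`.
    have hYpt : ∀ s, ‖Y s‖ ^ (2 * k) ≤
        (2 * inner ℝ g (X s) : ℝ) ^ (2 * (2 * k)) + (2 * β) ^ (2 * (2 * k)) := fun s => by
      have a0 : 0 ≤ (2 * inner ℝ g (X s) : ℝ) ^ 2 := sq_nonneg _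
      have hle : ‖Y s‖ ≤ max ((2 * inner ℝ g (X s) : ℝ) ^ 2) ((2 * β) ^ 2) := by
        rw [Real.norm_eq_abs]
        refine abs_le.2 ⟨?_, ?_⟩
        · have := le_max_right ((2 * inner ℝ g (X s) : ℝ) ^ 2) ((2 * β) ^ 2)
          simp only [hY]; linarith
        · have := le_max_left ((2 * inner ℝ g (X s) : ℝ) ^ 2) ((2 * β) ^ 2)
          simp only [hY]; nlinarith [sq_nonneg σ]
      refine (pow_le_pow_left₀ (norm_nonneg _) hle _).trans ?_
      have n1 : 0 ≤ ((2 * inner ℝ g (X s) : ℝ) ^ 2) ^ (2 * k) := by positivity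
      have n2 : 0 ≤ ((2 * β) ^ 2) ^ (2 * k) := by positivity
      rw [pow_mul _ 2 (2 * k), pow_mul (2 * β) 2 (2 * k)]
      rcases le_total ((2 * inner ℝ g (X s) : ℝ) ^ 2) ((2 * β) ^ 2) with hm | hm
      · rw [max_eq_right hm]; linarith
      · rw [max_eq_left hm]; linarith
    have hYi : Integrable (fun s => ‖Y s‖ ^ (2 * k)) Q :=
      Integrable.mono' (hz2.add (integrable_const _))
        (hYm.norm.pow_const _).aestronglyMeasurable (ae_of_all _ fun s => by
          rw [Real.norm_of_nonneg (by positivity)]; exact hYpt s)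
    have hYle : ∫ s, ‖Y s‖ ^ (2 * k) ∂Q ≤ (64 * β ^ 4) ^ k := by
      refine (integral_mono hYi (hz2.add (integrable_const _)) hYpt).trans ?_
      rw [integral_add' hz2 (integrable_const _)]
      have := h.integral_zeta_pow_le (j := 2 * k) (l := 1) one_ne_zero (by ring)
      simp only [integral_const, probReal_univ, one_smul]
      have e1 : (2 * β) ^ (2 * (2 * k)) = (16 * β ^ 4) ^ k := by
        rw [← mul_assoc, pow_mul]; congr 1; ring
      have e2 : (64 * β ^ 4) ^ k = 4 ^ k * (16 * β ^ 4) ^ k := by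
        rw [← mul_pow]; congr 1; ring
      have e3 : (2 : ℝ) ≤ 4 ^ k := by
        have := le_self_pow₀ (show (1 : ℝ) ≤ 4 by norm_num) (show k ≠ 0 by omega)
        linarith
      rw [e1] at this
      rw [e1, e2]
      nlinarith [pow_pos (show 0 < 16 * β ^ 4 by positivity) k]
    -- The vector inequality, used for scalars, exploits cancellation between the centred squares.
    -- The threshold `1600` exceeds `8 · 64 · e`.
    obtain ⟨m1, m2⟩ := moment_sum_le (H := ℝ) (X := Y) (Q := Q) (P := P) (k := k)
      (by simp only [inner, RCLike.re_to_real]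
          exact (hYm.comp measurable_snd).mul (hYm.comp measurable_fst))
      (fun s => by
        simp only [inner, RCLike.re_to_real]
        rw [integral_mul_const, hY0, zero_mul]) hk hYi hξ hind hQ t
    have e : ∀ ω, ‖∑ i ∈ Finset.range t, Y (ξ i ω)‖ ^ (2 * k) =
        ((∑ i : Fin t, Y (ξ i ω)) ^ 2) ^ k := fun ω => by
      rw [Finset.sum_range fun i => Y (ξ i ω), Real.norm_eq_abs, pow_mul, sq_abs]
    simp only [e] at m1 m2
    refine markov_exp (c := 8 * k * t * (64 * β ^ 4)) (fun ω => sq_nonneg _) m1 (by positivity)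
      ?_ ?_
    · have : 0 < k * t * β ^ 4 := by positivity
      nlinarith
    · refine m2.trans ?_
      rw [mul_pow _ (64 * β ^ 4)]
      gcongr
  have hcover : {ω | ¬ GoodSample g β σ k fun i : Fin t => X (ξ i ω)} ⊆
      ({ω | 24 * k * β * t < ‖∑ i : Fin t, X (ξ i ω)‖ ^ 2} ∪
        {ω | 3 * β ^ 2 * t < ∑ i : Fin t, ‖X (ξ i ω)‖ ^ 4}) ∪
        {ω | 1600 * k * β ^ 4 * t <
          (∑ i : Fin t, ((2 * inner ℝ g (X (ξ i ω))) ^ 2 - σ ^ 2)) ^ 2} := by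
    intro ω hω
    by_contra hcon
    simp only [Set.mem_union, Set.mem_ofPred_eq, not_or, not_lt] at hcon
    exact hω ⟨hcon.1.1, hcon.1.2, hcon.2⟩
  refine (measureReal_mono hcover).trans ((measureReal_union_le _ _).trans ?_)
  have := measureReal_union_le (μ := P) {ω | 24 * k * β * t < ‖∑ i : Fin t, X (ξ i ω)‖ ^ 2}
    {ω | 3 * β ^ 2 * t < ∑ i : Fin t, ‖X (ξ i ω)‖ ^ 4}
  linarith

end CenteredModel

/-! ### Coverage of the bootstrap quantile for fixed data -/

lemma continuous_stdCDF : Continuous stdCDF := by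
  refine (LipschitzWith.of_dist_le_mul (K := 1) fun a b => ?_).continuous
  rw [Real.dist_eq, Real.dist_eq, NNReal.coe_one, one_mul]
  rcases le_total a b with h | h
  · rw [abs_of_nonpos (sub_nonpos.2 (stdCDF_mono h)), abs_of_nonpos (sub_nonpos.2 h)]
    linarith [stdCDF_sub_le h]
  · rw [abs_of_nonneg (sub_nonneg.2 (stdCDF_mono h)), abs_of_nonneg (sub_nonneg.2 h)]
    linarith [stdCDF_sub_le h]

/-- The Mills-type bound at `1/v` and at `1/(1 - v)` brackets the level, and the intermediate value
theorem concludes. -/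
lemma exists_stdCDF_eq {v : ℝ} (h0 : 0 < v) (h1 : v < 1) : ∃ z, stdCDF z = v := by
  have hlow : stdCDF (-(1 / v)) ≤ v := by
    have h := (neg_mul_setIntegral_Iic_stdPDF_le (-(1 / v))).trans (stdPDF_le_half _)
    rw [neg_neg, one_div_mul_eq_div, div_le_iff₀ h0] at h
    simp only [stdCDF]
    linarith
  have hhigh : v ≤ stdCDF (1 / (1 - v)) := by
    have h1' : 0 < 1 - v := by linarith
    have h := (mul_setIntegral_Ioi_stdPDF_le (1 / (1 - v))).trans (stdPDF_le_half _)
    rw [one_div_mul_eq_div, div_le_iff₀ h1'] at h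
    have h2 := setIntegral_Iic_add_Ioi_stdPDF (1 / (1 - v))
    simp only [stdCDF]
    linarith
  exact mem_range_of_exists_le_of_exists_ge continuous_stdCDF ⟨_, hlow⟩ ⟨_, hhigh⟩

/-- The left side is `B⁻²`. Squaring reduces the claim to `B⁻³ ≤ log B`, true because `B⁻³ ≤ 1/2 ≤
log B` for `B ≥ 2`. -/
lemma exp_neg_two_mul_log_le {B : ℕ} (hB : 2 ≤ B) :
    Real.exp (-(2 * B * √(Real.log B / B) ^ 2)) ≤ √(Real.log B / B) := by
  have hBR : (2 : ℝ) ≤ B := by exact_mod_cast hB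
  have hB0 : (0 : ℝ) < B := by linarith
  set L := Real.log B with hL
  have hL2 : 1 / 2 ≤ L := by
    have := Real.log_le_log (by norm_num) hBR
    linarith [Real.log_two_gt_d9]
  have hBL : (B : ℝ) = Real.exp L := (Real.exp_log hB0).symm
  rw [Real.sq_sqrt (by positivity), show 2 * (B : ℝ) * (L / B) = 2 * L by field_simp]
  apply Real.le_sqrt_of_sq_le
  rw [hBL, le_div_iff₀ (Real.exp_pos _), ← Real.exp_nat_mul, ← Real.exp_add]
  have e : ((2 : ℕ) : ℝ) * -(2 * L) + L = -(3 * L) := by push_cast; ring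
  rw [e, Real.exp_neg]
  have h3 := Real.add_one_le_exp (3 * L)
  have : (Real.exp (3 * L))⁻¹ ≤ (2 : ℝ)⁻¹ := inv_anti₀ (by norm_num) (by linarith)
  linarith

namespace CenteredModel

variable {Ξ H : Type*} [MeasurableSpace Ξ] [NormedAddCommGroup H] [InnerProductSpace ℝ H]
  {Q : Measure Ξ} {X : Ξ → H} {g : H} {β σ : ℝ} {k : ℕ}

lemma measurable_norm_add_mean (h : CenteredModel Q X g β σ k) {t : ℕ} (c : ℝ)
    (j : Fin t → Fin t) :
    Measurable fun s : Fin t → Ξ => ‖g + c • ∑ i, X (s (j i))‖ ^ 2 := by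
  have : (fun s : Fin t → Ξ => ‖g + c • ∑ i, X (s (j i))‖ ^ 2) = fun s =>
      ‖g‖ ^ 2 + 2 * (c * ∑ i, inner ℝ g (X (s (j i)))) +
        c ^ 2 * ‖∑ i, X (s (j i))‖ ^ 2 := by
    funext s
    rw [norm_add_sq_real, real_inner_smul_right, inner_sum, norm_smul, mul_pow, Real.norm_eq_abs,
      sq_abs]
  rw [this]
  have hm : Measurable fun s : Fin t → Ξ => fun i => s (j i) :=
    measurable_pi_lambda _ fun i => measurable_pi_apply (j i)
  have h1 : Measurable fun s : Fin t → Ξ => ∑ i, (inner ℝ g (X (s (j i))) : ℝ) :=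
    Finset.measurable_sum _ fun i _ => h.measurable_inner.comp (measurable_pi_apply (j i))
  have h2 := (h.measurable_norm_sum t).comp hm
  exact (measurable_const.add ((h1.const_mul c).const_mul 2)).add (h2.const_mul (c ^ 2))

variable [IsProbabilityMeasure Q] {Ω : Type*} [MeasurableSpace Ω] {P : Measure Ω}
  [IsProbabilityMeasure P]

/-- Upper tail of the standardized linear statistic, after applying the normal distribution
function. -/
lemma prob_le_stdCDF_le (h : CenteredModel Q X g β σ k) (hk : 2 ≤ k) {t : ℕ} (ht : 1 ≤ t)
    {ξ : ℕ → Ω → Ξ} (hξ : ∀ i, Measurable (ξ i)) (hind : iIndepFun ξ P)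
    (hQ : ∀ i, P.map (ξ i) = Q) {η : ℝ} (hη : η = (k : ℝ) ^ 2 / √t * (β / σ) ^ 3) {v : ℝ}
    (hv : v < 1) :
    P.real {ω | v ≤ stdCDF ((∑ i : Fin t, 2 * inner ℝ g (X (ξ i ω))) / (√t * σ))} ≤
      1 - v + 83 * η := by
  have htR : (0 : ℝ) < t := by exact_mod_cast ht
  have hK : (2 : ℝ) ≤ k := by exact_mod_cast hk
  have hσ := h.sigma_pos
  have hρ := h.half_le_ratio (by omega)
  set ρ : ℝ := β / σ with hρdef
  have hβρ : β = ρ * σ := by rw [hρdef]; field_simp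
  set x : ℝ := 1 / √t with hx
  have hx0 : 0 < x := by positivity
  have hη' : η = (k : ℝ) ^ 2 * x * ρ ^ 3 := by rw [hη, hx]; ring
  have hρ0 : 0 < ρ := by linarith
  have hη0 : 0 < η := by rw [hη']; positivity
  obtain ⟨-, -, -, -, r5⟩ := rate_bounds hK hρ hx0 hη'
  -- If `v ≤ η` the right side is at least one. Otherwise `v - η` is a value of `stdCDF`, and the
  -- gap `η` forces the sum strictly beyond the corresponding point `z`.
  rcases le_or_gt (v - η) 0 with hv0 | hv0
  · have : P.real {ω | v ≤ stdCDF ((∑ i : Fin t, 2 * inner ℝ g (X (ξ i ω))) / (√t * σ))} ≤ 1 :=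
      measureReal_le_one
    linarith
  obtain ⟨z, hz⟩ := exists_stdCDF_eq hv0 (by linarith)
  set ζ : Ξ → ℝ := fun s => 2 * inner ℝ g (X s) / σ with hζ
  have hζm : Measurable ζ := h.measurable_zeta.div_const σ
  have hmap : ∀ (F : ℝ → ℝ), Measurable F → ∀ i, ∫ ω, F (ζ (ξ i ω)) ∂P = ∫ s, F (ζ s) ∂Q :=
    fun F hF i => by
      rw [← hQ i]
      exact (integral_map (f := fun s => F (ζ s)) (hξ i).aemeasurable
        (hF.comp hζm).aestronglyMeasurable).symm
  have hi4 : Integrable (fun s => ζ s ^ 4) Q := by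
    have := h.integrable_zeta_pow (j := 2) (by omega)
    simp only [hζ, div_pow]
    exact this.div_const _
  have hbe := berry_esseen (P := P) (X := fun i ω => ζ (ξ i ω)) (fun i => hζm.comp (hξ i))
    (hind.comp (fun _ => ζ) fun _ => hζm)
    (fun i => by
      rw [← hQ i] at hi4
      exact (integrable_map_measure (hζm.pow_const 4).aestronglyMeasurable
        (hξ i).aemeasurable).1 hi4)
    (fun i => by
      refine (hmap id measurable_id i).trans ?_
      simp only [id, hζ]
      rw [integral_div, integral_const_mul, h.integral_inner]; simp)
    (fun i => by
      rw [hmap (fun y => y ^ 2) (by fun_prop)]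
      simp only [hζ, div_pow]
      rw [integral_div, h.integral_sq, div_self (by positivity)])
    (M := 2 * ρ) (by linarith)
    (fun i => by
      rw [hmap (fun y => y ^ 4) (by fun_prop)]
      simp only [hζ, div_pow]
      rw [integral_div, div_le_iff₀ (by positivity), ← mul_pow]
      have := h.integral_zeta_pow_le (j := 2) (l := k) (by omega) rfl
      rwa [show 2 * ρ * σ = 2 * β by rw [hβρ]; ring])
    (Finset.range t) (by simp; omega) z
  rw [Finset.card_range] at hbe
  have hmeas : MeasurableSet {ω | ∑ i ∈ Finset.range t, ζ (ξ i ω) ≤ z * √t} :=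
    measurableSet_le (Finset.measurable_sum _ fun i _ => hζm.comp (hξ i)) measurable_const
  have hsub : {ω | v ≤ stdCDF ((∑ i : Fin t, 2 * inner ℝ g (X (ξ i ω))) / (√t * σ))} ⊆
      {ω | ∑ i ∈ Finset.range t, ζ (ξ i ω) ≤ z * √t}ᶜ := by
    intro ω hω hcon
    simp only [Set.mem_ofPred_eq] at hω hcon
    rw [Finset.sum_range fun i => ζ (ξ i ω)] at hcon
    simp only [hζ] at hcon
    rw [← Finset.sum_div, div_le_iff₀ hσ] at hcon
    have : (∑ i : Fin t, 2 * inner ℝ g (X (ξ i ω))) / (√t * σ) ≤ z := by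
      rw [div_le_iff₀ (by positivity)]; linarith
    have := stdCDF_mono this
    linarith
  have h1 := measureReal_mono (μ := P) hsub
  rw [probReal_compl_eq_one_sub hmeas] at h1
  have h2 := (abs_le.1 hbe).1
  have h3 : 41 * (2 * ρ) ^ 3 / √t ≤ 82 * η := by
    have : 41 * (2 * ρ) ^ 3 / √t = 328 * (ρ ^ 3 * x) := by rw [hx]; ring
    linarith
  linarith

/-- **Coverage of the bootstrap quantile**, for fixed data. -/
theorem coverage (h : CenteredModel Q X g β σ k) (hk : 2 ≤ k) {t B : ℕ} (ht : 1 ≤ t) (hB : 2 ≤ B)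
    {α : ℝ} (hα0 : 0 < α) (hα1 : α < 1)
    {ξ : ℕ → Ω → Ξ} (hξ : ∀ i, Measurable (ξ i)) (hind : iIndepFun ξ P)
    (hQ : ∀ i, P.map (ξ i) = Q) {J : Fin B → Fin t → Ω → Fin t} (hJ : ∀ b i, Measurable (J b i))
    (hJind : iIndepFun (fun p : Fin B × Fin t => J p.1 p.2) P)
    (hJu : ∀ b i j, P {ω | J b i ω = j} = (t : ℝ≥0∞)⁻¹)
    (hξJ : IndepFun (fun ω i => ξ i ω) (fun ω b i => J b i ω) P) :
    1 - α - 200000 * ((k : ℝ) ^ 2 / √t * (β / σ) ^ 3 + Real.exp (-(k : ℝ) / 2) +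
        √(Real.log B / B)) ≤
      P.real {ω | ‖g + (1 / (t : ℝ)) • ∑ i : Fin t, X (ξ i ω)‖ ^ 2 - ‖g‖ ^ 2 ≤
        empiricalQuantile (1 - α) fun b : Fin B =>
          ‖g + (1 / (t : ℝ)) • ∑ i, X (ξ (J b i ω) ω)‖ ^ 2 -
            ‖g + (1 / (t : ℝ)) • ∑ i : Fin t, X (ξ i ω)‖ ^ 2} := by
  have htR : (0 : ℝ) < t := by exact_mod_cast ht
  have hK : (2 : ℝ) ≤ k := by exact_mod_cast hk
  have hσ := h.sigma_pos
  have hρ := h.half_le_ratio (by omega)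
  set η : ℝ := (k : ℝ) ^ 2 / √t * (β / σ) ^ 3 with hη
  set ε : ℝ := √(Real.log B / B) with hε
  have hε0 : 0 ≤ ε := Real.sqrt_nonneg _
  have hexp0 : 0 < Real.exp (-(k : ℝ) / 2) := Real.exp_pos _
  -- For large `η` the left side is negative, so the smallness assumed in the good-event estimates
  -- costs nothing.
  rcases lt_or_ge (1 / 2000) η with hη1 | hη1
  · refine le_trans ?_ measureReal_nonneg
    linarith
  have hη0 : 0 < η := by
    have := h.beta_pos
    positivity
  set c : ℝ := 1 / (t : ℝ) with hc
  set m : (Fin t → Ξ) → ℝ := fun s => ‖g + c • ∑ i, X (s i)‖ ^ 2 - ‖g‖ ^ 2 with hm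
  set z : (Fin t → Ξ) → (Fin t → Fin t) → ℝ := fun s j =>
    ‖g + c • ∑ i, X (s (j i))‖ ^ 2 - ‖g + c • ∑ i, X (s i)‖ ^ 2 with hz
  have hmm : Measurable m := (h.measurable_norm_add_mean c id).sub_const _
  have hzm : ∀ j, Measurable fun s => z s j := fun j =>
    (h.measurable_norm_add_mean c j).sub (h.measurable_norm_add_mean c id)
  set U : Ω → Fin t → Ξ := fun ω i => ξ i ω with hU
  set V : Ω → Fin B → Fin t → Fin t := fun ω b i => J b i ω with hV
  have hUm : Measurable U := measurable_pi_lambda _ fun i => hξ i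
  have hVm : Measurable V := measurable_pi_lambda _ fun b => measurable_pi_lambda _ fun i => hJ b i
  have hUV : IndepFun V U P :=
    (hξJ.comp (φ := fun (y : ℕ → Ξ) (i : Fin t) => y i) (ψ := id)
      (measurable_pi_lambda _ fun i => measurable_pi_apply _) measurable_id).symm
  set N : Set ((Fin B → Fin t → Fin t) × (Fin t → Ξ)) := {p | (1 - α) * B ≤
    ∑ b, Set.indicator {r : ℝ | r < m p.2} (fun _ => (1 : ℝ)) (z p.2 (p.1 b))} with hN
  have hNm : MeasurableSet N := by
    -- The index arrays form a finite set, so measurability need only be checked in the sample for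
    -- each fixed array.
    refine measurableSet_le measurable_const (measurable_from_prod_countable_right fun j => ?_)
    refine Finset.measurable_sum _ fun b _ => ?_
    have e : (fun s => Set.indicator {r : ℝ | r < m s} (fun _ => (1 : ℝ)) (z s (j b))) =
        Set.indicator {s | z s (j b) < m s} fun _ => (1 : ℝ) := rfl
    rw [e]
    exact measurable_const.indicator (measurableSet_lt (hzm _) hmm)
  have hcov : {ω | m (U ω) ≤ empiricalQuantile (1 - α) fun b => z (U ω) (V ω b)} =
      {ω | (V ω, U ω) ∈ N}ᶜ := by
    ext ω
    simp only [Set.mem_ofPred_eq, Set.mem_compl_iff, hN]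
    rw [← empiricalQuantile_lt_iff (by omega) (by linarith) (by linarith), not_lt]
  have hgoal : {ω | ‖g + c • ∑ i : Fin t, X (ξ i ω)‖ ^ 2 - ‖g‖ ^ 2 ≤
      empiricalQuantile (1 - α) fun b : Fin B => ‖g + c • ∑ i, X (ξ (J b i ω) ω)‖ ^ 2 -
        ‖g + c • ∑ i : Fin t, X (ξ i ω)‖ ^ 2} =
      {ω | m (U ω) ≤ empiricalQuantile (1 - α) fun b => z (U ω) (V ω b)} := rfl
  have hNpre : MeasurableSet {ω | (V ω, U ω) ∈ N} := (hVm.prodMk hUm) hNm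
  rw [hgoal, hcov, probReal_compl_eq_one_sub hNpre]
  -- the set of samples on which the bootstrap may fail
  set p' : ℝ := 1 - α - ε - 90000 * η with hp'
  set Bad : Set (Fin t → Ξ) := {s | GoodSample g β σ k fun i => X (s i)}ᶜ ∪
    {s | p' ≤ stdCDF (m s * √t / σ)} with hBad
  have hBadm : MeasurableSet Bad :=
    (h.measurableSet_goodSample t).compl.union (measurableSet_le measurable_const
      (continuous_stdCDF.measurable.comp ((hmm.mul_const _).div_const _)))
  have hblocks := iIndepFun_blocks hJ hJind
  have hcond : ∀ s, ∫ ω, N.indicator (fun _ => (1 : ℝ)) (V ω, s) ∂P ≤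
      ε + Bad.indicator (fun _ => (1 : ℝ)) s := fun s => by
    have e : ∫ ω, N.indicator (fun _ => (1 : ℝ)) (V ω, s) ∂P = P.real {ω | (V ω, s) ∈ N} :=
      integral_indicator_one ((hVm.prodMk measurable_const) hNm)
    rw [e]
    by_cases hs : s ∈ Bad
    · rw [Set.indicator_of_mem hs]
      have : P.real {ω | (V ω, s) ∈ N} ≤ 1 := measureReal_le_one
      linarith
    · rw [Set.indicator_of_notMem hs, add_zero]
      simp only [hBad, Set.mem_union, Set.mem_compl_iff, Set.mem_ofPred_eq, not_or, not_not,
        not_le] at hs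
      obtain ⟨hgood, hlt⟩ := hs
      have hq : ∀ b, P.real {ω | (fun i => J b i ω) ∈ {j | z s j < m s}} ≤
          stdCDF (m s * √t / σ) + 90000 * η := fun b =>
        hgood.bootstrap_cdf_le ht hk h.beta_pos hσ h.norm_sq_le hρ hη hη1 (hJ b)
          (hJind.precomp (g := fun i => (b, i)) fun i j hij => (Prod.mk.inj hij).2) (hJu b) (m s)
      have hcount := count_ge_le (P := P) (by omega) (fun b => measurable_pi_lambda _ (hJ b))
        hblocks (A := {j | z s j < m s}) (Set.toFinite _).measurableSet hq hε0
      refine (measureReal_mono fun ω hω => ?_).trans (hcount.trans (exp_neg_two_mul_log_le hB))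
      simp only [hN, Set.mem_ofPred_eq] at hω
      refine le_trans ?_ hω
      have hB0 : (0 : ℝ) ≤ B := by positivity
      refine mul_le_mul_of_nonneg_right ?_ hB0
      linarith
  have hBadi : Integrable (fun ω => Bad.indicator (fun _ => (1 : ℝ)) (U ω)) P :=
    (integrable_const (1 : ℝ)).indicator (hUm hBadm)
  have hPN : P.real {ω | (V ω, U ω) ∈ N} ≤ ε + P.real {ω | U ω ∈ Bad} := by
    have e1 : ∫ ω, N.indicator (fun _ => (1 : ℝ)) (V ω, U ω) ∂P = P.real {ω | (V ω, U ω) ∈ N} :=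
      integral_indicator_one hNpre
    have e2 : ∫ ω, Bad.indicator (fun _ => (1 : ℝ)) (U ω) ∂P = P.real {ω | U ω ∈ Bad} :=
      integral_indicator_one (hUm hBadm)
    have := integral_le_of_indepFun (P := P) hVm hUm hUV
      (G := N.indicator fun _ => (1 : ℝ)) (measurable_const.indicator hNm)
      ((integrable_const (1 : ℝ)).indicator hNpre)
      (b := fun s => ε + Bad.indicator (fun _ => (1 : ℝ)) s)
      ((integrable_const ε).add hBadi) hcond
    rw [e1, integral_add (integrable_const ε) hBadi, e2] at this
    simpa using this
  have hBadP : P.real {ω | U ω ∈ Bad} ≤ 3 * Real.exp (-k) + (1 - (p' - 24 * η) + 83 * η) := by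
    have h1 := h.prob_not_goodSample_le (by omega) ht hξ hind hQ
    have h2 := h.prob_le_stdCDF_le hk ht hξ hind hQ hη
      (show p' - 24 * η < 1 by linarith)
    refine le_trans (measureReal_mono (fun ω hω => ?_)) ((measureReal_union_le _ _).trans
      (add_le_add h1 h2))
    by_cases hgood : GoodSample g β σ k fun i : Fin t => X (ξ i ω)
    · right
      have hpm : p' ≤ stdCDF (m (U ω) * √t / σ) := by
        rcases hω with hω | hω
        · exact absurd hgood hω
        · exact hω
      simp only [Set.mem_ofPred_eq]
      set S := ∑ i : Fin t, 2 * inner ℝ g (X (ξ i ω)) with hS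
      set n2 := ‖∑ i : Fin t, X (ξ i ω)‖ ^ 2 with hn2
      have hst : √(t : ℝ) ^ 2 = t := Real.sq_sqrt htR.le
      have hst0 : 0 < √(t : ℝ) := by positivity
      have hmU : m (U ω) = c * S + c ^ 2 * n2 := by
        simp only [hm, hU]
        rw [norm_add_sq_real, real_inner_smul_right, inner_sum, norm_smul, mul_pow,
          Real.norm_eq_abs, sq_abs, hS, ← Finset.mul_sum]
        ring
      have harg : m (U ω) * √t / σ = S / (√t * σ) + n2 / (t * √t * σ) := by
        rw [hmU, hc]
        have ht2 : (t : ℝ) = √t * √t := by rw [← sq, hst]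
        field_simp
        rw [hst]
        ring
      have hx0 : 0 < 1 / √(t : ℝ) := by positivity
      obtain ⟨-, -, -, r4, -⟩ := rate_bounds hK hρ hx0
        (show η = (k : ℝ) ^ 2 * (1 / √t) * (β / σ) ^ 3 by rw [hη]; ring)
      -- The quadratic term, after standardization. Since `stdCDF` is `1/2`-Lipschitz, it shifts the
      -- level by at most `24η`.
      have hn : n2 / (t * √t * σ) ≤ 48 * η := by
        have := hgood.norm_sum
        calc n2 / (t * √t * σ) ≤ 24 * k * β * t / (t * √t * σ) := by gcongr
          _ = 24 * (k * (β / σ) * (1 / √t)) := by field_simp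
          _ ≤ 48 * η := by linarith
      have hmono := stdCDF_mono (show m (U ω) * √t / σ ≤ S / (√t * σ) + 48 * η by
        rw [harg]; linarith)
      have hadd := stdCDF_add_le (a := S / (√t * σ)) (show 0 ≤ 48 * η by positivity)
      linarith
    · left; exact hgood
  have hexp : Real.exp (-(k : ℝ)) ≤ Real.exp (-(k : ℝ) / 2) := by
    apply Real.exp_le_exp.2; linarith
  -- The failure probability is at most `α + 2ε + 3e^{-k}` plus `90000η + 24η + 83η`, within the
  -- constant `200000`.
  linarith

end CenteredModel

/-! ### Conditioning on independent data by freezing them. -/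

section Transfer

variable {Ω E F G : Type*} [MeasurableSpace Ω] [MeasurableSpace E] [MeasurableSpace F]
  [MeasurableSpace G] {P : Measure Ω} [IsProbabilityMeasure P]

/-- Associativity of the product measure: the two hypotheses make the joint law of the three
variables a threefold product. -/
lemma indepFun_prodMk_of_indepFun {D : Ω → E} {V : Ω → F} {W : Ω → G} (hD : Measurable D)
    (hV : Measurable V) (hW : Measurable W) (hDV : IndepFun D V P)
    (hDVW : IndepFun (fun ω => (D ω, V ω)) W P) : IndepFun D (fun ω => (V ω, W ω)) P := by
  have hVW : IndepFun V W P := hDVW.comp measurable_snd measurable_id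
  rw [indepFun_iff_map_prod_eq_prod_map_map (by fun_prop) (by fun_prop)] at hDV hDVW hVW ⊢
  have := Measure.isProbabilityMeasure_map (μ := P) hD.aemeasurable
  have := Measure.isProbabilityMeasure_map (μ := P) hV.aemeasurable
  have := Measure.isProbabilityMeasure_map (μ := P) hW.aemeasurable
  rw [hDV] at hDVW
  rw [hVW, ← Measure.prodAssoc_prod, ← hDVW,
    Measure.map_map (MeasurableEquiv.measurable _) ((hD.prodMk hV).prodMk hW)]
  rfl

lemma ae_prodMk_of_forall_ae {D : Ω → E} {W : Ω → F} (hD : Measurable D) (hW : Measurable W)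
    (hind : IndepFun D W P) {C : Set (E × F)} (hC : MeasurableSet C)
    (h : ∀ d, ∀ᵐ ω ∂P, (d, W ω) ∈ C) : ∀ᵐ ω ∂P, (D ω, W ω) ∈ C := by
  have hmap := (indepFun_iff_map_prod_eq_prod_map_map hD.aemeasurable hW.aemeasurable).1 hind
  have := Measure.isProbabilityMeasure_map (μ := P) hD.aemeasurable
  have := Measure.isProbabilityMeasure_map (μ := P) hW.aemeasurable
  refine (ae_map_iff (hD.prodMk hW).aemeasurable hC).1 ?_
  rw [hmap]
  refine (Measure.measure_prod_null hC.compl).2 (.of_forall fun d => ?_)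
  change P.map W (Prod.mk d ⁻¹' Cᶜ) = 0
  rw [Measure.map_apply hW (measurable_prodMk_left hC.compl)]
  exact h d

/-- The law of the pair is a product, so by Fubini the frozen-data probability integrates correctly
over every event determined by `D`; this characterizes the conditional expectation. -/
lemma condExp_indicator_of_indepFun {D : Ω → E} {W : Ω → F} (hD : Measurable D)
    (hW : Measurable W) (hind : IndepFun D W P) {C : Set (E × F)} (hC : MeasurableSet C) :
    P⟦{ω | (D ω, W ω) ∈ C} | MeasurableSpace.comap D inferInstance⟧ =ᵐ[P]
      fun ω => P.real {ω' | (D ω, W ω') ∈ C} := by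
  have hmap := (indepFun_iff_map_prod_eq_prod_map_map hD.aemeasurable hW.aemeasurable).1 hind
  have := Measure.isProbabilityMeasure_map (μ := P) hD.aemeasurable
  have := Measure.isProbabilityMeasure_map (μ := P) hW.aemeasurable
  have hS : MeasurableSet {ω | (D ω, W ω) ∈ C} := (hD.prodMk hW) hC
  have hGm : Measurable fun d => P.real {ω' | (d, W ω') ∈ C} := by
    have : (fun d => P.real {ω' | (d, W ω') ∈ C}) =
        fun d => ((P.map W) (Prod.mk d ⁻¹' C)).toReal := by
      funext d
      rw [Measure.map_apply hW (measurable_prodMk_left hC)]; rfl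
    rw [this]
    exact (measurable_measure_prodMk_left hC).ennreal_toReal
  have hGi : Integrable (fun ω => P.real {ω' | (D ω, W ω') ∈ C}) P :=
    Integrable.of_bound (hGm.comp hD).aestronglyMeasurable 1 (.of_forall fun ω => by
      rw [Real.norm_of_nonneg measureReal_nonneg]; exact measureReal_le_one)
  refine (ae_eq_condExp_of_forall_setIntegral_eq hD.comap_le
    ((integrable_const (1 : ℝ)).indicator hS) (fun s _ _ => hGi.integrableOn) ?_ ?_).symm
  · rintro _ ⟨A, hA, rfl⟩ -
    have hDA : MeasurableSet (D ⁻¹' A) := hD hA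
    rw [setIntegral_indicator hS, setIntegral_const, smul_eq_mul, mul_one, measureReal_def,
      integral_eq_lintegral_of_nonneg_ae (.of_forall fun _ => measureReal_nonneg)
        (hGm.comp hD).aestronglyMeasurable]
    congr 1
    have h1 : P (D ⁻¹' A ∩ {ω | (D ω, W ω) ∈ C}) = P.map (fun ω => (D ω, W ω))
        (Prod.fst ⁻¹' A ∩ C) :=
      (Measure.map_apply (hD.prodMk hW) ((measurable_fst hA).inter hC)).symm
    rw [h1, hmap, Measure.prod_apply ((measurable_fst hA).inter hC)]
    have h2 : ∀ ω, ENNReal.ofReal (P.real {ω' | (D ω, W ω') ∈ C}) =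
        P.map W (Prod.mk (D ω) ⁻¹' C) := fun ω => by
      rw [Measure.map_apply hW (measurable_prodMk_left hC), measureReal_def,
        ENNReal.ofReal_toReal (measure_ne_top _ _)]
      rfl
    simp_rw [h2]
    rw [← setLIntegral_map (f := fun d => P.map W (Prod.mk d ⁻¹' C)) hA
      (measurable_measure_prodMk_left hC) hD, ← lintegral_indicator hA]
    refine lintegral_congr fun d => ?_
    by_cases hd : d ∈ A <;> simp [hd, Set.preimage_inter, Set.preimage_preimage]
  · exact (hGm.comp (comap_measurable D)).aestronglyMeasurable

end Transfer

/-! ### The ensemble as random vectors in `L²(ν)`. -/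

section Embedding

variable {𝒳 Ξ : Type*} [MeasurableSpace 𝒳] [MeasurableSpace Ξ]

lemma measurable_vartheta {Q : Measure Ξ} [SFinite Q] {T : Ξ → 𝒳 → ℝ}
    (hT : Measurable fun p : Ξ × 𝒳 => T p.1 p.2) : Measurable (vartheta Q T) := by
  have : StronglyMeasurable fun p : 𝒳 × Ξ => T p.2 p.1 :=
    (hT.comp measurable_swap).stronglyMeasurable
  exact this.integral_prod_right'.measurable

lemma measurable_eLpNorm_two {E Z : Type*} [MeasurableSpace E] [MeasurableSpace Z] {ν : Measure Z}
    [SFinite ν] {F : E → Z → ℝ} (hF : Measurable fun p : E × Z => F p.1 p.2) :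
    Measurable fun e => eLpNorm (F e) 2 ν := by
  simp_rw [eLpNorm_eq_lintegral_rpow_enorm_toReal two_ne_zero ENNReal.ofNat_ne_top]
  refine Measurable.pow_const ?_ _
  exact Measurable.lintegral_prod_right' (f := fun p : E × Z => ‖F p.1 p.2‖ₑ ^ _)
    (hF.enorm.pow_const _)

variable (ν : Measure (𝒳 × ℝ)) (Q : Measure Ξ) (T : Ξ → 𝒳 → ℝ)

/-- The centered ensemble member `T - ϑ`, as a function on `𝒳 × ℝ`. -/
def deviation (s : Ξ) (z : 𝒳 × ℝ) : ℝ := T s z.1 - vartheta Q T z.1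

open scoped Classical in
/-- The class of `T - ϑ` in `L²(ν)`, or `0` where `T - ϑ` is not square integrable. -/
def deviationLp (s : Ξ) : Lp ℝ 2 ν :=
  if h : MemLp (deviation Q T s) 2 ν then h.toLp _ else 0

variable {ν Q T}

lemma measurable_deviation [SFinite Q] (hT : Measurable fun p : Ξ × 𝒳 => T p.1 p.2) :
    Measurable fun p : Ξ × (𝒳 × ℝ) => deviation Q T p.1 p.2 :=
  (hT.comp (measurable_fst.prodMk (measurable_fst.comp measurable_snd))).sub
    ((measurable_vartheta hT).comp (measurable_fst.comp measurable_snd))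

lemma coeFn_deviationLp {s : Ξ} (h : MemLp (deviation Q T s) 2 ν) :
    deviationLp ν Q T s =ᵐ[ν] deviation Q T s := by
  rw [deviationLp, dif_pos h]
  exact h.coeFn_toLp

lemma enorm_deviationLp {s : Ξ} (h : MemLp (deviation Q T s) 2 ν) :
    ‖deviationLp ν Q T s‖ₑ = eLpNorm (deviation Q T s) 2 ν := by
  rw [deviationLp, dif_pos h, Lp.enorm_toLp]

lemma memLp_deviation_iff [SFinite Q] (hT : Measurable fun p : Ξ × 𝒳 => T p.1 p.2) (s : Ξ) :
    MemLp (deviation Q T s) 2 ν ↔ eLpNorm (deviation Q T s) 2 ν < ∞ :=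
  ⟨fun h => h.2, fun h => ⟨((measurable_deviation hT).comp
    measurable_prodMk_left).aestronglyMeasurable, h⟩⟩

lemma measurableSet_memLp_deviation [SFinite Q] [SFinite ν]
    (hT : Measurable fun p : Ξ × 𝒳 => T p.1 p.2) :
    MeasurableSet {s | MemLp (deviation Q T s) 2 ν} := by
  simp_rw [memLp_deviation_iff hT]
  exact measurableSet_lt (measurable_eLpNorm_two (measurable_deviation hT)) measurable_const

lemma inner_eq_integral_mul (u v : Lp ℝ 2 ν) {f h : 𝒳 × ℝ → ℝ} (hu : u =ᵐ[ν] f)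
    (hv : v =ᵐ[ν] h) : inner ℝ u v = ∫ z, f z * h z ∂ν := by
  rw [L2.inner_def]
  refine integral_congr_ae ?_
  filter_upwards [hu, hv] with z h1 h2
  rw [h1, h2]
  simp [mul_comm]

lemma norm_sq_eq_integral (u : Lp ℝ 2 ν) {f : 𝒳 × ℝ → ℝ} (hu : u =ᵐ[ν] f) :
    ‖u‖ ^ 2 = ∫ z, f z ^ 2 ∂ν := by
  rw [← real_inner_self_eq_norm_sq, inner_eq_integral_mul u u hu hu]
  simp_rw [sq]

/-- On the measurable set of square-integrable deviations the inner product is an explicit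
parametric integral, and elsewhere it is zero by the choice of default. Measurability of the
vector-valued map itself is not needed. -/
lemma measurable_inner_deviationLp [SFinite Q] [SFinite ν]
    (hT : Measurable fun p : Ξ × 𝒳 => T p.1 p.2) (u : Lp ℝ 2 ν) :
    Measurable fun s => (inner ℝ u (deviationLp ν Q T s) : ℝ) := by
  classical
  have h1 : (fun s => (inner ℝ u (deviationLp ν Q T s) : ℝ)) =
      Set.indicator {s | MemLp (deviation Q T s) 2 ν}
        fun s => ∫ z, u z * deviation Q T s z ∂ν := by
    funext s
    by_cases hs : MemLp (deviation Q T s) 2 ν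
    · rw [Set.indicator_of_mem (show s ∈ {s | MemLp (deviation Q T s) 2 ν} from hs)]
      exact inner_eq_integral_mul _ _ .rfl (coeFn_deviationLp hs)
    · rw [Set.indicator_of_notMem (show s ∉ {s | MemLp (deviation Q T s) 2 ν} from hs), deviationLp, dif_neg hs,
        inner_zero_right]
  rw [h1]
  refine Measurable.indicator ?_ (measurableSet_memLp_deviation hT)
  have : StronglyMeasurable fun p : Ξ × (𝒳 × ℝ) => u p.2 * deviation Q T p.1 p.2 :=
    (((Lp.stronglyMeasurable u).measurable.comp measurable_snd).mul
      (measurable_deviation hT)).stronglyMeasurable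
  exact this.integral_prod_right'.measurable

lemma measurable_kernel_deviationLp [SFinite Q] [SFinite ν]
    (hT : Measurable fun p : Ξ × 𝒳 => T p.1 p.2) :
    Measurable fun p : Ξ × Ξ =>
      (inner ℝ (deviationLp ν Q T p.1) (deviationLp ν Q T p.2) : ℝ) := by
  classical
  have h1 : (fun p : Ξ × Ξ => (inner ℝ (deviationLp ν Q T p.1) (deviationLp ν Q T p.2) : ℝ)) =
      Set.indicator ({s | MemLp (deviation Q T s) 2 ν} ×ˢ {s | MemLp (deviation Q T s) 2 ν})
        fun p => ∫ z, deviation Q T p.1 z * deviation Q T p.2 z ∂ν := by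
    funext ⟨s, s'⟩
    by_cases hs : MemLp (deviation Q T s) 2 ν
    · by_cases hs' : MemLp (deviation Q T s') 2 ν
      · have hmem : (s, s') ∈ {s | MemLp (deviation Q T s) 2 ν} ×ˢ
            {s | MemLp (deviation Q T s) 2 ν} := ⟨hs, hs'⟩
        rw [Set.indicator_of_mem hmem]
        exact inner_eq_integral_mul _ _ (coeFn_deviationLp hs) (coeFn_deviationLp hs')
      · rw [Set.indicator_of_notMem (fun h => hs' h.2)]
        simp only [deviationLp, dif_neg hs', inner_zero_right]
    · rw [Set.indicator_of_notMem (fun h => hs h.1)]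
      simp only [deviationLp, dif_neg hs, inner_zero_left]
  rw [h1]
  refine Measurable.indicator ?_
    ((measurableSet_memLp_deviation hT).prod (measurableSet_memLp_deviation hT))
  have h2 := measurable_deviation (Q := Q) hT
  have : StronglyMeasurable fun p : (Ξ × Ξ) × (𝒳 × ℝ) =>
      deviation Q T p.1.1 p.2 * deviation Q T p.1.2 p.2 :=
    ((h2.comp ((measurable_fst.comp measurable_fst).prodMk measurable_snd)).mul
      (h2.comp ((measurable_snd.comp measurable_fst).prodMk measurable_snd))).stronglyMeasurable
  exact this.integral_prod_right'.measurable

-- True at every point without integrability: if `T` is not integrable there, neither is the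
-- deviation, whose integral is then zero by convention.
omit [MeasurableSpace 𝒳] in
lemma integral_deviation [IsProbabilityMeasure Q] (z : 𝒳 × ℝ) :
    ∫ s, deviation Q T s z ∂Q = 0 := by
  unfold deviation
  by_cases h : Integrable (fun s => T s z.1) Q
  · rw [integral_sub h (integrable_const _), integral_const]
    simp [vartheta]
  · refine integral_undef fun h' => h ?_
    have := h'.add (integrable_const (vartheta Q T z.1))
    refine this.congr (.of_forall fun s => ?_)
    simp

/-- Fubini's theorem turns pointwise centring into weak centring; Cauchy–Schwarz supplies joint
integrability. -/
lemma integral_inner_deviationLp [IsProbabilityMeasure Q] [IsProbabilityMeasure ν]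
    (hT : Measurable fun p : Ξ × 𝒳 => T p.1 p.2)
    (hgood : ∀ᵐ s ∂Q, MemLp (deviation Q T s) 2 ν)
    (hint : ∫⁻ s, eLpNorm (deviation Q T s) 2 ν ∂Q < ∞) (u : Lp ℝ 2 ν) :
    ∫ s, inner ℝ u (deviationLp ν Q T s) ∂Q = 0 := by
  have h1 : ∫ s, inner ℝ u (deviationLp ν Q T s) ∂Q =
      ∫ s, ∫ z, u z * deviation Q T s z ∂ν ∂Q := by
    refine integral_congr_ae ?_
    filter_upwards [hgood] with s hs
    exact inner_eq_integral_mul _ _ .rfl (coeFn_deviationLp hs)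
  have hdm := measurable_deviation (Q := Q) hT
  have hm : Measurable fun p : Ξ × (𝒳 × ℝ) => u p.2 * deviation Q T p.1 p.2 :=
    ((Lp.stronglyMeasurable u).measurable.comp measurable_snd).mul hdm
  have hi : Integrable (Function.uncurry fun (s : Ξ) (z : 𝒳 × ℝ) => u z * deviation Q T s z)
      (Q.prod ν) := by
    refine ⟨hm.aestronglyMeasurable, ?_⟩
    rw [hasFiniteIntegral_iff_enorm]
    refine (lintegral_prod _ hm.enorm.aemeasurable).trans_lt ?_
    calc ∫⁻ s, ∫⁻ z, ‖u z * deviation Q T s z‖ₑ ∂ν ∂Q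
        ≤ ∫⁻ s, eLpNorm u 2 ν * eLpNorm (deviation Q T s) 2 ν ∂Q := by
          refine lintegral_mono fun s => ?_
          have hds : AEMeasurable (fun z => ‖deviation Q T s z‖ₑ) ν :=
            (hdm.comp measurable_prodMk_left).enorm.aemeasurable
          have := ENNReal.lintegral_mul_le_Lp_mul_Lq ν Real.HolderConjugate.two_two
            (Lp.stronglyMeasurable u).measurable.enorm.aemeasurable hds
          rw [eLpNorm_eq_lintegral_rpow_enorm_toReal two_ne_zero ENNReal.ofNat_ne_top,
            eLpNorm_eq_lintegral_rpow_enorm_toReal two_ne_zero ENNReal.ofNat_ne_top]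
          simpa [enorm_mul] using this
      _ = eLpNorm u 2 ν * ∫⁻ s, eLpNorm (deviation Q T s) 2 ν ∂Q :=
          lintegral_const_mul _ (measurable_eLpNorm_two hdm)
      _ < ∞ := ENNReal.mul_lt_top (Lp.eLpNorm_lt_top u) hint
  rw [h1, integral_integral_swap hi]
  simp_rw [integral_const_mul, integral_deviation, mul_zero, integral_zero]

/-- The averaged deviations plus `ϑ - y` equal the averaged prediction minus `y`. This needs `t ≥
1`, because an empty average does not reproduce `ϑ`. -/
lemma psi_average_eq_norm_sq {g : Lp ℝ 2 ν}
    (hg : g =ᵐ[ν] fun z => vartheta Q T z.1 - z.2) {t : ℕ} (ht : 1 ≤ t) (s : Fin t → Ξ)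
    (hs : ∀ i, MemLp (deviation Q T (s i)) 2 ν) :
    psi ν (average fun i => T (s i)) =
      ‖g + (1 / (t : ℝ)) • ∑ i, deviationLp ν Q T (s i)‖ ^ 2 := by
  have ht0 : (t : ℝ) ≠ 0 := by positivity
  have h1 : (g + (1 / (t : ℝ)) • ∑ i, deviationLp ν Q T (s i) : Lp ℝ 2 ν) =ᵐ[ν]
      fun z => average (fun i => T (s i)) z.1 - z.2 := by
    have h2 : ∀ᵐ z ∂ν, ∀ i, deviationLp ν Q T (s i) z = deviation Q T (s i) z :=
      ae_all_iff.2 fun i => coeFn_deviationLp (hs i)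
    filter_upwards [Lp.coeFn_add g ((1 / (t : ℝ)) • ∑ i, deviationLp ν Q T (s i)),
      Lp.coeFn_smul (1 / (t : ℝ)) (∑ i, deviationLp ν Q T (s i)),
      Lp.coeFn_finsetSum Finset.univ fun i => deviationLp ν Q T (s i), h2, hg]
      with z e1 e2 e3 e4 e5
    rw [e1, Pi.add_apply, e2, Pi.smul_apply, e3, Finset.sum_apply, e5]
    simp only [e4, deviation, average, smul_eq_mul, Finset.sum_sub_distrib, Finset.sum_const,
      Finset.card_univ, Fintype.card_fin, nsmul_eq_mul]
    field_simp
    ring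
  rw [norm_sq_eq_integral _ h1, psi]
  exact integral_congr_ae (.of_forall fun z => by ring)

lemma mseInf_eq_norm_sq {g : Lp ℝ 2 ν} (hg : g =ᵐ[ν] fun z => vartheta Q T z.1 - z.2) :
    mseInf ν Q T = ‖g‖ ^ 2 := by
  rw [norm_sq_eq_integral _ hg, mseInf, psi]
  exact integral_congr_ae (.of_forall fun z => by ring)

end Embedding

/-! ### Moment bounds, convergence and coverage for fixed data. -/

section FixedDataBounds

lemma integrable_pow_of_lintegral_le {Ξ : Type*} [MeasurableSpace Ξ] {Q : Measure Ξ}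
    {f : Ξ → ℝ≥0∞} (hf : Measurable f) {Y : Ξ → ℝ} (hY : ∀ᵐ s ∂Q, Y s = (f s).toReal) {n : ℕ}
    {C : ℝ≥0∞} (hC : C < ∞) (h : ∫⁻ s, f s ^ n ∂Q ≤ C) :
    Integrable (fun s => Y s ^ n) Q ∧ ∫ s, Y s ^ n ∂Q ≤ C.toReal := by
  have hpow : (fun s => Y s ^ n) =ᵐ[Q] fun s => (f s ^ n).toReal := by
    filter_upwards [hY] with s hs
    rw [hs, ENNReal.toReal_pow]
  have hlt : ∫⁻ s, f s ^ n ∂Q < ∞ := h.trans_lt hC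
  refine ⟨(integrable_congr hpow).2
    (integrable_toReal_of_lintegral_ne_top (hf.pow_const n).aemeasurable hlt.ne), ?_⟩
  rw [integral_congr_ae hpow, integral_toReal (hf.pow_const n).aemeasurable
    (ae_lt_top (hf.pow_const n) hlt.ne)]
  exact ENNReal.toReal_mono hC.ne h

lemma integrable_pow_of_integrable_pow {Ξ : Type*} [MeasurableSpace Ξ] {Q : Measure Ξ}
    [IsFiniteMeasure Q] {Y : Ξ → ℝ} (hY : Measurable Y) (hY0 : ∀ s, 0 ≤ Y s) {j n : ℕ}
    (hj : j ≤ n) (h : Integrable (fun s => Y s ^ n) Q) : Integrable (fun s => Y s ^ j) Q := by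
  refine Integrable.mono' ((integrable_const (1 : ℝ)).add h)
    (hY.pow_const _).aestronglyMeasurable (ae_of_all _ fun s => ?_)
  rw [Real.norm_of_nonneg (pow_nonneg (hY0 s) _)]
  simp only [Pi.add_apply]
  have h0 := pow_nonneg (hY0 s) n
  rcases le_total (Y s) 1 with h1 | h1
  · have := pow_le_one₀ (n := j) (hY0 s) h1
    linarith
  · have := pow_le_pow_right₀ h1 hj
    linarith

variable {𝒳 Ξ : Type*} [MeasurableSpace 𝒳] [MeasurableSpace Ξ] {ν : Measure (𝒳 × ℝ)}
  {Q : Measure Ξ} {T : Ξ → 𝒳 → ℝ}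

lemma lintegral_residual_pow_le_beta {m : ℕ} (hm : m ≠ 0) :
    ∫⁻ s, eLpNorm (fun z : 𝒳 × ℝ => T s z.1 - z.2) 2 ν ^ (2 * m) ∂Q ≤ beta ν Q T m ^ m := by
  have h : _ ≤ beta ν Q T m := le_max_left _ _
  have := pow_le_pow_left' h m
  rwa [one_div, ENNReal.rpow_inv_natCast_pow hm] at this

lemma lintegral_deviation_pow_le_beta {m : ℕ} (hm : m ≠ 0) :
    ∫⁻ s, eLpNorm (deviation Q T s) 2 ν ^ (2 * m) ∂Q ≤ beta ν Q T m ^ m := by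
  have h : _ ≤ beta ν Q T m := le_max_right _ _
  have := pow_le_pow_left' h m
  rwa [one_div, ENNReal.rpow_inv_natCast_pow hm] at this

/-- The embedding into `L²(ν)` of an ensemble with finite moment parameter. -/
structure L2Embedding (ν : Measure (𝒳 × ℝ)) (Q : Measure Ξ) (T : Ξ → 𝒳 → ℝ) (g : Lp ℝ 2 ν)
    (m : ℕ) : Prop where
  coeFn_bias : g =ᵐ[ν] fun z => vartheta Q T z.1 - z.2
  ae_memLp : ∀ᵐ s ∂Q, MemLp (deviation Q T s) 2 ν
  measurable_norm : Measurable fun s => ‖deviationLp ν Q T s‖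
  integral_inner : ∀ u : Lp ℝ 2 ν, ∫ s, inner ℝ u (deviationLp ν Q T s) ∂Q = 0
  integrable_pow : Integrable (fun s => ‖deviationLp ν Q T s‖ ^ (2 * m)) Q
  integral_pow_le : ∫ s, ‖deviationLp ν Q T s‖ ^ (2 * m) ∂Q ≤ (beta ν Q T m).toReal ^ m
  integrable_residual_pow : Integrable (fun s => ‖g + deviationLp ν Q T s‖ ^ (2 * m)) Q
  integral_residual_pow_le :
    ∫ s, ‖g + deviationLp ν Q T s‖ ^ (2 * m) ∂Q ≤ (beta ν Q T m).toReal ^ m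

/-- Finite moments make both `T - ϑ` and `T - y` square integrable for almost every parameter. A
single such parameter suffices to show, by subtraction, that the bias `ϑ - y` is in `L²`. -/
theorem exists_l2Embedding [IsProbabilityMeasure Q] [IsProbabilityMeasure ν]
    (hT : Measurable fun p : Ξ × 𝒳 => T p.1 p.2) {m : ℕ} (hm : 1 ≤ m)
    (hβ : beta ν Q T m < ∞) : ∃ g : Lp ℝ 2 ν, L2Embedding ν Q T g m := by
  have hm0 : m ≠ 0 := by omega
  have hC : beta ν Q T m ^ m < ∞ := ENNReal.pow_lt_top hβ
  have hrm : Measurable fun p : Ξ × (𝒳 × ℝ) => T p.1 p.2.1 - p.2.2 :=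
    (hT.comp (measurable_fst.prodMk (measurable_fst.comp measurable_snd))).sub
      (measurable_snd.comp measurable_snd)
  have hdN := measurable_eLpNorm_two (ν := ν) (measurable_deviation (Q := Q) hT)
  have hrN := measurable_eLpNorm_two (ν := ν)
    (F := fun (s : Ξ) (z : 𝒳 × ℝ) => T s z.1 - z.2) hrm
  have hdI := lintegral_deviation_pow_le_beta (ν := ν) (Q := Q) (T := T) hm0
  have hrI := lintegral_residual_pow_le_beta (ν := ν) (Q := Q) (T := T) hm0
  have hd : ∀ᵐ s ∂Q, MemLp (deviation Q T s) 2 ν := by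
    filter_upwards [ae_lt_top (hdN.pow_const (2 * m)) (hdI.trans_lt hC).ne] with s hs
    rw [memLp_deviation_iff hT]
    exact (ENNReal.pow_lt_top_iff.1 hs).resolve_right (by omega)
  have hr : ∀ᵐ s ∂Q, MemLp (fun z : 𝒳 × ℝ => T s z.1 - z.2) 2 ν := by
    filter_upwards [ae_lt_top (hrN.pow_const (2 * m)) (hrI.trans_lt hC).ne] with s hs
    exact ⟨(hrm.comp measurable_prodMk_left).aestronglyMeasurable,
      (ENNReal.pow_lt_top_iff.1 hs).resolve_right (by omega)⟩
  have hg : MemLp (fun z : 𝒳 × ℝ => vartheta Q T z.1 - z.2) 2 ν := by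
    obtain ⟨s, h1, h2⟩ := (hd.and hr).exists
    refine (h2.sub h1).ae_eq (.of_forall fun z => ?_)
    simp [deviation]
  have hnm : Measurable fun s => ‖deviationLp ν Q T s‖ := by
    have : (fun s => ‖deviationLp ν Q T s‖) =
        fun s => √(inner ℝ (deviationLp ν Q T s) (deviationLp ν Q T s)) := by
      funext s; rw [real_inner_self_eq_norm_sq, Real.sqrt_sq (norm_nonneg _)]
    rw [this]
    exact ((measurable_kernel_deviationLp hT).comp (measurable_id.prodMk measurable_id)).sqrt
  have hfin : ∫⁻ s, eLpNorm (deviation Q T s) 2 ν ∂Q < ∞ := by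
    calc ∫⁻ s, eLpNorm (deviation Q T s) 2 ν ∂Q
        ≤ ∫⁻ s, (1 + eLpNorm (deviation Q T s) 2 ν ^ (2 * m)) ∂Q := by
          refine lintegral_mono fun s => ?_
          rcases le_total (eLpNorm (deviation Q T s) 2 ν) 1 with h | h
          · exact h.trans le_self_add
          · exact (le_self_pow h (by omega)).trans le_add_self
      _ = 1 + ∫⁻ s, eLpNorm (deviation Q T s) 2 ν ^ (2 * m) ∂Q := by
          rw [lintegral_add_left measurable_const]; simp
      _ < ∞ := ENNReal.add_lt_top.2 ⟨ENNReal.one_lt_top, hdI.trans_lt hC⟩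
  have e1 : ∀ᵐ s ∂Q, ‖deviationLp ν Q T s‖ = (eLpNorm (deviation Q T s) 2 ν).toReal := by
    filter_upwards [hd] with s hs
    rw [← enorm_deviationLp hs, toReal_enorm]
  have e2 : ∀ᵐ s ∂Q, ‖hg.toLp _ + deviationLp ν Q T s‖ =
      (eLpNorm (fun z : 𝒳 × ℝ => T s z.1 - z.2) 2 ν).toReal := by
    filter_upwards [hd] with s hs
    rw [Lp.norm_def]
    congr 1
    refine eLpNorm_congr_ae ?_
    filter_upwards [Lp.coeFn_add (hg.toLp _) (deviationLp ν Q T s), hg.coeFn_toLp,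
      coeFn_deviationLp hs] with z h1 h2 h3
    rw [h1, Pi.add_apply, h2, h3, deviation]
    ring
  obtain ⟨i1, b1⟩ := integrable_pow_of_lintegral_le hdN e1 hC hdI
  obtain ⟨i2, b2⟩ := integrable_pow_of_lintegral_le hrN e2 hC hrI
  rw [ENNReal.toReal_pow] at b1 b2
  exact ⟨hg.toLp _, hg.coeFn_toLp, hd, hnm, integral_inner_deviationLp hT hd hfin, i1, b1, i2, b2⟩

namespace L2Embedding

variable {g : Lp ℝ 2 ν} {m : ℕ}

lemma integrable_inner [IsProbabilityMeasure Q] [IsProbabilityMeasure ν]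
    (h : L2Embedding ν Q T g m) (hT : Measurable fun p : Ξ × 𝒳 => T p.1 p.2) (hm : 1 ≤ m) :
    Integrable (fun s => (inner ℝ g (deviationLp ν Q T s) : ℝ)) Q := by
  have h1 := integrable_pow_of_integrable_pow h.measurable_norm (fun s => norm_nonneg _)
    (show 1 ≤ 2 * m by omega) h.integrable_pow
  simp only [pow_one] at h1
  exact (h1.const_mul ‖g‖).mono' (measurable_inner_deviationLp hT g).aestronglyMeasurable
    (ae_of_all _ fun s => norm_inner_le_norm _ _)

/-- Since the deviation is centred, `‖g‖²` is at most the mean of the squared residual norm.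
Bernoulli's inequality, the tangent line to the `m`-th power, passes from the `m`-th moment of that
square to its mean, in place of Jensen. -/
lemma norm_bias_sq_le [IsProbabilityMeasure Q] [IsProbabilityMeasure ν]
    (h : L2Embedding ν Q T g m) (hT : Measurable fun p : Ξ × 𝒳 => T p.1 p.2) (hm : 1 ≤ m)
    (hβ : 0 < (beta ν Q T m).toReal) : ‖g‖ ^ 2 ≤ (beta ν Q T m).toReal := by
  set β := (beta ν Q T m).toReal with hβd
  have hmR : (0 : ℝ) < m := by exact_mod_cast hm
  have hi := h.integrable_inner hT hm
  have hpt : ∀ s, ‖g‖ ^ 2 + 2 * inner ℝ g (deviationLp ν Q T s) ≤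
      β / m * (‖g + deviationLp ν Q T s‖ ^ (2 * m) / β ^ m + (m - 1)) := fun s => by
    have h1 := norm_add_sq_real g (deviationLp ν Q T s)
    have h2 : 0 ≤ ‖g + deviationLp ν Q T s‖ ^ 2 / β := by positivity
    have h3 := one_add_mul_sub_le_pow (a := ‖g + deviationLp ν Q T s‖ ^ 2 / β) (by linarith) m
    rw [div_pow, ← pow_mul] at h3
    have h4 := sq_nonneg ‖deviationLp ν Q T s‖
    have h5 : β / m * (m * (‖g + deviationLp ν Q T s‖ ^ 2 / β)) =
        ‖g + deviationLp ν Q T s‖ ^ 2 := by field_simp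
    calc _ ≤ ‖g + deviationLp ν Q T s‖ ^ 2 := by linarith
      _ = β / m * (m * (‖g + deviationLp ν Q T s‖ ^ 2 / β)) := h5.symm
      _ ≤ _ := by
        gcongr
        linarith
  have h1 := integral_mono ((integrable_const (‖g‖ ^ 2)).add (hi.const_mul 2))
    (((h.integrable_residual_pow.div_const (β ^ m)).add
      (integrable_const ((m : ℝ) - 1))).const_mul (β / m)) hpt
  rw [integral_const_mul] at h1
  simp only [Pi.add_apply] at h1
  rw [integral_add (integrable_const _) (hi.const_mul 2), integral_const_mul, h.integral_inner,
    integral_add (h.integrable_residual_pow.div_const _) (integrable_const _), integral_div] at h1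
  simp only [integral_const, probReal_univ, one_smul, mul_zero, add_zero] at h1
  have h2 : (∫ s, ‖g + deviationLp ν Q T s‖ ^ (2 * m) ∂Q) / β ^ m ≤ 1 :=
    (div_le_one (by positivity)).2 h.integral_residual_pow_le
  calc ‖g‖ ^ 2 ≤ _ := h1
    _ ≤ β / m * (1 + (m - 1)) := by gcongr
    _ = β := by field_simp; ring

lemma zeta_ae_eq (h : L2Embedding ν Q T g m) :
    zeta ν Q T =ᵐ[Q] fun s => 2 * inner ℝ g (deviationLp ν Q T s) := by
  filter_upwards [h.ae_memLp] with s hs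
  rw [inner_eq_integral_mul _ _ h.coeFn_bias (coeFn_deviationLp hs)]
  rfl

lemma integral_zeta_sq [IsProbabilityMeasure Q] [IsProbabilityMeasure ν]
    (h : L2Embedding ν Q T g m) (hT : Measurable fun p : Ξ × 𝒳 => T p.1 p.2) :
    ∫ s, (2 * inner ℝ g (deviationLp ν Q T s)) ^ 2 ∂Q = sigma ν Q T ^ 2 := by
  rw [sigma, Real.sq_sqrt (variance_nonneg _ _), variance_congr h.zeta_ae_eq,
    variance_of_integral_eq_zero]
  · exact ((measurable_inner_deviationLp hT g).const_mul 2).aemeasurable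
  · rw [integral_const_mul, h.integral_inner, mul_zero]

/-- If `β` vanished, the deviation would vanish almost surely and so would `σ`. The moment of order
`6k` bounds the one of order `4k` used by the model through a tangent inequality. -/
lemma centeredModel [IsProbabilityMeasure Q] [IsProbabilityMeasure ν] {k : ℕ}
    (h : L2Embedding ν Q T g (3 * k)) (hT : Measurable fun p : Ξ × 𝒳 => T p.1 p.2) (hk : 1 ≤ k)
    (hσ : 0 < sigma ν Q T) :
    CenteredModel Q (deviationLp ν Q T) g (beta ν Q T (3 * k)).toReal (sigma ν Q T) k := by
  set β := (beta ν Q T (3 * k)).toReal with hβd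
  have hβ : 0 < β := by
    by_contra hcon
    have hβ0 : β = 0 := le_antisymm (not_lt.1 hcon) ENNReal.toReal_nonneg
    have h1 := h.integral_pow_le
    rw [← hβd, hβ0, zero_pow (by omega)] at h1
    have h2 := (integral_eq_zero_iff_of_nonneg (fun s => by positivity) h.integrable_pow).1
      (le_antisymm h1 (integral_nonneg fun s => by positivity))
    have h3 := h.integral_zeta_sq hT
    rw [integral_congr_ae (g := fun _ => (0 : ℝ)), integral_zero] at h3
    · have := pow_pos hσ 2
      linarith
    · filter_upwards [h2] with s hs
      have : deviationLp ν Q T s = 0 := norm_eq_zero.1 (pow_eq_zero_iff (by omega) |>.1 hs)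
      simp [this]
  have hi4 : Integrable (fun s => ‖deviationLp ν Q T s‖ ^ (4 * k)) Q :=
    integrable_pow_of_integrable_pow h.measurable_norm (fun s => norm_nonneg _)
      (show 4 * k ≤ 2 * (3 * k) by omega) h.integrable_pow
  refine ⟨measurable_kernel_deviationLp hT, measurable_inner_deviationLp hT g,
    fun s => h.integral_inner _, h.integral_inner _, hβ, h.norm_bias_sq_le hT (by omega) hβ,
    hi4, ?_, hσ, h.integral_zeta_sq hT⟩
  have hpt : ∀ s, ‖deviationLp ν Q T s‖ ^ (4 * k) ≤
      β ^ (2 * k) / 3 * (2 * (‖deviationLp ν Q T s‖ ^ (2 * (3 * k)) / β ^ (3 * k)) + 1) :=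
    fun s => by
    set u := ‖deviationLp ν Q T s‖ ^ (2 * k) / β ^ k with hu
    have hu0 : 0 ≤ u := by positivity
    have e3 : ‖deviationLp ν Q T s‖ ^ (2 * (3 * k)) / β ^ (3 * k) = u ^ 3 := by
      rw [hu, div_pow, ← pow_mul, ← pow_mul]; congr 2 <;> ring
    have e2 : ‖deviationLp ν Q T s‖ ^ (4 * k) = β ^ (2 * k) * u ^ 2 := by
      rw [hu, div_pow, ← pow_mul, ← pow_mul, mul_comm k 2, mul_div_cancel₀ _ (by positivity)]
      congr 1; ring
    rw [e3, e2]
    -- This product expands to `2u³ - 3u² + 1`, so `u² ≤ (2u³ + 1)/3`, with equality at `u = 1`.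
    have : 0 ≤ (u - 1) ^ 2 * (2 * u + 1) := by positivity
    have h2 : u ^ 2 ≤ (2 * u ^ 3 + 1) / 3 := by linarith
    calc β ^ (2 * k) * u ^ 2 ≤ β ^ (2 * k) * ((2 * u ^ 3 + 1) / 3) := by gcongr
      _ = _ := by ring
  have h1 := integral_mono hi4 ((((h.integrable_pow.div_const (β ^ (3 * k))).const_mul 2).add
    (integrable_const (1 : ℝ))).const_mul (β ^ (2 * k) / 3)) hpt
  rw [integral_const_mul] at h1
  simp only [Pi.add_apply] at h1
  rw [integral_add ((h.integrable_pow.div_const _).const_mul 2) (integrable_const _),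
    integral_const_mul, integral_div] at h1
  simp only [integral_const, probReal_univ, one_smul] at h1
  have h2 : (∫ s, ‖deviationLp ν Q T s‖ ^ (2 * (3 * k)) ∂Q) / β ^ (3 * k) ≤ 1 :=
    (div_le_one (by positivity)).2 h.integral_pow_le
  calc _ ≤ _ := h1
    _ ≤ β ^ (2 * k) / 3 * (2 * 1 + 1) := by gcongr
    _ = β ^ (2 * k) := by ring

end L2Embedding

/-- Summable means make the sum of the functions almost surely finite, so its terms tend to zero. -/
lemma ae_tendsto_zero_of_summable_integral {Ω : Type*} [MeasurableSpace Ω] {P : Measure Ω}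
    {f : ℕ → Ω → ℝ} (hf0 : ∀ n ω, 0 ≤ f n ω) (hf : ∀ n, Integrable (f n) P) {c : ℕ → ℝ}
    (hc : Summable c) (hfc : ∀ n, ∫ ω, f n ω ∂P ≤ c n) :
    ∀ᵐ ω ∂P, Tendsto (fun n => f n ω) atTop (𝓝 0) := by
  have h1 : ∫⁻ ω, ∑' n, ENNReal.ofReal (f n ω) ∂P ≠ ∞ := by
    rw [lintegral_tsum fun n => (hf n).1.aemeasurable.ennreal_ofReal]
    have hs : Summable fun n => ∫ ω, f n ω ∂P :=
      Summable.of_nonneg_of_le (fun n => integral_nonneg (hf0 n)) hfc hc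
    have e : ∀ n, ∫⁻ ω, ENNReal.ofReal (f n ω) ∂P = ENNReal.ofReal (∫ ω, f n ω ∂P) := fun n =>
      (ofReal_integral_eq_lintegral_ofReal (hf n) (ae_of_all _ (hf0 n))).symm
    simp_rw [e]
    exact hs.tsum_ofReal_ne_top
  have h2 := ae_lt_top' (AEMeasurable.tsum fun n => (hf n).1.aemeasurable.ennreal_ofReal) h1
  filter_upwards [h2] with ω hω
  have h3 := (ENNReal.tendsto_toReal ENNReal.zero_ne_top).comp
    (ENNReal.tendsto_atTop_zero_of_tsum_ne_top hω.ne)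
  refine h3.congr fun n => ?_
  simp [ENNReal.toReal_ofReal (hf0 n ω)]

variable {Ω : Type*} [MeasurableSpace Ω] {P : Measure Ω}

lemma ae_forall_memLp_deviation {g : Lp ℝ 2 ν} {m : ℕ} (h : L2Embedding ν Q T g m)
    {ξ : ℕ → Ω → Ξ} (hξ : ∀ i, Measurable (ξ i)) (hQ : ∀ i, P.map (ξ i) = Q) :
    ∀ᵐ ω ∂P, ∀ i, MemLp (deviation Q T (ξ i ω)) 2 ν :=
  ae_all_iff.2 fun i => ae_of_ae_map (hξ i).aemeasurable (by rw [hQ i]; exact h.ae_memLp)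

variable [IsProbabilityMeasure P]

/-- The mean-squared error of the average converges to that of `ϑ`, for fixed data. -/
theorem ae_tendsto_psi_average [IsProbabilityMeasure Q] [IsProbabilityMeasure ν]
    (hT : Measurable fun p : Ξ × 𝒳 => T p.1 p.2) {m : ℕ} (hm : 2 ≤ m)
    (hβ : beta ν Q T m < ∞) {ξ : ℕ → Ω → Ξ} (hξ : ∀ i, Measurable (ξ i)) (hind : iIndepFun ξ P)
    (hQ : ∀ i, P.map (ξ i) = Q) :
    ∀ᵐ ω ∂P, Tendsto (fun t => psi ν (average fun i : Fin t => T (ξ i ω))) atTop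
      (𝓝 (mseInf ν Q T)) := by
  obtain ⟨g, h⟩ := exists_l2Embedding hT (by omega) hβ
  have hi := integrable_pow_of_integrable_pow h.measurable_norm (fun s => norm_nonneg _)
    (show 2 * 2 ≤ 2 * m by omega) h.integrable_pow
  have hmom := moment_sum_le (measurable_kernel_deviationLp hT) (fun s => h.integral_inner _)
    one_le_two hi hξ hind hQ
  set M := ∫ s, ‖deviationLp ν Q T s‖ ^ (2 * 2) ∂Q with hM
  -- Fourth moments suffice: the mean of `‖X̄‖⁴` is at most `(16n)² M / n⁴ = 256 M / n²`, which is
  -- summable. At `n = 0` both sides vanish by the convention for division by zero.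
  have h0 := ae_tendsto_zero_of_summable_integral (P := P)
    (f := fun n ω => (1 / (n : ℝ)) ^ 4 *
      ‖∑ i ∈ Finset.range n, deviationLp ν Q T (ξ i ω)‖ ^ (2 * 2))
    (c := fun n => 256 * M * (1 / (n : ℝ) ^ 2)) (fun n ω => by positivity)
    (fun n => (hmom n).1.const_mul _)
    ((Real.summable_one_div_nat_pow.2 one_lt_two).mul_left _) (fun n => by
      rw [integral_const_mul]
      calc _ ≤ (1 / (n : ℝ)) ^ 4 * ((8 * (2 : ℕ) * n) ^ 2 * M) := by
            gcongr; exact (hmom n).2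
        _ = _ := by
            rcases Nat.eq_zero_or_pos n with rfl | hn
            · simp
            · have : (n : ℝ) ≠ 0 := by positivity
              push_cast
              field_simp
              ring)
  filter_upwards [h0, ae_forall_memLp_deviation h hξ hQ] with ω hω hgood
  have h1 : Tendsto (fun n : ℕ => (1 / (n : ℝ)) •
      ∑ i ∈ Finset.range n, deviationLp ν Q T (ξ i ω)) atTop (𝓝 0) := by
    rw [tendsto_zero_iff_norm_tendsto_zero]
    have h2 := (hω.sqrt).sqrt
    rw [Real.sqrt_zero, Real.sqrt_zero] at h2
    refine h2.congr fun n => ?_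
    rw [norm_smul, Real.norm_of_nonneg (by positivity),
      show (1 / (n : ℝ)) ^ 4 * ‖∑ i ∈ Finset.range n, deviationLp ν Q T (ξ i ω)‖ ^ (2 * 2) =
        ((1 / (n : ℝ) * ‖∑ i ∈ Finset.range n, deviationLp ν Q T (ξ i ω)‖) ^ 2) ^ 2 by ring,
      Real.sqrt_sq (by positivity), Real.sqrt_sq (by positivity)]
  have h2 : Tendsto (fun n : ℕ => ‖g + (1 / (n : ℝ)) •
      ∑ i ∈ Finset.range n, deviationLp ν Q T (ξ i ω)‖ ^ 2) atTop (𝓝 (mseInf ν Q T)) := by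
    have := ((tendsto_const_nhds (x := g)).add h1).norm.pow 2
    rwa [add_zero, ← mseInf_eq_norm_sq h.coeFn_bias] at this
  refine h2.congr' ?_
  filter_upwards [eventually_ge_atTop 1] with n hn
  rw [psi_average_eq_norm_sq h.coeFn_bias hn _ fun i => hgood i,
    Finset.sum_range fun i => deviationLp ν Q T (ξ i ω)]

lemma delta_eq_ofReal {t k B : ℕ} (hβ : beta ν Q T (3 * k) < ∞) (hσ : 0 < sigma ν Q T) :
    delta ν Q T t k B = ENNReal.ofReal ((k : ℝ) ^ 2 / √t *
      ((beta ν Q T (3 * k)).toReal / sigma ν Q T) ^ 3 + Real.exp (-(k : ℝ) / 2) +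
        √(Real.log B / B)) := by
  have h1 : 0 ≤ (beta ν Q T (3 * k)).toReal / sigma ν Q T := by positivity
  rw [delta, if_neg hσ.ne', ENNReal.ofReal_add (by positivity) (by positivity),
    ENNReal.ofReal_add (by positivity) (by positivity), ENNReal.ofReal_mul (by positivity),
    ENNReal.ofReal_pow h1, ENNReal.ofReal_div_of_pos hσ, ENNReal.ofReal_toReal hβ.ne]

/-- Positivity of `t` and `k` matters because `0 * ∞ = 0` in `ℝ≥0∞`. -/
lemma delta_eq_top {t k B : ℕ} (ht : 1 ≤ t) (hk : 1 ≤ k) (hσ : sigma ν Q T = 0) :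
    delta ν Q T t k B = ∞ := by
  have : ENNReal.ofReal ((k : ℝ) ^ 2 / √t) ≠ 0 := by
    have : 0 < (k : ℝ) ^ 2 / √t := by positivity
    simpa using this
  rw [delta, if_pos hσ, ENNReal.top_pow (by norm_num), ENNReal.mul_top this]
  simp

/-- Coverage of the bootstrap quantile of the mean-squared error, for fixed data. -/
theorem coverage_of_beta_lt_top [IsProbabilityMeasure Q] [IsProbabilityMeasure ν]
    (hT : Measurable fun p : Ξ × 𝒳 => T p.1 p.2) {t k B : ℕ} (ht : 1 ≤ t) (hk : 2 ≤ k)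
    (hB : 2 ≤ B) (hβ : beta ν Q T (3 * k) < ∞) {α : ℝ} (hα0 : 0 < α) (hα1 : α < 1)
    {ξ : ℕ → Ω → Ξ} (hξ : ∀ i, Measurable (ξ i)) (hind : iIndepFun ξ P)
    (hQ : ∀ i, P.map (ξ i) = Q) {J : Fin B → Fin t → Ω → Fin t} (hJ : ∀ b i, Measurable (J b i))
    (hJind : iIndepFun (fun p : Fin B × Fin t => J p.1 p.2) P)
    (hJu : ∀ b i j, P {ω | J b i ω = j} = (t : ℝ≥0∞)⁻¹)
    (hξJ : IndepFun (fun ω i => ξ i ω) (fun ω b i => J b i ω) P) :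
    ((1 - α : ℝ) : EReal) - ((200000 : ℝ) : EReal) * (delta ν Q T t k B : EReal) ≤
      ((P.real {ω | psi ν (average fun i : Fin t => T (ξ i ω)) - mseInf ν Q T ≤
        empiricalQuantile (1 - α) fun b : Fin B =>
          bootSample ν (fun i : Fin t => T (ξ i ω)) (fun i => J b i ω)} : ℝ) : EReal) := by
  -- For `σ = 0` the lower bound is `⊥` in `EReal`; otherwise all quantities are real and the
  -- fixed-data theorem applies.
  rcases (show 0 ≤ sigma ν Q T from Real.sqrt_nonneg _).eq_or_lt with hσ | hσ
  · rw [delta_eq_top ht (by omega) hσ.symm, EReal.coe_ennreal_top,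
      EReal.coe_mul_top_of_pos (by norm_num), EReal.sub_top]
    exact bot_le
  obtain ⟨g, h⟩ := exists_l2Embedding hT (by omega) hβ
  have hcov := (h.centeredModel hT (by omega) hσ).coverage hk ht hB hα0 hα1 hξ hind hQ hJ hJind
    hJu hξJ
  rw [delta_eq_ofReal hβ hσ, EReal.coe_ennreal_ofReal, max_eq_left (by positivity),
    ← EReal.coe_mul, ← EReal.coe_sub, EReal.coe_le_coe_iff]
  refine hcov.trans_eq (measureReal_congr ?_)
  filter_upwards [ae_forall_memLp_deviation h hξ hQ] with ω hgood
  refine propext ?_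
  change (_ ≤ empiricalQuantile _ _) ↔ (_ ≤ empiricalQuantile _ _)
  simp only [bootSample]
  rw [mseInf_eq_norm_sq h.coeFn_bias, psi_average_eq_norm_sq h.coeFn_bias ht _ fun i => hgood i]
  have : ∀ b, psi ν (average fun i => T (ξ (J b i ω) ω)) = _ := fun b =>
    psi_average_eq_norm_sq h.coeFn_bias ht (fun i => ξ (J b i ω) ω) fun i => hgood (J b i ω)
  simp only [this]

end FixedDataBounds

/-! ### Joint measurability in the data and the randomization. -/

section Parameters

variable {E 𝒳 Ξ : Type*} [MeasurableSpace E] [MeasurableSpace 𝒳] [MeasurableSpace Ξ]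
  {ν : Measure (𝒳 × ℝ)} {Q : Measure Ξ} {T : E → Ξ → 𝒳 → ℝ}

lemma measurable_vartheta_param [SFinite Q]
    (hT : Measurable fun p : (E × Ξ) × 𝒳 => T p.1.1 p.1.2 p.2) :
    Measurable fun p : E × 𝒳 => vartheta Q (T p.1) p.2 := by
  have : StronglyMeasurable fun p : (E × 𝒳) × Ξ => T p.1.1 p.2 p.1.2 :=
    (hT.comp (((measurable_fst.comp measurable_fst).prodMk measurable_snd).prodMk
      (measurable_snd.comp measurable_fst))).stronglyMeasurable
  exact this.integral_prod_right'.measurable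

lemma measurable_psi [SFinite ν] {F : E → 𝒳 → ℝ} (hF : Measurable fun p : E × 𝒳 => F p.1 p.2) :
    Measurable fun e => psi ν (F e) := by
  have : StronglyMeasurable fun p : E × (𝒳 × ℝ) => (p.2.2 - F p.1 p.2.1) ^ 2 :=
    (((measurable_snd.comp measurable_snd).sub
      (hF.comp (measurable_fst.prodMk (measurable_fst.comp measurable_snd)))).pow_const
        2).stronglyMeasurable
  exact this.integral_prod_right'.measurable

lemma measurable_beta [SFinite ν] [SFinite Q]
    (hT : Measurable fun p : (E × Ξ) × 𝒳 => T p.1.1 p.1.2 p.2) (k : ℕ) :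
    Measurable fun e => beta ν Q (T e) k := by
  have h1 : Measurable fun p : (E × Ξ) × (𝒳 × ℝ) => T p.1.1 p.1.2 p.2.1 :=
    hT.comp (measurable_fst.prodMk (measurable_fst.comp measurable_snd))
  have h2 : Measurable fun p : (E × Ξ) × (𝒳 × ℝ) => vartheta Q (T p.1.1) p.2.1 :=
    (measurable_vartheta_param hT).comp
      ((measurable_fst.comp measurable_fst).prodMk (measurable_fst.comp measurable_snd))
  have aux : ∀ F : E × Ξ → 𝒳 × ℝ → ℝ, (Measurable fun p : (E × Ξ) × (𝒳 × ℝ) => F p.1 p.2) →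
      Measurable fun e => (∫⁻ s, eLpNorm (F (e, s)) 2 ν ^ (2 * k) ∂Q) ^ (1 / (k : ℝ)) :=
    fun F hF => (Measurable.lintegral_prod_right'
      ((measurable_eLpNorm_two hF).pow_const (2 * k))).pow_const _
  exact (aux (fun p z => T p.1 p.2 z.1 - z.2)
    (h1.sub (measurable_snd.comp measurable_snd))).max
      (aux (fun p z => T p.1 p.2 z.1 - vartheta Q (T p.1) z.1) (h1.sub h2))

lemma measurable_psi_average [SFinite ν]
    (hT : Measurable fun p : (E × Ξ) × 𝒳 => T p.1.1 p.1.2 p.2) {F : Type*} [MeasurableSpace F]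
    {t : ℕ} {s : F → Fin t → Ξ} (hs : ∀ i, Measurable fun w => s w i) :
    Measurable fun p : E × F => psi ν (average fun i => T p.1 (s p.2 i)) := by
  refine measurable_psi (F := fun (p : E × F) => average fun i => T p.1 (s p.2 i)) ?_
  refine (Finset.measurable_sum _ fun i _ => ?_).const_mul _
  exact hT.comp (((measurable_fst.comp measurable_fst).prodMk
    ((hs i).comp (measurable_snd.comp measurable_fst))).prodMk measurable_snd)

lemma measurable_bootSample [SFinite ν]
    (hT : Measurable fun p : (E × Ξ) × 𝒳 => T p.1.1 p.1.2 p.2) {F : Type*} [MeasurableSpace F]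
    {t : ℕ} {s : F → Fin t → Ξ} (hs : ∀ i, Measurable fun w => s w i)
    {j : F → Fin t → Fin t} (hj : ∀ i, Measurable fun w => j w i) :
    Measurable fun p : E × F => bootSample ν (fun i => T p.1 (s p.2 i)) (j p.2) := by
  have h1 : Measurable fun q : (Fin t → Ξ) × Fin t => q.1 q.2 :=
    measurable_from_prod_countable_left fun j => measurable_pi_apply _
  have h2 : ∀ i, Measurable fun w => s w (j w i) := fun i =>
    h1.comp ((measurable_pi_lambda _ hs).prodMk (hj i))
  exact (measurable_psi_average hT (s := fun w i => s w (j w i)) h2).sub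
    (measurable_psi_average hT hs)

variable {t B : ℕ}

lemma measurable_psi_average_seq [SFinite ν]
    (hT : Measurable fun p : (E × Ξ) × 𝒳 => T p.1.1 p.1.2 p.2) {G : Type*} [MeasurableSpace G]
    (m : ℕ) : Measurable fun p : E × ((ℕ → Ξ) × G) =>
      psi ν (average fun i : Fin m => T p.1 (p.2.1 i)) := by
  have hs : ∀ i : Fin m, Measurable fun w : (ℕ → Ξ) × G => w.1 i := fun i => by
    fun_prop
  have := measurable_psi_average (ν := ν) hT (s := fun (w : (ℕ → Ξ) × G) (i : Fin m) => w.1 i) hs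
  exact this

/-- The quantile is an infimum over a continuum, but by `empiricalQuantile_lt_iff` failure of
coverage is a condition on a finite count of measurable events. -/
lemma measurableSet_coverage [SFinite ν] [SFinite Q]
    (hT : Measurable fun p : (E × Ξ) × 𝒳 => T p.1.1 p.1.2 p.2) (hB : 1 ≤ B) {q : ℝ}
    (hq0 : 0 < q) (hq1 : q < 1) :
    MeasurableSet {p : E × ((ℕ → Ξ) × (Fin B → Fin t → Fin t)) |
      psi ν (average fun i : Fin t => T p.1 (p.2.1 i)) - mseInf ν Q (T p.1) ≤
        empiricalQuantile q fun b =>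
          bootSample ν (fun i : Fin t => T p.1 (p.2.1 i)) (p.2.2 b)} := by
  have hinf : Measurable fun d => mseInf ν Q (T d) :=
    measurable_psi (F := fun d => vartheta Q (T d)) (measurable_vartheta_param hT)
  have hm := (measurable_psi_average_seq (ν := ν) (G := Fin B → Fin t → Fin t) hT t).sub
    (hinf.comp measurable_fst)
  have hs : ∀ i : Fin t, Measurable fun w : (ℕ → Ξ) × (Fin B → Fin t → Fin t) => w.1 i :=
    fun i => by fun_prop
  have hj : ∀ b i, Measurable fun w : (ℕ → Ξ) × (Fin B → Fin t → Fin t) => w.2 b i :=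
    fun b i => by fun_prop
  have hboot : ∀ b, Measurable fun p : E × ((ℕ → Ξ) × (Fin B → Fin t → Fin t)) =>
      bootSample ν (fun i : Fin t => T p.1 (p.2.1 i)) (p.2.2 b) := fun b => by
    have := measurable_bootSample (ν := ν) hT
      (s := fun (w : (ℕ → Ξ) × (Fin B → Fin t → Fin t)) (i : Fin t) => w.1 i)
      (j := fun w => w.2 b) hs (hj b)
    exact this
  rw [← MeasurableSet.compl_iff]
  have h1 : MeasurableSet {p : E × ((ℕ → Ξ) × (Fin B → Fin t → Fin t)) |
      q * B ≤ ∑ b, Set.indicator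
        {r : ℝ | r < psi ν (average fun i : Fin t => T p.1 (p.2.1 i)) - mseInf ν Q (T p.1)}
          (fun _ => (1 : ℝ)) (bootSample ν (fun i : Fin t => T p.1 (p.2.1 i)) (p.2.2 b))} := by
    refine measurableSet_le measurable_const (Finset.measurable_sum _ fun b _ => ?_)
    exact (measurable_const (a := (1 : ℝ))).indicator (measurableSet_lt (hboot b) hm)
  convert h1 using 1
  ext p
  rw [Set.mem_compl_iff, Set.mem_ofPred_eq, Set.mem_ofPred_eq, not_le,
    empiricalQuantile_lt_iff hB hq0 hq1]

lemma measurableSet_tendsto_psi_average [SFinite ν] [SFinite Q]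
    (hT : Measurable fun p : (E × Ξ) × 𝒳 => T p.1.1 p.1.2 p.2) {G : Type*} [MeasurableSpace G]
    (k : ℕ) : MeasurableSet {p : E × ((ℕ → Ξ) × G) | beta ν Q (T p.1) k < ∞ →
      Tendsto (fun m => psi ν (average fun i : Fin m => T p.1 (p.2.1 i))) atTop
        (𝓝 (mseInf ν Q (T p.1)))} := by
  have hinf : Measurable fun d => mseInf ν Q (T d) :=
    measurable_psi (F := fun d => vartheta Q (T d)) (measurable_vartheta_param hT)
  have h1 : MeasurableSet {p : E × ((ℕ → Ξ) × G) | beta ν Q (T p.1) k < ∞} :=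
    measurableSet_lt ((measurable_beta hT _).comp measurable_fst) measurable_const
  have h2 := measurableSet_tendsto_fun (l := atTop)
    (measurable_psi_average_seq (ν := ν) (G := G) hT) (hinf.comp measurable_fst)
  exact h1.imp h2

end Parameters

end RandomizedEnsemble

end

/-- `D` is the training set, `ξ 0, ξ 1, …` are the randomizing parameters (the ensemble of size `t`
uses the first `t` of them), and `J b` holds the indices drawn with replacement for the `b`-th
bootstrap sample. -/
theorem theorem1 :
    ∃ c₀ : ℝ, 0 < c₀ ∧
      ∀ {Ω 𝒳 Ξ : Type*} [MeasurableSpace Ω] [MeasurableSpace 𝒳] [MeasurableSpace Ξ]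
        (P : Measure Ω) [IsProbabilityMeasure P]
        (ν : Measure (𝒳 × ℝ)) [IsProbabilityMeasure ν]
        (Q : Measure Ξ) [IsProbabilityMeasure Q]
        (n t k B : ℕ) (_ : 1 ≤ t) (_ : 2 ≤ k) (_ : 2 ≤ B)
        (α : ℝ) (_ : 0 < α) (_ : α < 1)
        (φ : 𝒳 → RandomizedEnsemble.Dataset 𝒳 n → Ξ → ℝ)
        (_ : Measurable fun p : 𝒳 × RandomizedEnsemble.Dataset 𝒳 n × Ξ => φ p.1 p.2.1 p.2.2)
        (D : Ω → RandomizedEnsemble.Dataset 𝒳 n) (_ : Measurable D)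
        (ξ : ℕ → Ω → Ξ) (_ : ∀ i, Measurable (ξ i))
        (_ : iIndepFun ξ P) (_ : ∀ i, P.map (ξ i) = Q)
        (_ : IndepFun D (fun ω i => ξ i ω) P)
        (J : Fin B → Fin t → Ω → Fin t) (_ : ∀ b i, Measurable (J b i))
        (_ : iIndepFun (fun p : Fin B × Fin t => J p.1 p.2) P)
        (_ : ∀ b i j, P {ω | J b i ω = j} = (t : ℝ≥0∞)⁻¹)
        (_ : IndepFun (fun ω => (D ω, fun i => ξ i ω)) (fun ω b i => J b i ω) P),
        let T : Ω → ℕ → 𝒳 → ℝ := fun ω i x => φ x (D ω) (ξ i ω)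
        let mse : ℕ → Ω → ℝ := fun m ω =>
          RandomizedEnsemble.psi ν (RandomizedEnsemble.average fun i : Fin m => T ω i)
        let mse_inf : Ω → ℝ := fun ω =>
          RandomizedEnsemble.mseInf ν Q (fun s x => φ x (D ω) s)
        let q_hat : Ω → ℝ := fun ω =>
          RandomizedEnsemble.empiricalQuantile (1 - α) fun b : Fin B =>
            RandomizedEnsemble.bootSample ν (fun i : Fin t => T ω i) (fun i => J b i ω)
        let covered : Set Ω := {ω | mse t ω - mse_inf ω ≤ q_hat ω}
        ∀ᵐ ω ∂P, RandomizedEnsemble.beta ν Q (fun s x => φ x (D ω) s) (3 * k) < ∞ →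
          Tendsto (fun m => mse m ω) atTop (𝓝 (mse_inf ω)) ∧
          ((1 - α : ℝ) : EReal)
              - (c₀ : EReal) *
                (RandomizedEnsemble.delta ν Q (fun s x => φ x (D ω) s) t k B : EReal)
            ≤ (((P⟦covered | MeasurableSpace.comap D inferInstance⟧) ω : ℝ) : EReal) := by
  open RandomizedEnsemble in
  refine ⟨200000, by norm_num, ?_⟩
  intro Ω 𝒳 Ξ _ _ _ P _ ν _ Q _ n t k B ht hk hB α hα0 hα1 φ hφ D hD ξ hξ hind hQ hDξ J hJ hJind
    hJu hDξJ T mse mse_inf q_hat covered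
  set Φ : Dataset 𝒳 n → Ξ → 𝒳 → ℝ := fun d s x => φ x d s
  have hΦm : Measurable fun p : (Dataset 𝒳 n × Ξ) × 𝒳 => Φ p.1.1 p.1.2 p.2 :=
    hφ.comp (measurable_snd.prodMk measurable_fst)
  have hΦd : ∀ d, Measurable fun p : Ξ × 𝒳 => Φ d p.1 p.2 := fun d =>
    hΦm.comp ((measurable_const.prodMk measurable_fst).prodMk measurable_snd)
  set W : Ω → (ℕ → Ξ) × (Fin B → Fin t → Fin t) := fun ω =>
    (fun i => ξ i ω, fun b i => J b i ω)
  have hξm : Measurable fun ω i => ξ i ω := measurable_pi_lambda _ hξ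
  have hJm : Measurable fun ω b i => J b i ω :=
    measurable_pi_lambda _ fun b => measurable_pi_lambda _ fun i => hJ b i
  have hWm : Measurable W := hξm.prodMk hJm
  have hξJ : IndepFun (fun ω i => ξ i ω) (fun ω b i => J b i ω) P :=
    hDξJ.comp measurable_snd measurable_id
  -- The data are independent of the parameters and the resampling indices taken together, so both
  -- can be integrated out with the data frozen.
  have hDW : IndepFun D W P := indepFun_prodMk_of_indepFun hD hξm hJm hDξ hDξJ
  have hconv : ∀ᵐ ω ∂P, beta ν Q (Φ (D ω)) (3 * k) < ∞ →
      Tendsto (fun m => mse m ω) atTop (𝓝 (mse_inf ω)) := by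
    refine ae_prodMk_of_forall_ae hD hWm hDW
      (C := {p | beta ν Q (Φ p.1) (3 * k) < ∞ →
        Tendsto (fun m => psi ν (average fun i : Fin m => Φ p.1 (p.2.1 i))) atTop
          (𝓝 (mseInf ν Q (Φ p.1)))}) ?_ fun d => ?_
    · exact measurableSet_tendsto_psi_average hΦm (3 * k)
    · by_cases hβ : beta ν Q (Φ d) (3 * k) < ∞
      · filter_upwards [ae_tendsto_psi_average (hΦd d) (by omega) hβ hξ hind hQ] with ω hω _
        exact hω
      · exact .of_forall fun ω h => absurd h hβ
  set C : Set (Dataset 𝒳 n × ((ℕ → Ξ) × (Fin B → Fin t → Fin t))) :=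
    {p | psi ν (average fun i : Fin t => Φ p.1 (p.2.1 i)) - mseInf ν Q (Φ p.1) ≤
      empiricalQuantile (1 - α) fun b =>
        bootSample ν (fun i : Fin t => Φ p.1 (p.2.1 i)) (p.2.2 b)} with hC
  have hCm : MeasurableSet C :=
    measurableSet_coverage hΦm (by omega) (by linarith) (by linarith)
  -- Convergence needs an exceptional null set in the joint space, whereas the coverage bound holds
  -- for every frozen data set and needs one only to identify the conditional probability.
  filter_upwards [hconv, condExp_indicator_of_indepFun hD hWm hDW hCm] with ω h1 h2 hβ
  refine ⟨h1 hβ, ?_⟩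
  have h3 := coverage_of_beta_lt_top (hΦd (D ω)) ht hk hB hβ hα0 hα1 hξ hind hQ hJ hJind hJu hξJ
  refine h3.trans_eq ?_
  exact congrArg _ h2.symm
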